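/- Let $\lambda>0$, $0<\alpha<1$, $\beta>0$, and let the block sizes $B=B(n)\in\mathbb N$ satisfy $B(n)\sim\beta n^{\alpha}/\lambda$ as $n\to\infty$. For each $n\ge1$ let $G^{(n)}\sim\mathrm{ER}_n(\min(1,\lambda n^{-\alpha}))$ be an Erdős–Rényi graph on $[n]$, let the initial vertex be uniform on $[n]$, and let the vertices carry i.i.d. $\mathrm{Unif}[0,1]$ costs, all independent. *Approximate gradient descent.* A vertex is unexplored until it belongs to a partial neighbourhood; the initial vertex counts as explored from the start. On arriving at a vertex, the algorithm goes through the vertices that are unexplored at that moment (in increasing order of labels) in blocks of $B$, the last block being possibly smaller. In step $i\ge1$ the next block is inspected, and its vertices that are adjacent to the current vertex form the partial neighbourhood $\mathcal N_i$, which becomes explored. If some vertex of $\mathcal N_i$ has a lower cost than the current vertex, the algorithm moves to the one of lowest cost and starts anew from there; otherwise it stays. Let $X_i$ and $U_i$ be the cost of the current vertex and the number of unexplored vertices at the beginning of step $i$. The running time is $$\mathcal S^{(n)}=\inf\{i\ge n/B:\ X_i=X_j\ \text{and}\ i=j+\lceil U_j/B\rceil\ \text{for some } j\ge1\},$$ i.e.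 the algorithm runs until all vertices that were unexplored on arrival at the current vertex have been inspected without an improvement. Let $\mathcal E^{(n)}=\sum_{i=1}^{\mathcal S^{(n)}}|\mathcal N_i|$ be the number of explored cost values. *Coupling.* Let $W_0,W_1,\dots$ be i.i.d. $\mathrm{Unif}[0,1]$ and, for each $n$, independent of $G^{(n)}$ and the initial vertex. For every $n$ the costs are drawn from this sequence in the order of exploration: almost surely the initial vertex has cost $W_0$, and the $k$-th vertex explored after it has cost $W_k$ (vertices explored in the same step being ordered by label). *Poisson processes.* Let $K=K(n)=\lfloor\lambda n^{1-\alpha}\rfloor$. Let $0=L_0<L_1<\cdots$ be the indices of the successive strict minimal records of $(W_k)$ and $\tau_j=L_{j+1}-L_j$. For $t\ge0$ let $$N^{(i)}_t=\#\{j\ge0:-\ln W_{L_j}\le t,\ \tau_j=i\}\quad(1\le i<K),\qquad N^{(K)}_t=\#\{j\ge0:-\ln W_{L_j}\le t,\ \tau_j>K\},$$ and set $$T_K=\inf\{t\ge0:N^{(K)}_t>0\},\qquad \tilde{\mathcal S}^{(n)}=K+\sum_{i=1}^{K-1}i\,N^{(i)}_{T_K}.$$ **Theorem.** For every $n$, $N^{(1)},\dots,N^{(K)}$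 are independent inhomogeneous Poisson processes, of intensities $\lambda_i(t)=(1-e^{-t})^{i-1}e^{-t}$ for $1\le i<K$ and $\lambda_K(t)=(1-e^{-t})^{K}$. Moreover, as $n\to\infty$, $$\mathbb E\left|\frac{\mathcal S^{(n)}}{n^{1-\alpha}}-\frac{\tilde{\mathcal S}^{(n)}}{\beta n^{1-\alpha}}\right|\to0\qquad\text{and}\qquad \frac{\mathbb E\left|\mathcal E^{(n)}-\tilde{\mathcal S}^{(n)}\right|}{n^{1-\alpha}}\to0 .$$ -/

import Mathlib

open MeasureTheory ProbabilityTheory Filter Topology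
open scoped NNReal ENNReal

noncomputable section

/-! ### Approximate gradient descent on a graph -/

/-- State of approximate gradient descent: the vertex the algorithm is currently at, the set of
unexplored vertices (those that have not belonged to any partial neighbourhood so far), and the
list of the unexplored vertices that have not yet been inspected from the current vertex, in
increasing order of their labels. -/
structure AGDState (n : ℕ) where
  vertex : Fin n
  unexplored : Finset (Fin n)
  pending : List (Fin n)

/-- The initial state, at the vertex `v`: all the other vertices are unexplored. -/
def agdInit {n : ℕ} (v : Fin n) : AGDState n :=
  ⟨v, Finset.univ.erase v, (Finset.univ.erase v).sort⟩

open Classical in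
/-- The partial neighbourhood found in one step: the neighbours of the current vertex among the
next `B` vertices to be inspected (or among those that are left, if fewer than `B` are left). -/
def agdPartialNbhd {n : ℕ} (G : SimpleGraph (Fin n)) (B : ℕ) (s : AGDState n) : List (Fin n) :=
  (s.pending.take B).filter (fun u => decide (G.Adj s.vertex u))

open Classical in
/-- One step of approximate gradient descent on `G` with cost function `c` and block size `B`.
The partial neighbourhood becomes explored. If its cheapest vertex is cheaper than the current
vertex, the algorithm moves there and restarts the inspection with all unexplored vertices;
otherwise it stays and goes on to the next block. -/
def agdStep {n : ℕ} (G : SimpleGraph (Fin n)) (c : Fin n → ℝ) (B : ℕ) (s : AGDState n) :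
    AGDState n :=
  let nb := agdPartialNbhd G B s
  let unexplored' := s.unexplored \ nb.toFinset
  match nb.argmin c with
  | some u =>
    if c u < c s.vertex then ⟨u, unexplored', unexplored'.sort⟩
    else ⟨s.vertex, unexplored', s.pending.drop B⟩
  | none => ⟨s.vertex, unexplored', s.pending.drop B⟩

/-- The state in which step `i` finds the algorithm, for `i ≥ 1`; state `1` is the initial one.
Once all the unexplored vertices have been inspected from a vertex without an improvement, the
state no longer changes. -/
def agdState {n : ℕ} (G : SimpleGraph (Fin n)) (c : Fin n → ℝ) (v : Fin n) (B i : ℕ) :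
    AGDState n :=
  (agdStep G c B)^[i - 1] (agdInit v)

/-- `X_i`: the cost of the vertex at which the algorithm is during step `i`. -/
def agdCost {n : ℕ} (G : SimpleGraph (Fin n)) (c : Fin n → ℝ) (v : Fin n) (B i : ℕ) : ℝ :=
  c (agdState G c v B i).vertex

/-- `U_i`: the number of unexplored vertices during step `i`. -/
def agdUnexplored {n : ℕ} (G : SimpleGraph (Fin n)) (c : Fin n → ℝ) (v : Fin n) (B i : ℕ) : ℕ :=
  (agdState G c v B i).unexplored.card

/-- `E_i`: the number of vertices explored in step `i`. -/
def agdNewlyExplored {n : ℕ} (G : SimpleGraph (Fin n)) (c : Fin n → ℝ) (v : Fin n) (B i : ℕ) : ℕ :=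
  (agdPartialNbhd G B (agdState G c v B i)).length

/-- The running time: the first `i ≥ n / B` such that the cost did not change since the step
`j = i - ⌈U_j / B⌉`, which means that all the vertices unexplored at step `j` have been inspected
from the current vertex, `B` at a time, without finding a lower cost. -/
def agdRunningTime {n : ℕ} (G : SimpleGraph (Fin n)) (c : Fin n → ℝ) (v : Fin n) (B : ℕ) : ℕ :=
  sInf {i : ℕ | (n : ℝ) / B ≤ i ∧ ∃ j : ℕ, 1 ≤ j ∧
    i = j + ⌈(agdUnexplored G c v B j : ℝ) / B⌉₊ ∧ agdCost G c v B i = agdCost G c v B j}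

/-- The number of cost values explored during the run. -/
def agdTotalExplored {n : ℕ} (G : SimpleGraph (Fin n)) (c : Fin n → ℝ) (v : Fin n) (B : ℕ) : ℕ :=
  ∑ i ∈ Finset.Icc 1 (agdRunningTime G c v B), agdNewlyExplored G c v B i

/-- The vertices explored before or in step `m`, in the order of their exploration, starting with
the initial vertex. -/
def agdExplorationOrder {n : ℕ} (G : SimpleGraph (Fin n)) (c : Fin n → ℝ) (v : Fin n) (B m : ℕ) :
    List (Fin n) :=
  v :: (List.range m).flatMap (fun i => agdPartialNbhd G B (agdState G c v B (i + 1)))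

/-- Whenever a vertex is explored, its cost is the next term of the sequence `w`. -/
def AGDCostsDrawnFrom {n : ℕ} (G : SimpleGraph (Fin n)) (c : Fin n → ℝ) (v : Fin n) (B : ℕ)
    (w : ℕ → ℝ) : Prop :=
  ∀ (m k : ℕ) (u : Fin n), (agdExplorationOrder G c v B m)[k]? = some u → c u = w k

/-! ### Poisson processes -/

/-- `N` is (the counting process of) an inhomogeneous Poisson process of intensity `lam`. -/
structure IsInhomogeneousPoisson {Ω : Type*} [MeasurableSpace Ω] (N : ℝ≥0 → Ω → ℕ) (lam : ℝ → ℝ)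
    (μ : Measure Ω) : Prop where
  measurable : ∀ t, Measurable (N t)
  zero : ∀ᵐ ω ∂μ, N 0 ω = 0
  monotone : ∀ᵐ ω ∂μ, Monotone (fun t => N t ω)
  rightContinuous : ∀ᵐ ω ∂μ, ∀ t, ContinuousWithinAt (fun s => N s ω) (Set.Ici t) t
  indepIncrements : HasIndepIncrements N μ
  increment_law : ∀ s t : ℝ≥0, s ≤ t →
    HasLaw (fun ω => N t ω - N s ω) (poissonMeasure (∫ x in (s : ℝ)..t, lam x).toNNReal) μ

/-- `K(n) = ⌊λ n^{1-α}⌋`. -/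
def floorMeanDegree (lam α : ℝ) (n : ℕ) : ℕ :=
  ⌊lam * (n : ℝ) ^ (1 - α)⌋₊

/-- The intensities `λ_i(t) = (1 - e^{-t})^{i-1} e^{-t}` for `1 ≤ i < K`, and
`λ_K(t) = (1 - e^{-t})^K`. -/
def poissonIntensity (K i : ℕ) (t : ℝ) : ℝ :=
  if i < K then (1 - Real.exp (-t)) ^ (i - 1) * Real.exp (-t) else (1 - Real.exp (-t)) ^ K

/-- The functional `K + ∑_{i=1}^{K-1} i N^{(i)}_{T_K}` of a path of the processes
`N^{(1)}, …, N^{(K)}`, where `T_K` is the first time at which `N^{(K)}` is positive. -/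
def poissonFunctional (K : ℕ) (N : ℕ → ℝ≥0 → ℕ) : ℕ :=
  K + ∑ i ∈ Finset.Ico 1 K, i * N i (sInf {t : ℝ≥0 | 0 < N K t})

/-! ### The records of the sequence of costs -/

/-- The index of the `j`-th (strict, lower) record of the sequence `w`; the first term is record
number `0`. -/
def recordIndex (w : ℕ → ℝ) : ℕ → ℕ
  | 0 => 0
  | j + 1 => sInf {m : ℕ | recordIndex w j < m ∧ w m < w (recordIndex w j)}

/-- The jumping time: how long the `j`-th record stands. -/
def recordDuration (w : ℕ → ℝ) (j : ℕ) : ℕ :=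
  recordIndex w (j + 1) - recordIndex w j

/-- The process `N^{(i)}`, `1 ≤ i ≤ K`, of a sequence `w` of costs: the `j`-th record, of value `y`,
is placed at the time `- log y`. For `i < K`, `N^{(i)}` counts the records which stand for exactly
`i` terms of the sequence; `N^{(K)}` counts those which stand for more than `K` terms. -/
def recordProcess (w : ℕ → ℝ) (K i : ℕ) (t : ℝ≥0) : ℕ :=
  Set.ncard {j : ℕ | - Real.log (w (recordIndex w j)) ≤ t ∧
    if i < K then recordDuration w j = i else K < recordDuration w j}

end

/-! Put `p = λ n^{-α}`. The costs are revealed in the order of exploration, so every vertex the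
algorithm moves to is a strict record of `W`, and the algorithm stops once the current minimum has
survived a full inspection of the unexplored vertices. If neighbourhoods are spread evenly over the
labels, a full inspection explores about `p n ≈ K` vertices and a single step about `p B ≈ β`. Hence
the number `E` of explored costs should be close to `ageTime W K`, the first index at which the
current minimum has stood for `K` terms, and the running time should be close to `E / (p B)`.

To make this rigorous, the evenness is stated as a deterministic property, `IsPseudoRandom`, which
holds for all vertices and all initial segments of labels at once. It therefore applies to the
unexplored sets produced by the algorithm, although these depend on the graph and on the costs. The
correction due to explored vertices is controlled by codegrees and by the number of visits, which is
at most the number of records. `agd_estimates` concludes that `E` lies between `ageTime W D` and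
`ageTime W (D + d)` with `D ≤ K ≤ D + d`, and that `p B S` is close to `E`. Chernoff's bound for the
graph and the martingale `2 ^ recordCount * runningMin` for the number of records make the
exceptional event smaller than any power of `n`, so that crude polynomial bounds suffice there.

The age time is stable in its level: its increase from `D` to `D + d` is at most `d` unless some
record has a duration between `D + 1` and `D + d`. The expected number of records of duration `D +
1` is at most `1 / (D + 1)`, by a telescoping sum, so this has probability at most `d / (D + 1)`,
which tends to `0`. On that event the age time is handled by uniform integrability: among
consecutive windows of length `2 D`, the first one whose minimum falls in its first half bounds it,
which gives a geometric tail (`setLIntegral_ageTime_le`). Finally `ageTime W K` and the Poisson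
functional differ only by the records of duration exactly `K`, which no process counts; they
contribute at most `1` in mean.

The Poisson statement rests on an exact formula, `integral_record_product`, for the mean of a
product over the records of factors that depend on value and duration. A record of value `x` is
beaten at each term with probability `x`, and the next record is uniform on `[0, x]`; this
determines an explicit value function, hence a martingale, and the mean is `exp (∫₀¹ ψ)`. With
exponential factors and `x = exp (-t)`, the exponent becomes the sum over the classes `i` of `∫
λ_i(t) (exp (I f_i(t)) - 1) dt`. This is the joint characteristic function of independent
inhomogeneous Poisson processes, from which laws, independent increments and independence are read
off. -/

noncomputable section

/-! ### Dynamics of the algorithm, visit by visit -/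

section AGD

variable {n : ℕ} {G : SimpleGraph (Fin n)} {c : Fin n → ℝ} {v : Fin n} {B : ℕ}

open Classical in
theorem agdStep_stay {s : AGDState n}
    (h : ∀ u ∈ agdPartialNbhd G B s, ¬ c u < c s.vertex) :
    agdStep G c B s =
      ⟨s.vertex, s.unexplored \ (agdPartialNbhd G B s).toFinset, s.pending.drop B⟩ := by
  unfold agdStep
  simp only
  cases hm : (agdPartialNbhd G B s).argmin c with
  | none => congr
  | some u =>
    have hu : u ∈ agdPartialNbhd G B s := List.argmin_mem (by rw [hm]; rfl)
    simp only [if_neg (h u hu)]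

open Classical in
theorem agdStep_move {s : AGDState n} {u : Fin n}
    (hu : u ∈ agdPartialNbhd G B s) (hc : c u < c s.vertex) :
    ∃ y ∈ agdPartialNbhd G B s, c y < c s.vertex ∧ (∀ z ∈ agdPartialNbhd G B s, c y ≤ c z) ∧
      agdStep G c B s = ⟨y, s.unexplored \ (agdPartialNbhd G B s).toFinset,
        (s.unexplored \ (agdPartialNbhd G B s).toFinset).sort⟩ := by
  unfold agdStep
  simp only
  cases hm : (agdPartialNbhd G B s).argmin c with
  | none => rw [List.argmin_eq_none] at hm; simp [hm] at hu
  | some y =>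
    have hy : y ∈ (agdPartialNbhd G B s).argmin c := by rw [hm]; rfl
    have hlt : c y < c s.vertex := (List.le_of_mem_argmin hu hy).trans_lt hc
    refine ⟨y, List.argmin_mem hy, hlt, fun z hz => List.le_of_mem_argmin hz hy, ?_⟩
    simp only [if_pos hlt]

theorem agdStep_cost_le (s : AGDState n) : c (agdStep G c B s).vertex ≤ c s.vertex := by
  by_cases h : ∀ u ∈ agdPartialNbhd G B s, ¬ c u < c s.vertex
  · rw [agdStep_stay h]
  · push Not at h
    obtain ⟨u, hu, hc⟩ := h
    obtain ⟨y, -, hy, -, he⟩ := agdStep_move hu hc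
    rw [he]
    exact hy.le

theorem agdCost_antitone {i j : ℕ} (hij : i ≤ j) : agdCost G c v B j ≤ agdCost G c v B i := by
  have key : ∀ k, c ((agdStep G c B)^[k + 1] (agdInit v)).vertex
      ≤ c ((agdStep G c B)^[k] (agdInit v)).vertex := fun k => by
    rw [Function.iterate_succ_apply']
    exact agdStep_cost_le _
  exact antitone_nat_of_succ_le (f := fun k => c ((agdStep G c B)^[k] (agdInit v)).vertex) key
    (Nat.sub_le_sub_right hij 1)

theorem agdExplorationOrder_succ (m : ℕ) :
    agdExplorationOrder G c v B (m + 1) = agdExplorationOrder G c v B m ++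
      agdPartialNbhd G B ((agdStep G c B)^[m] (agdInit v)) := by
  simp [agdExplorationOrder, List.range_succ, agdState]

theorem length_agdExplorationOrder (m : ℕ) :
    (agdExplorationOrder G c v B m).length
      = ∑ i ∈ Finset.Icc 1 m, agdNewlyExplored G c v B i + 1 := by
  induction m with
  | zero => simp [agdExplorationOrder]
  | succ m ih =>
    rw [agdExplorationOrder_succ, List.length_append, ih, Finset.sum_Icc_succ_top (by omega)]
    simp only [agdNewlyExplored, agdState, Nat.add_sub_cancel]
    ring

theorem length_agdPartialNbhd_le (s : AGDState n) : (agdPartialNbhd G B s).length ≤ B :=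
  (List.length_filter_le _ _).trans (List.length_take_le _ _)

theorem length_agdExplorationOrder_le (m : ℕ) :
    (agdExplorationOrder G c v B m).length ≤ m * B + 1 := by
  induction m with
  | zero => simp [agdExplorationOrder]
  | succ m ih =>
    rw [agdExplorationOrder_succ, List.length_append]
    have := length_agdPartialNbhd_le (G := G) (B := B) ((agdStep G c B)^[m] (agdInit v))
    linarith [add_one_mul m B]

open Classical in
/-- The neighbours of `x` among the first `t` elements of `U`. -/
def adjAmongFirst (G : SimpleGraph (Fin n)) (x : Fin n) (U : Finset (Fin n)) (t : ℕ) :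
    List (Fin n) :=
  (U.sort.take t).filter (fun u => decide (G.Adj x u))

theorem mem_of_mem_adjAmongFirst {x u : Fin n} {U : Finset (Fin n)} {t : ℕ}
    (h : u ∈ adjAmongFirst G x U t) : u ∈ U ∧ G.Adj x u := by
  classical
  unfold adjAmongFirst at h
  rw [List.mem_filter] at h
  exact ⟨(Finset.mem_sort _).1 (List.mem_of_mem_take h.1), by simpa using h.2⟩

theorem nodup_adjAmongFirst (x : Fin n) (U : Finset (Fin n)) (t : ℕ) :
    (adjAmongFirst G x U t).Nodup :=
  ((U.sort_nodup _).sublist (List.take_sublist _ _)).filter _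

theorem adjAmongFirst_add (x : Fin n) (U : Finset (Fin n)) (t s : ℕ) :
    adjAmongFirst G x U (t + s) = adjAmongFirst G x U t ++
      ((U.sort.drop t).take s).filter (fun u => @decide (G.Adj x u) (Classical.propDecidable _)) := by
  unfold adjAmongFirst
  rw [List.take_add, List.filter_append]

theorem adjAmongFirst_of_le {x : Fin n} {U : Finset (Fin n)} {t : ℕ} (h : U.card ≤ t) :
    adjAmongFirst G x U t = adjAmongFirst G x U U.card := by
  unfold adjAmongFirst
  rw [List.take_of_length_le (by simpa using h), List.take_of_length_le (by simp)]

/-- As long as no cheaper neighbour is found, the algorithm inspects the unexplored vertices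
block by block. -/
theorem agd_epoch {a : ℕ} {x : Fin n} {U : Finset (Fin n)}
    (hs : (agdStep G c B)^[a] (agdInit v) = ⟨x, U, U.sort⟩) (k : ℕ)
    (hk : ∀ u ∈ adjAmongFirst G x U (k * B), ¬ c u < c x) :
    (agdStep G c B)^[a + k] (agdInit v)
      = ⟨x, U \ (adjAmongFirst G x U (k * B)).toFinset, U.sort.drop (k * B)⟩ ∧
    agdExplorationOrder G c v B (a + k)
      = agdExplorationOrder G c v B a ++ adjAmongFirst G x U (k * B) := by
  classical
  induction k with
  | zero => simp [hs, adjAmongFirst]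
  | succ k ih =>
    have e : adjAmongFirst G x U ((k + 1) * B) = adjAmongFirst G x U (k * B) ++
        ((U.sort.drop (k * B)).take B).filter
          (fun u => @decide (G.Adj x u) (Classical.propDecidable _)) := by
      rw [add_one_mul, adjAmongFirst_add]
    obtain ⟨h1, h2⟩ := ih (fun u hu => hk u (by rw [e]; exact List.mem_append_left _ hu))
    have hnb : agdPartialNbhd G B ((agdStep G c B)^[a + k] (agdInit v))
        = ((U.sort.drop (k * B)).take B).filter
          (fun u => @decide (G.Adj x u) (Classical.propDecidable _)) := by
      rw [h1]; rfl
    constructor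
    · rw [← add_assoc, Function.iterate_succ_apply', agdStep_stay, hnb, h1, e]
      · simp only [List.toFinset_append, List.drop_drop, AGDState.mk.injEq, true_and]
        constructor
        · ext u; simp; tauto
        · congr 1; ring
      · rw [hnb, h1]
        intro u hu
        exact hk u (by rw [e]; exact List.mem_append_right _ hu)
    · rw [← add_assoc, agdExplorationOrder_succ, h2, hnb, e, List.append_assoc]

theorem card_sub_le_card_sdiff {x : Fin n} {U : Finset (Fin n)} {t : ℕ} :
    U.card - t ≤ (U \ (adjAmongFirst G x U t).toFinset).card := by
  classical
  have h1 : (adjAmongFirst G x U t).toFinset.card ≤ t :=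
    (List.toFinset_card_le _).trans ((List.length_filter_le _ _).trans (List.length_take_le _ _))
  have := Finset.le_card_sdiff (adjAmongFirst G x U t).toFinset U
  omega

end AGD

section AGD

variable {n : ℕ} {G : SimpleGraph (Fin n)} {c : Fin n → ℝ} {v : Fin n} {B : ℕ}

/-- After `a` steps the algorithm has just arrived at the vertex `x`, the `l`-th explored one, and
`U` is the set of unexplored vertices. -/
structure AGDArrival (G : SimpleGraph (Fin n)) (c : Fin n → ℝ) (v : Fin n) (B a l : ℕ) (x : Fin n)
    (U : Finset (Fin n)) : Prop where
  state : (agdStep G c B)^[a] (agdInit v) = ⟨x, U, U.sort⟩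
  nodup : (agdExplorationOrder G c v B a).Nodup
  mem_iff : ∀ u, u ∈ U ↔ u ∉ agdExplorationOrder G c v B a
  index : (agdExplorationOrder G c v B a)[l]? = some x
  min : ∀ u ∈ agdExplorationOrder G c v B a, c x ≤ c u
  left : ∀ j, 1 ≤ j → j ≤ a → ∀ i, j + ⌈(agdUnexplored G c v B j : ℝ) / B⌉₊ ≤ i →
    agdCost G c v B i < agdCost G c v B j
  time_le : a + n ≤ (agdExplorationOrder G c v B a).length * n

theorem agdArrival_init : AGDArrival G c v B 0 0 v (Finset.univ.erase v) where
  state := rfl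
  nodup := by simp [agdExplorationOrder]
  mem_iff u := by simp [agdExplorationOrder]
  index := by simp [agdExplorationOrder]
  min u hu := by simp [agdExplorationOrder] at hu; simp [hu]
  left j h1 h2 := by omega
  time_le := by simp [agdExplorationOrder]

theorem AGDArrival.card_add {a l : ℕ} {x : Fin n} {U : Finset (Fin n)}
    (h : AGDArrival G c v B a l x U) : U.card + (agdExplorationOrder G c v B a).length = n := by
  classical
  have h1 : U = (agdExplorationOrder G c v B a).toFinsetᶜ := by
    ext u; simp [h.mem_iff]
  have h2 := Finset.card_compl (agdExplorationOrder G c v B a).toFinset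
  have h3 := Finset.card_le_univ (agdExplorationOrder G c v B a).toFinset
  rw [← h1, List.toFinset_card_of_nodup h.nodup, Fintype.card_fin] at h2
  rw [List.toFinset_card_of_nodup h.nodup, Fintype.card_fin] at h3
  omega

/-- A step explores at most `B` vertices, so during a visit `j + ⌈U_j / B⌉` never drops below its
value at the arrival step `a + 1`. Applied from a later step of the visit, the stopping rule thus
cannot take effect earlier than from the arrival step. -/
theorem AGDArrival.le_ceil {a l : ℕ} {x : Fin n} {U : Finset (Fin n)}
    (h : AGDArrival G c v B a l x U) (hB : 0 < B) {k : ℕ}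
    (hk : ∀ u ∈ adjAmongFirst G x U (k * B), ¬ c u < c x) :
    agdCost G c v B (a + k + 1) = c x ∧
    ⌈(U.card : ℝ) / B⌉₊ ≤ k + ⌈(agdUnexplored G c v B (a + k + 1) : ℝ) / B⌉₊ := by
  obtain ⟨h1, -⟩ := agd_epoch h.state k hk
  refine ⟨by simp [agdCost, agdState, h1], ?_⟩
  have h2 := card_sub_le_card_sdiff (G := G) (x := x) (U := U) (t := k * B)
  have h3 : agdUnexplored G c v B (a + k + 1) =
      (U \ (adjAmongFirst G x U (k * B)).toFinset).card := by
    simp [agdUnexplored, agdState, h1]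
  rw [Nat.ceil_le, div_le_iff₀ (by positivity)]
  have h4 := Nat.le_ceil ((agdUnexplored G c v B (a + k + 1) : ℝ) / B)
  rw [div_le_iff₀ (by positivity)] at h4
  have h5 : (U.card : ℝ) ≤ agdUnexplored G c v B (a + k + 1) + k * B := by
    rw [h3]; norm_cast; omega
  push_cast
  linarith

/-- Here `k` is the number of blocks inspected in vain before the improving one. The lower bound on
`l'` records that `y` was found in the improving block; it controls the age that `y` already has on
arrival. -/
theorem AGDArrival.final_or_next {a l : ℕ} {x : Fin n} {U : Finset (Fin n)}
    (h : AGDArrival G c v B a l x U) (hB : 0 < B) :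
    (∀ u ∈ U, G.Adj x u → ¬ c u < c x) ∨
    ∃ k l' y, k * B < U.card ∧ (∀ u ∈ adjAmongFirst G x U (k * B), ¬ c u < c x) ∧ c y < c x ∧
      AGDArrival G c v B (a + (k + 1)) l' y (U \ (adjAmongFirst G x U ((k + 1) * B)).toFinset) ∧
      agdExplorationOrder G c v B (a + (k + 1))
        = agdExplorationOrder G c v B a ++ adjAmongFirst G x U ((k + 1) * B) ∧
      (agdExplorationOrder G c v B a).length + (adjAmongFirst G x U (k * B)).length ≤ l' := by
  classical
  rw [or_iff_not_imp_left]
  intro hne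
  push Not at hne
  obtain ⟨u₀, hu₀U, hu₀x, hu₀c⟩ := hne
  have hex : ∃ k, ∃ u ∈ adjAmongFirst G x U (k * B), c u < c x := by
    refine ⟨U.card, u₀, ?_, hu₀c⟩
    unfold adjAmongFirst
    rw [List.take_of_length_le (by simpa using Nat.le_mul_of_pos_right _ hB)]
    simp [hu₀U, hu₀x]
  obtain ⟨k, hk⟩ : ∃ k, Nat.find hex = k + 1 := by
    refine Nat.exists_eq_succ_of_ne_zero fun h0 => ?_
    have := Nat.find_spec hex
    rw [h0] at this
    simp [adjAmongFirst] at this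
  have hspec := Nat.find_spec hex
  rw [hk] at hspec
  have hmin : ∀ u ∈ adjAmongFirst G x U (k * B), ¬ c u < c x := by
    have := Nat.find_min hex (m := k) (by omega)
    push Not at this
    simpa using this
  obtain ⟨u, hu, huc⟩ := hspec
  -- If `k` blocks exhausted `U`, the next block would be empty and could not bring an improvement.
  have hkU : k * B < U.card := by
    by_contra hcon
    push Not at hcon
    rw [adjAmongFirst_of_le (hcon.trans (Nat.mul_le_mul_right _ (Nat.le_succ k))),
      ← adjAmongFirst_of_le hcon] at hu
    exact hmin u hu huc
  obtain ⟨h1, h2⟩ := agd_epoch h.state k hmin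
  have hsplit : adjAmongFirst G x U ((k + 1) * B) = adjAmongFirst G x U (k * B) ++
      agdPartialNbhd G B ((agdStep G c B)^[a + k] (agdInit v)) := by
    rw [add_one_mul, adjAmongFirst_add, h1]
    rfl
  have hu' : u ∈ agdPartialNbhd G B ((agdStep G c B)^[a + k] (agdInit v)) := by
    rw [hsplit, List.mem_append] at hu
    exact hu.resolve_left fun hu => hmin u hu huc
  obtain ⟨y, hy, hyx, hymin, hstep⟩ := agdStep_move (c := c) hu' (by rw [h1]; exact huc)
  simp only [h1] at hyx
  have hord : agdExplorationOrder G c v B (a + (k + 1))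
      = agdExplorationOrder G c v B a ++ adjAmongFirst G x U ((k + 1) * B) := by
    rw [← add_assoc, agdExplorationOrder_succ, h2, hsplit, List.append_assoc]
  have hU' : (U \ (adjAmongFirst G x U (k * B)).toFinset) \
      (agdPartialNbhd G B ((agdStep G c B)^[a + k] (agdInit v))).toFinset
      = U \ (adjAmongFirst G x U ((k + 1) * B)).toFinset := by
    rw [hsplit, List.toFinset_append]
    ext u; simp; tauto
  have hstate : (agdStep G c B)^[a + (k + 1)] (agdInit v) =
      ⟨y, U \ (adjAmongFirst G x U ((k + 1) * B)).toFinset,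
        (U \ (adjAmongFirst G x U ((k + 1) * B)).toFinset).sort⟩ := by
    rw [← add_assoc, Function.iterate_succ_apply', hstep, ← hU']
    simp only [h1]
  obtain ⟨r, hr, hry⟩ := List.getElem_of_mem hy
  refine ⟨k, (agdExplorationOrder G c v B a).length + (adjAmongFirst G x U (k * B)).length + r, y,
    hkU, hmin, hyx, ⟨hstate, ?_, ?_, ?_, ?_, ?_, ?_⟩, hord, Nat.le_add_right _ _⟩
  · rw [hord, List.nodup_append]
    refine ⟨h.nodup, nodup_adjAmongFirst _ _ _, ?_⟩
    rintro z hz _ hz' rfl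
    exact (h.mem_iff z).1 (mem_of_mem_adjAmongFirst hz').1 hz
  · intro z
    rw [hord, Finset.mem_sdiff, h.mem_iff, List.mem_append, List.mem_toFinset]
    tauto
  · rw [hord, hsplit, ← List.append_assoc, List.getElem?_append_right (by simp)]
    simp only [List.length_append, Nat.add_sub_cancel_left]
    rw [List.getElem?_eq_getElem hr, hry]
  · intro z hz
    rw [hord, hsplit, List.mem_append, List.mem_append] at hz
    rcases hz with hz | hz | hz
    · exact hyx.le.trans (h.min z hz)
    · exact hyx.le.trans (not_lt.1 (hmin z hz))
    · exact hymin z hz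
  -- For a step `j` of the visit just ended, `le_ceil` together with `k < ⌈|U| / B⌉` places `i`
  -- after the move to `y`, where the cost has dropped.
  · intro j hj1 hj2 i hi
    rcases le_or_gt j a with hja | hja
    · exact h.left j hj1 hja i hi
    obtain ⟨k', rfl⟩ : ∃ k', j = a + k' + 1 := ⟨j - a - 1, by omega⟩
    have hk' : k' ≤ k := by omega
    have hmin' : ∀ u ∈ adjAmongFirst G x U (k' * B), ¬ c u < c x := fun z hz => by
      refine hmin z ?_
      obtain ⟨d, rfl⟩ := Nat.exists_eq_add_of_le hk'
      rw [add_mul, adjAmongFirst_add]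
      exact List.mem_append_left _ hz
    obtain ⟨e1, e2⟩ := h.le_ceil hB hmin'
    have e3 : k < ⌈(U.card : ℝ) / B⌉₊ := by
      rw [Nat.lt_ceil, lt_div_iff₀ (by positivity)]
      exact_mod_cast hkU
    rw [e1]
    refine (agdCost_antitone (show a + (k + 1) + 1 ≤ i by omega)).trans_lt ?_
    simpa [agdCost, agdState, hstate] using hyx
  -- A visit that ends with a move lasts at most `n` steps and explores at least one vertex.
  · have hpos : (agdExplorationOrder G c v B a).length + 1
        ≤ (agdExplorationOrder G c v B (a + (k + 1))).length := by
      rw [hord, List.length_append]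
      exact Nat.add_le_add_left (List.length_pos_of_mem hu) _
    have hkn : k + 1 ≤ n := by
      have := U.card_le_univ
      rw [Fintype.card_fin] at this
      have := Nat.le_mul_of_pos_right k hB
      omega
    nlinarith [h.time_le, Nat.mul_le_mul_right n hpos]

/-- The arrival step at the last vertex satisfies the stopping rule. Steps of earlier visits are
excluded by `left`, since the cost drops before their deadline, and later steps of the last visit by
`le_ceil`. -/
theorem AGDArrival.runningTime_eq {a l : ℕ} {x : Fin n} {U : Finset (Fin n)}
    (h : AGDArrival G c v B a l x U) (hB : 0 < B) (hf : ∀ u ∈ U, G.Adj x u → ¬ c u < c x) :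
    agdRunningTime G c v B = a + 1 + ⌈(U.card : ℝ) / B⌉₊ ∧
    agdExplorationOrder G c v B (agdRunningTime G c v B) =
      agdExplorationOrder G c v B a ++ adjAmongFirst G x U U.card := by
  have hf' : ∀ k, ∀ u ∈ adjAmongFirst G x U (k * B), ¬ c u < c x := fun k u hu =>
    hf u (mem_of_mem_adjAmongFirst hu).1 (mem_of_mem_adjAmongFirst hu).2
  have hcost : ∀ k, agdCost G c v B (a + k + 1) = c x := fun k => (h.le_ceil hB (hf' k)).1
  have hS : agdRunningTime G c v B = a + 1 + ⌈(U.card : ℝ) / B⌉₊ := by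
    have hmem : a + 1 + ⌈(U.card : ℝ) / B⌉₊ ∈ {i : ℕ | (n : ℝ) / B ≤ i ∧ ∃ j : ℕ, 1 ≤ j ∧
        i = j + ⌈(agdUnexplored G c v B j : ℝ) / B⌉₊ ∧
        agdCost G c v B i = agdCost G c v B j} := by
      refine ⟨?_, a + 1, by omega, ?_, ?_⟩
      -- The requirement `i ≥ n / B` is automatic: on arrival at most `a * B + 1` vertices are
      -- explored, and all the others belong to `U`.
      · rw [div_le_iff₀ (by positivity)]
        have h1 := Nat.le_ceil ((U.card : ℝ) / B)
        rw [div_le_iff₀ (by positivity)] at h1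
        have h2 : (n : ℝ) ≤ U.card + (a * B + 1) := by
          have := h.card_add
          have := length_agdExplorationOrder_le (G := G) (c := c) (v := v) (B := B) a
          norm_cast
          omega
        have h3 : (1 : ℝ) ≤ B := by exact_mod_cast hB
        push_cast
        linarith
      · congr
        simp [agdState, h.state]
      · have := hcost ⌈(U.card : ℝ) / B⌉₊
        rw [show a + 1 + ⌈(U.card : ℝ) / B⌉₊ = a + ⌈(U.card : ℝ) / B⌉₊ + 1 by ring, this]
        exact (hcost 0).symm
    refine le_antisymm (Nat.sInf_le hmem) (le_csInf ⟨_, hmem⟩ ?_)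
    rintro i ⟨-, j, hj, rfl, hij⟩
    rcases le_or_gt j a with hja | hja
    · exact absurd hij (h.left j hj hja _ le_rfl).ne
    · obtain ⟨k', rfl⟩ : ∃ k', j = a + k' + 1 := ⟨j - a - 1, by omega⟩
      have := (h.le_ceil hB (hf' k')).2
      omega
  refine ⟨hS, ?_⟩
  rw [hS, add_assoc, (agd_epoch h.state _ (hf' _)).2]
  congr 1
  -- The step whose number is the running time is included in the count, but all of `U` has been
  -- inspected before it.
  refine adjAmongFirst_of_le ?_
  have h1 := Nat.le_ceil ((U.card : ℝ) / B)
  rw [div_le_iff₀ (by positivity)] at h1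
  have h3 : (1 : ℝ) ≤ B := by exact_mod_cast hB
  have : (U.card : ℝ) ≤ ((1 + ⌈(U.card : ℝ) / B⌉₊) * B : ℕ) := by push_cast; linarith
  exact_mod_cast this

theorem AGDArrival.runningTime_le {a l : ℕ} {x : Fin n} {U : Finset (Fin n)}
    (h : AGDArrival G c v B a l x U) (hB : 0 < B) (hf : ∀ u ∈ U, G.Adj x u → ¬ c u < c x) :
    agdRunningTime G c v B ≤ n * n + 1 ∧ agdTotalExplored G c v B ≤ n := by
  obtain ⟨h1, h2⟩ := h.runningTime_eq hB hf
  have h2 := congrArg List.length h2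
  rw [List.length_append, length_agdExplorationOrder] at h2
  have h3 := h.card_add
  have h4 : (adjAmongFirst G x U U.card).length ≤ U.card :=
    (List.length_filter_le _ _).trans (List.length_take_le _ _)
  have h5 : ⌈(U.card : ℝ) / B⌉₊ ≤ U.card := by
    rw [Nat.ceil_le]
    exact div_le_self (by positivity) (by exact_mod_cast hB)
  refine ⟨?_, by unfold agdTotalExplored; omega⟩
  have h6 := h.time_le
  have h7 : (agdExplorationOrder G c v B a).length * n ≤ n * n :=
    Nat.mul_le_mul_right _ (by omega)
  omega

/-- A property of the arrivals which is inherited from each arrival by the next one holds at the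
last arrival. -/
theorem agdArrival_induction (hB : 0 < B) {P : ℕ → ℕ → Fin n → Finset (Fin n) → Prop}
    (h0 : P 0 0 v (Finset.univ.erase v))
    (hP : ∀ a l x U k l' y, AGDArrival G c v B a l x U → P a l x U → k * B < U.card →
      (∀ u ∈ adjAmongFirst G x U (k * B), ¬ c u < c x) → c y < c x →
      AGDArrival G c v B (a + (k + 1)) l' y (U \ (adjAmongFirst G x U ((k + 1) * B)).toFinset) →
      agdExplorationOrder G c v B (a + (k + 1))
        = agdExplorationOrder G c v B a ++ adjAmongFirst G x U ((k + 1) * B) →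
      (agdExplorationOrder G c v B a).length + (adjAmongFirst G x U (k * B)).length ≤ l' →
      P (a + (k + 1)) l' y (U \ (adjAmongFirst G x U ((k + 1) * B)).toFinset)) :
    ∃ a l x U, AGDArrival G c v B a l x U ∧ P a l x U ∧ ∀ u ∈ U, G.Adj x u → ¬ c u < c x := by
  have key : ∀ m a l x U, U.card ≤ m → AGDArrival G c v B a l x U → P a l x U →
      ∃ a l x U, AGDArrival G c v B a l x U ∧ P a l x U ∧ ∀ u ∈ U, G.Adj x u → ¬ c u < c x := by
    intro m
    induction m with
    | zero =>
      intro a l x U hU h hp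
      refine ⟨a, l, x, U, h, hp, fun u hu => ?_⟩
      simp_all
    | succ m ih =>
      intro a l x U hU h hp
      rcases h.final_or_next hB with hf | ⟨k, l', y, h1, h2, h3, h4, h5, h6⟩
      · exact ⟨a, l, x, U, h, hp, hf⟩
      · refine ih _ _ _ _ ?_ h4 (hP a l x U k l' y h hp h1 h2 h3 h4 h5 h6)
        -- `y` is cheaper than everything explored before, so it is newly explored and the
        -- unexplored set has shrunk.
        have e1 := h.card_add
        have e2 := h4.card_add
        have e3 : y ∈ agdExplorationOrder G c v B (a + (k + 1)) :=
          List.mem_of_getElem? h4.index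
        rw [h5, List.mem_append] at e3
        have e4 : y ∈ adjAmongFirst G x U ((k + 1) * B) :=
          e3.resolve_left fun hy => absurd (h.min y hy) (not_le.2 h3)
        have e5 := List.length_pos_of_mem e4
        rw [h5, List.length_append] at e2
        omega
  exact key _ _ _ _ _ le_rfl agdArrival_init h0

end AGD

/-! ### Counting neighbours in pseudo-random graphs -/

section AGD

variable {n : ℕ} {G : SimpleGraph (Fin n)} {c : Fin n → ℝ} {v : Fin n} {B : ℕ}

/-- Crude bounds that hold on every graph; they serve on the atypical event. -/
theorem agdRunningTime_le (hB : 0 < B) :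
    agdRunningTime G c v B ≤ n * n + 1 ∧ agdTotalExplored G c v B ≤ n := by
  obtain ⟨a, l, x, U, h, -, hf⟩ := agdArrival_induction (G := G) (c := c) (v := v) hB
    (P := fun _ _ _ _ => True) trivial (fun _ _ _ _ _ _ _ _ _ _ _ _ _ _ _ => trivial)
  exact h.runningTime_le hB hf

/-- The number of records among the terms `w 0, …, w m`. -/
def recordCount (w : ℕ → ℝ) (m : ℕ) : ℕ :=
  ((Finset.range (m + 1)).filter (fun k => ∀ i < k, w k < w i)).card

theorem recordCount_lt {w : ℕ → ℝ} {m m' l : ℕ} (hml : m < l) (hlm : l ≤ m')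
    (h : ∀ i < l, w l < w i) : recordCount w m < recordCount w m' := by
  refine Finset.card_lt_card ⟨?_, fun hsub => ?_⟩
  · exact Finset.filter_subset_filter _ (Finset.range_subset_range.2 (by omega))
  · have := hsub (x := l) (by simp only [Finset.mem_filter, Finset.mem_range]; exact ⟨by omega, h⟩)
    simp only [Finset.mem_filter, Finset.mem_range] at this
    omega

open Classical in
/-- Pseudo-randomness of a graph on `Fin n` with edge density `p`: the neighbourhoods have the
right number of elements in every initial segment, and two of them have few common elements. -/
structure IsPseudoRandom (G : SimpleGraph (Fin n)) (p η κ : ℝ) : Prop where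
  card_sub_le : ∀ (x : Fin n) (q : ℕ), q ≤ n →
    |((Finset.univ.filter fun u : Fin n => G.Adj x u ∧ u.val < q).card : ℝ) - p * q| ≤ η
  codegree_le : ∀ x y : Fin n, x ≠ y →
    ((Finset.univ.filter fun u : Fin n => G.Adj x u ∧ G.Adj y u).card : ℝ) ≤ κ

open Classical in
theorem IsPseudoRandom.degree_le {p η κ : ℝ} (hG : IsPseudoRandom G p η κ) (x : Fin n) :
    ((Finset.univ.filter fun u : Fin n => G.Adj x u).card : ℝ) ≤ p * n + η := by
  have := (abs_le.1 (hG.card_sub_le x n le_rfl)).2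
  simp only [Fin.is_lt, and_true] at this
  linarith

/-- This turns the inspected part of `U` into a cut-off on labels, the form in which
pseudo-randomness is stated. The cut-off is the label of the first element not taken, or `n`. -/
theorem exists_mem_take_sort_iff (U : Finset (Fin n)) {t : ℕ} (ht : t ≤ U.card) :
    ∃ q ≤ n, ∀ u, u ∈ U.sort.take t ↔ u ∈ U ∧ u.val < q := by
  rcases ht.eq_or_lt with rfl | ht
  · refine ⟨n, le_rfl, fun u => ?_⟩
    rw [List.take_of_length_le (by simp)]
    simp
  · have hlen : t < U.sort.length := by simpa using ht
    refine ⟨(U.sort[t]).val, (U.sort[t]).isLt.le, fun u => ?_⟩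
    have hs : U.sort.SortedLT := Finset.sortedLT_sort U
    rw [List.mem_take_iff_getElem]
    constructor
    · rintro ⟨i, hi, rfl⟩
      refine ⟨(Finset.mem_sort (· ≤ ·)).1 (List.getElem_mem _), ?_⟩
      exact hs.strictMono_get (a := ⟨i, by omega⟩) (b := ⟨t, hlen⟩)
        (by rw [Fin.mk_lt_mk]; omega)
    · rintro ⟨hu, hlt⟩
      obtain ⟨i, hi, rfl⟩ := List.getElem_of_mem ((Finset.mem_sort (· ≤ ·)).2 hu)
      refine ⟨i, ?_, rfl⟩
      have : i < t := by
        by_contra hcon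
        push Not at hcon
        have := hs.strictMono_get.monotone (a := ⟨t, hlen⟩) (b := ⟨i, hi⟩)
          (by rw [Fin.mk_le_mk]; omega)
        exact absurd hlt (not_lt.2 this)
      omega

open Classical in
-- Both the neighbours and the size `t` are obtained from the segment of labels below `q` by
-- removing the part in `Uᶜ`: the first removal costs at most `R`, the second at most `p |Uᶜ|`.
-- Nothing is assumed on how `U` arises, so it may depend on the graph.
theorem IsPseudoRandom.abs_length_sub_le {p η κ : ℝ} (hG : IsPseudoRandom G p η κ) (hp : 0 ≤ p)
    {x : Fin n} {U : Finset (Fin n)} {R : ℝ}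
    (hR : ((Uᶜ.filter fun u => G.Adj x u).card : ℝ) ≤ R) {t : ℕ} (ht : t ≤ U.card) :
    |((adjAmongFirst G x U t).length : ℝ) - p * t| ≤ η + R + p * (Uᶜ.card : ℝ) := by
  obtain ⟨q, hq, hmem⟩ := exists_mem_take_sort_iff U ht
  have hnd : (U.sort.take t).Nodup := (U.sort_nodup _).sublist (List.take_sublist _ _)
  have e1 : (adjAmongFirst G x U t).length
      = ((U.filter fun u => u.val < q).filter fun u => G.Adj x u).card := by
    rw [← List.toFinset_card_of_nodup (nodup_adjAmongFirst x U t)]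
    congr 1
    ext u
    simp only [adjAmongFirst, List.mem_toFinset, List.mem_filter, hmem, Finset.mem_filter,
      decide_eq_true_eq]
  have e2 : t = (U.filter fun u => u.val < q).card := by
    have h1 : (U.sort.take t).length = t := by simpa using ht
    have h2 : (U.sort.take t).toFinset = U.filter fun u => u.val < q := by
      ext u
      simp only [List.mem_toFinset, hmem, Finset.mem_filter]
    rw [← h2, List.toFinset_card_of_nodup hnd, h1]
  have e3 : q = (U.filter fun u => u.val < q).card + (Uᶜ.filter fun u => u.val < q).card := by
    rw [← Finset.card_union_of_disjoint, ← Finset.filter_union, Finset.union_compl]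
    · rw [Fin.card_filter_val_lt]
      omega
    · exact Finset.disjoint_filter_filter disjoint_compl_right
  have e4 : (Finset.univ.filter fun u : Fin n => G.Adj x u ∧ u.val < q).card
      = ((U.filter fun u => u.val < q).filter fun u => G.Adj x u).card
        + ((Uᶜ.filter fun u => u.val < q).filter fun u => G.Adj x u).card := by
    rw [← Finset.card_union_of_disjoint, ← Finset.filter_union, ← Finset.filter_union,
      Finset.union_compl, Finset.filter_filter]
    · simp only [and_comm]
    · exact Finset.disjoint_filter_filter (Finset.disjoint_filter_filter disjoint_compl_right)
  have e5 : ((Uᶜ.filter fun u => u.val < q).filter fun u => G.Adj x u).card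
      ≤ (Uᶜ.filter fun u => G.Adj x u).card :=
    Finset.card_le_card (Finset.filter_subset_filter _ (Finset.filter_subset _ _))
  have e6 : (Uᶜ.filter fun u => u.val < q).card ≤ Uᶜ.card :=
    Finset.card_le_card (Finset.filter_subset _ _)
  have h1 := abs_le.1 (hG.card_sub_le x q hq)
  rw [e4] at h1
  rw [← e2] at e3
  have e3' : (q : ℝ) = t + ((Uᶜ.filter fun u => u.val < q).card : ℝ) := by exact_mod_cast e3
  have e5' : (((Uᶜ.filter fun u => u.val < q).filter fun u => G.Adj x u).card : ℝ) ≤ R :=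
    le_trans (by exact_mod_cast e5) hR
  have e6' : p * ((Uᶜ.filter fun u => u.val < q).card : ℝ) ≤ p * (Uᶜ.card : ℝ) :=
    mul_le_mul_of_nonneg_left (by exact_mod_cast e6) hp
  have e7 : 0 ≤ p * ((Uᶜ.filter fun u => u.val < q).card : ℝ) := mul_nonneg hp (Nat.cast_nonneg _)
  have e8 : (0 : ℝ) ≤ ((Uᶜ.filter fun u => u.val < q).filter fun u => G.Adj x u).card :=
    Nat.cast_nonneg _
  rw [e1, abs_le]
  rw [e3', mul_add] at h1
  push_cast at h1
  constructor <;> linarith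

theorem AGDArrival.compl_eq {a l : ℕ} {x : Fin n} {U : Finset (Fin n)}
    (h : AGDArrival G c v B a l x U) : Uᶜ = (agdExplorationOrder G c v B a).toFinset := by
  ext u; simp [h.mem_iff]

open Classical in
-- `Z` stands for the vertices already left and `L` for the explored ones. The covering bounds `L`
-- by degrees, and the part of `L` adjacent to `x` by codegrees, for which `x ∉ Z` is needed.
theorem IsPseudoRandom.card_explored_le {p η κ : ℝ} (hG : IsPseudoRandom G p η κ)
    {x : Fin n} {L : Finset (Fin n)} {Z : Finset (Fin n)} {M : ℝ} (hZ : (Z.card : ℝ) ≤ M)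
    (hxZ : x ∉ Z) (hκ : 0 ≤ κ) (hη : 0 ≤ p * n + η)
    (hcov : ∀ u ∈ L, u = v ∨ ∃ z ∈ Z, G.Adj z u) :
    ((L.filter fun u => G.Adj x u).card : ℝ) ≤ M * κ + 1 ∧ (L.card : ℝ) ≤ 1 + M * (p * n + η) := by
  constructor
  · have hsub : (L.filter fun u => G.Adj x u) ⊆ {v} ∪ Z.biUnion fun z =>
        Finset.univ.filter fun u => G.Adj x u ∧ G.Adj z u := by
      intro u hu
      rw [Finset.mem_filter] at hu
      rcases hcov u hu.1 with rfl | ⟨z, hz, hzu⟩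
      · simp
      · simp only [Finset.mem_union, Finset.mem_biUnion, Finset.mem_filter, Finset.mem_univ,
          true_and]
        exact Or.inr ⟨z, hz, hu.2, hzu⟩
    have h1 := (Finset.card_le_card hsub).trans (Finset.card_union_le _ _)
    have h2 : ((Z.biUnion fun z =>
        Finset.univ.filter fun u => G.Adj x u ∧ G.Adj z u).card : ℝ) ≤ Z.card * κ := by
      refine (Nat.cast_le.2 Finset.card_biUnion_le).trans ?_
      push_cast
      rw [← nsmul_eq_mul]
      exact Finset.sum_le_card_nsmul _ _ _ fun z hz => hG.codegree_le x z (by rintro rfl; exact hxZ hz)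
    have h3 : ((L.filter fun u => G.Adj x u).card : ℝ) ≤ 1 + ((Z.biUnion fun z =>
        Finset.univ.filter fun u => G.Adj x u ∧ G.Adj z u).card : ℝ) := by
      rw [Finset.card_singleton] at h1
      exact_mod_cast h1
    nlinarith
  · have hsub : L ⊆ {v} ∪ Z.biUnion fun z => Finset.univ.filter fun u => G.Adj z u := by
      intro u hu
      rcases hcov u hu with rfl | ⟨z, hz, hzu⟩
      · simp
      · simp only [Finset.mem_union, Finset.mem_biUnion, Finset.mem_filter, Finset.mem_univ,
          true_and]
        exact Or.inr ⟨z, hz, hzu⟩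
    have h1 := (Finset.card_le_card hsub).trans (Finset.card_union_le _ _)
    have h2 : ((Z.biUnion fun z =>
        Finset.univ.filter fun u => G.Adj z u).card : ℝ) ≤ Z.card * (p * n + η) := by
      refine (Nat.cast_le.2 Finset.card_biUnion_le).trans ?_
      push_cast
      rw [← nsmul_eq_mul]
      exact Finset.sum_le_card_nsmul _ _ _ fun z _ => hG.degree_le z
    have h3 : (L.card : ℝ) ≤ 1 + ((Z.biUnion fun z =>
        Finset.univ.filter fun u => G.Adj z u).card : ℝ) := by
      rw [Finset.card_singleton] at h1
      exact_mod_cast h1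
    nlinarith

end AGD

/-! ### The algorithm on a pseudo-random graph -/

section AGD

variable {n : ℕ} {G : SimpleGraph (Fin n)} {c : Fin n → ℝ} {v : Fin n} {B : ℕ}

/-- The bound on the deviation of the number of neighbours found from its mean, during the visit of
a vertex, when at most `M` vertices are visited. -/
def visitError (n : ℕ) (p η κ M : ℝ) : ℝ := η + (M * κ + 1) + p * (1 + M * (p * n + η))

/-- The quantitative properties of the arrival after `a` steps at the `l`-th explored vertex `x`. -/
structure AGDArrivalBounds (G : SimpleGraph (Fin n)) (c : Fin n → ℝ) (v : Fin n) (B : ℕ)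
    (w : ℕ → ℝ) (p δ b D : ℝ) (a l : ℕ) (x : Fin n) (V : ℕ) (Z : Finset (Fin n)) : Prop where
  card_le : Z.card ≤ V
  lt_of_mem : ∀ z ∈ Z, c x < c z
  covered : ∀ u ∈ agdExplorationOrder G c v B a, u = v ∨ ∃ z ∈ Z, G.Adj z u
  lt_recordCount : V < recordCount w ((agdExplorationOrder G c v B a).length - 1)
  time : |p * B * a - ((agdExplorationOrder G c v B a).length - 1)| ≤ V * δ
  age_lt : ∀ m l' : ℕ, m < (agdExplorationOrder G c v B a).length → l' ≤ m →
    (∀ k ≤ m, w l' ≤ w k) → (m : ℝ) < l' + D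
  length_le : ((agdExplorationOrder G c v B a).length : ℝ) ≤ l + 1 + b

/-- The explored set enters the error through its part adjacent to `x` and through its size; its
covering by the neighbourhoods of `Z` bounds both. The count of records gives `V + 1 ≤ M`. Values of
`t` beyond `|U|` are allowed because the last block may be incomplete. -/
theorem abs_length_adjAmongFirst_sub_le {p η κ M : ℝ} {w : ℕ → ℝ} {δ b D : ℝ}
    (hG : IsPseudoRandom G p η κ) (hp : 0 ≤ p) (hη : 0 ≤ η) (hκ : 0 ≤ κ)
    (hM : ∀ m < n, (recordCount w m : ℝ) ≤ M)
    {a l : ℕ} {x : Fin n} {U : Finset (Fin n)} (h : AGDArrival G c v B a l x U) {V : ℕ}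
    {Z : Finset (Fin n)} (hb : AGDArrivalBounds G c v B w p δ b D a l x V Z) :
    (∀ t ≤ U.card, |((adjAmongFirst G x U t).length : ℝ) - p * t| ≤ visitError n p η κ M) ∧
    (∀ t ≤ U.card + B, |((adjAmongFirst G x U t).length : ℝ) - p * t|
      ≤ visitError n p η κ M + p * B) ∧
    (V : ℝ) + 1 ≤ M ∧ ((agdExplorationOrder G c v B a).length : ℝ) ≤ 1 + M * (p * n + η) := by
  classical
  have hlen : 0 < (agdExplorationOrder G c v B a).length := by simp [agdExplorationOrder]
  have hV : (V : ℝ) + 1 ≤ M := by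
    refine le_trans ?_ (hM ((agdExplorationOrder G c v B a).length - 1) (by
      have := h.card_add
      omega))
    exact_mod_cast hb.lt_recordCount
  have hZ : (Z.card : ℝ) ≤ M := by
    have : (Z.card : ℝ) ≤ V := by exact_mod_cast hb.card_le
    linarith
  have hpn : 0 ≤ p * n + η := by positivity
  obtain ⟨h1, h2⟩ := hG.card_explored_le (x := x) (L := Uᶜ) (v := v) hZ
    (fun hx => lt_irrefl _ (hb.lt_of_mem x hx)) hκ hpn (fun u hu => by
      rw [h.compl_eq, List.mem_toFinset] at hu
      exact hb.covered u hu)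
  have key : ∀ t ≤ U.card, |((adjAmongFirst G x U t).length : ℝ) - p * t|
      ≤ visitError n p η κ M := fun t ht => by
    refine (hG.abs_length_sub_le hp h1 ht).trans ?_
    unfold visitError
    gcongr
  refine ⟨key, fun t ht => ?_, hV, ?_⟩
  · have hpB : 0 ≤ p * B := by positivity
    rcases le_or_gt t U.card with htU | htU
    · exact (key t htU).trans (le_add_of_nonneg_right hpB)
    · rw [adjAmongFirst_of_le htU.le]
      have h3 := abs_le.1 (key U.card le_rfl)
      have h4 : p * (t : ℝ) ≤ p * U.card + p * B := by
        rw [← mul_add]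
        exact mul_le_mul_of_nonneg_left (by exact_mod_cast ht) hp
      have h5 : p * (U.card : ℝ) ≤ p * t := mul_le_mul_of_nonneg_left (by exact_mod_cast htU.le) hp
      rw [abs_le]
      constructor <;> linarith
  · rwa [h.compl_eq, List.toFinset_card_of_nodup h.nodup] at h2

/-- A visit adds its own deviation to the time estimate and at least one record to the count. For
the ages, two cases arise during the visit. While `x` is the minimum, its age is at most what was
explored after it in its own block plus the number of its neighbours. A minimum found in the
improving block is no older than that block, which has at most `p * B + 2 * visitError` explored
vertices, as the counts at both of its ends are known up to `visitError`. -/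
theorem agdArrivalBounds_next {p η κ M D : ℝ} {w : ℕ → ℝ}
    (hG : IsPseudoRandom G p η κ) (hp : 0 ≤ p) (hη : 0 ≤ η) (hκ : 0 ≤ κ)
    (hM : ∀ m < n, (recordCount w m : ℝ) ≤ M) (hw : Function.Injective w)
    (hcw : AGDCostsDrawnFrom G c v B w)
    (hD : p * B + 2 * visitError n p η κ M + (p * n + η) < D)
    {a l k l' : ℕ} {x y : Fin n} {U : Finset (Fin n)} (h : AGDArrival G c v B a l x U) {V : ℕ}
    {Z : Finset (Fin n)}
    (hb : AGDArrivalBounds G c v B w p (visitError n p η κ M + p * B)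
      (p * B + 2 * visitError n p η κ M) D a l x V Z)
    (hkU : k * B < U.card) (hk : ∀ u ∈ adjAmongFirst G x U (k * B), ¬ c u < c x) (hyx : c y < c x)
    {U' : Finset (Fin n)} (h' : AGDArrival G c v B (a + (k + 1)) l' y U')
    (ho : agdExplorationOrder G c v B (a + (k + 1))
      = agdExplorationOrder G c v B a ++ adjAmongFirst G x U ((k + 1) * B))
    (hl' : (agdExplorationOrder G c v B a).length + (adjAmongFirst G x U (k * B)).length ≤ l') :
    AGDArrivalBounds G c v B w p (visitError n p η κ M + p * B)
      (p * B + 2 * visitError n p η κ M) D (a + (k + 1)) l' y (V + 1) (insert x Z) := by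
  classical
  obtain ⟨e1, e2, e3, e4⟩ := abs_length_adjAmongFirst_sub_le hG hp hη hκ hM h hb
  have hk1B : (k + 1) * B ≤ U.card + B := by rw [add_one_mul]; omega
  have f1 := abs_le.1 (e1 (k * B) hkU.le)
  -- For an incomplete last block the count stops at `|U|`, which only helps the upper bound; no
  -- extra `p * B` is lost here.
  have f2 : ((adjAmongFirst G x U ((k + 1) * B)).length : ℝ)
      ≤ p * ((k + 1) * B : ℕ) + visitError n p η κ M := by
    rcases le_or_gt ((k + 1) * B) U.card with hle | hlt
    · linarith [(abs_le.1 (e1 _ hle)).2]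
    · rw [adjAmongFirst_of_le hlt.le]
      have := (abs_le.1 (e1 _ le_rfl)).2
      have h5 : p * (U.card : ℝ) ≤ p * ((k + 1) * B : ℕ) :=
        mul_le_mul_of_nonneg_left (by exact_mod_cast hlt.le) hp
      linarith
  have f3 := abs_le.1 (e2 _ hk1B)
  push_cast at f1 f2 f3
  have hlen : 0 < (agdExplorationOrder G c v B a).length := by simp [agdExplorationOrder]
  have hlenℓ := congrArg List.length ho
  rw [List.length_append] at hlenℓ
  have hlenR : ((agdExplorationOrder G c v B (a + (k + 1))).length : ℝ)
      = (agdExplorationOrder G c v B a).length + (adjAmongFirst G x U ((k + 1) * B)).length := by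
    exact_mod_cast hlenℓ
  have hl : l < (agdExplorationOrder G c v B a).length := by
    by_contra hcon
    have := h.index
    rw [List.getElem?_eq_none (by omega)] at this
    simp at this
  have hl'lt : l' < (agdExplorationOrder G c v B (a + (k + 1))).length := by
    by_contra hcon
    have := h'.index
    rw [List.getElem?_eq_none (by omega)] at this
    simp at this
  have hcx : c x = w l := hcw _ _ _ h.index
  have hcy : c y = w l' := hcw _ _ _ h'.index
  have hdeg : ((adjAmongFirst G x U ((k + 1) * B)).length : ℝ) ≤ p * n + η := by
    refine le_trans ?_ (hG.degree_le x)
    rw [← List.toFinset_card_of_nodup (nodup_adjAmongFirst x U _)]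
    norm_cast
    refine Finset.card_le_card fun u hu => ?_
    rw [List.mem_toFinset] at hu
    simpa using (mem_of_mem_adjAmongFirst hu).2
  have hwl : ∀ i < (agdExplorationOrder G c v B a).length
      + (adjAmongFirst G x U (k * B)).length, w l ≤ w i := by
    intro i hi
    have hsplit : ∃ R, agdExplorationOrder G c v B (a + (k + 1)) =
        (agdExplorationOrder G c v B a ++ adjAmongFirst G x U (k * B)) ++ R :=
      ⟨_, by rw [ho, add_one_mul, adjAmongFirst_add, List.append_assoc]⟩
    obtain ⟨R, hR⟩ := hsplit
    have hi' : i < (agdExplorationOrder G c v B a ++ adjAmongFirst G x U (k * B)).length := by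
      simpa using hi
    have := hcw (a + (k + 1)) i _ (by
      rw [hR, List.getElem?_append_left hi', List.getElem?_eq_getElem hi'])
    rw [← this, ← hcx]
    have hmem := List.getElem_mem hi'
    rw [List.mem_append] at hmem
    rcases hmem with hmem | hmem
    · exact h.min _ hmem
    · exact not_lt.1 (hk _ hmem)
  constructor
  · exact (Finset.card_insert_le _ _).trans (Nat.add_le_add_right hb.card_le 1)
  · intro z hz
    rcases Finset.mem_insert.1 hz with rfl | hz
    · exact hyx
    · exact hyx.trans (hb.lt_of_mem z hz)
  · intro u hu
    rw [ho, List.mem_append] at hu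
    rcases hu with hu | hu
    · rcases hb.covered u hu with hu | ⟨z, hz, hzu⟩
      · exact Or.inl hu
      · exact Or.inr ⟨z, Finset.mem_insert_of_mem hz, hzu⟩
    · exact Or.inr ⟨x, Finset.mem_insert_self _ _, (mem_of_mem_adjAmongFirst hu).2⟩
  -- The index of `y` is a record index that lies beyond the old exploration order.
  · refine lt_of_le_of_lt hb.lt_recordCount (recordCount_lt (l := l') (by omega) (by omega) ?_)
    intro i hi
    refine lt_of_le_of_ne ?_ (hw.ne hi.ne')
    have hi' : i < (agdExplorationOrder G c v B (a + (k + 1))).length := hi.trans hl'lt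
    rw [← hcy, ← hcw (a + (k + 1)) i _ (List.getElem?_eq_getElem hi')]
    exact h'.min _ (List.getElem_mem hi')
  · have ht := abs_le.1 hb.time
    rw [hlenR, abs_le]
    push_cast
    constructor <;> linarith
  · intro m l'' hm hl''m hmin
    have hpn : 0 ≤ p * n + η := by positivity
    rcases lt_or_ge m (agdExplorationOrder G c v B a).length with hma | hma
    · exact hb.age_lt m l'' hma hl''m hmin
    rw [hlenℓ] at hm
    rcases lt_or_ge l'' ((agdExplorationOrder G c v B a).length
      + (adjAmongFirst G x U (k * B)).length) with hlt | hge
    -- By injectivity the minimiser is unique, so the minimum standing at `m` is still `x`.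
    · have : l'' = l := hw (le_antisymm (hmin l (by omega)) (hwl l'' hlt))
      subst this
      have h1 := hb.length_le
      have h2 : (m : ℝ) + 1 ≤ (agdExplorationOrder G c v B a).length
        + (adjAmongFirst G x U ((k + 1) * B)).length := by exact_mod_cast hm
      linarith
    · have h2 : (m : ℝ) + 1 ≤ (agdExplorationOrder G c v B a).length
        + (adjAmongFirst G x U ((k + 1) * B)).length := by exact_mod_cast hm
      have h3 : ((agdExplorationOrder G c v B a).length : ℝ)
        + (adjAmongFirst G x U (k * B)).length ≤ l'' := by exact_mod_cast hge
      linarith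
  · have h3 : ((agdExplorationOrder G c v B a).length : ℝ)
        + (adjAmongFirst G x U (k * B)).length ≤ l' := by exact_mod_cast hl'
    rw [hlenR]
    linarith

/-- On a pseudo-random graph, the algorithm stops when about `p n` vertices have been explored since
the last record, after about `1 / (p B)` steps per explored vertex. -/
theorem agd_estimates {p η κ M D : ℝ} {w : ℕ → ℝ} (hB : 0 < B)
    (hG : IsPseudoRandom G p η κ) (hp : 0 ≤ p) (hη : 0 ≤ η) (hκ : 0 ≤ κ)
    (hM : ∀ m < n, (recordCount w m : ℝ) ≤ M) (hw : Function.Injective w)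
    (hcw : AGDCostsDrawnFrom G c v B w)
    (hD : p * B + 2 * visitError n p η κ M + (p * n + η) < D) :
    (∃ l : ℕ, (l : ℝ) + (p * n - 2 * visitError n p η κ M) ≤ agdTotalExplored G c v B ∧
      ∀ k ≤ agdTotalExplored G c v B, w l ≤ w k) ∧
    (∀ m ≤ agdTotalExplored G c v B, ∀ l ≤ m, (∀ k ≤ m, w l ≤ w k) → (m : ℝ) < l + D) ∧
    |p * B * agdRunningTime G c v B - agdTotalExplored G c v B|
      ≤ (M + 1) * (visitError n p η κ M + p * B) := by
  classical
  have hM1 : 1 ≤ M := by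
    refine le_trans ?_ (hM 0 v.pos)
    have : 0 < recordCount w 0 := Finset.card_pos.2 ⟨0, by simp⟩
    exact_mod_cast this
  have hpn : 0 ≤ p * n + η := by positivity
  have herr : 0 ≤ visitError n p η κ M := by unfold visitError; positivity
  have hpB : 0 ≤ p * B := by positivity
  obtain ⟨a, l, x, U, h, ⟨V, Z, hb⟩, hf⟩ := agdArrival_induction (G := G) (c := c) (v := v) hB
    (P := fun a l x _ => ∃ V Z, AGDArrivalBounds G c v B w p (visitError n p η κ M + p * B)
      (p * B + 2 * visitError n p η κ M) D a l x V Z)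
    ⟨0, ∅, by simp, by simp, by simp [agdExplorationOrder],
      Finset.card_pos.2 ⟨0, by simp⟩, by simp [agdExplorationOrder], by
        intro m l' hm hl' _
        simp only [agdExplorationOrder, List.range_zero, List.flatMap_nil, List.length_singleton,
          Nat.lt_one_iff] at hm
        obtain rfl : l' = 0 := by omega
        subst hm
        simpa using by linarith, by
        simp only [agdExplorationOrder, List.range_zero, List.flatMap_nil, List.length_singleton]
        push_cast
        linarith⟩
    (fun a l x U k l' y h ⟨V, Z, hb⟩ h1 h2 h3 h4 h5 h6 =>
      ⟨V + 1, insert x Z, agdArrivalBounds_next hG hp hη hκ hM hw hcw hD h hb h1 h2 h3 h4 h5 h6⟩)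
  obtain ⟨hS, ho⟩ := h.runningTime_eq hB hf
  obtain ⟨e1, e2, e3, e4⟩ := abs_length_adjAmongFirst_sub_le hG hp hη hκ hM h hb
  have hE : agdTotalExplored G c v B + 1 = (agdExplorationOrder G c v B a).length
      + (adjAmongFirst G x U U.card).length := by
    unfold agdTotalExplored
    rw [← length_agdExplorationOrder, ho, List.length_append]
  have hER : (agdTotalExplored G c v B : ℝ) + 1 = (agdExplorationOrder G c v B a).length
      + (adjAmongFirst G x U U.card).length := by exact_mod_cast hE
  have hl : l < (agdExplorationOrder G c v B a).length := by
    by_contra hcon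
    have := h.index
    rw [List.getElem?_eq_none (by omega)] at this
    simp at this
  have hlR : (l : ℝ) + 1 ≤ (agdExplorationOrder G c v B a).length := by exact_mod_cast hl
  have hcx : c x = w l := hcw _ _ _ h.index
  have f1 := abs_le.1 (e1 _ le_rfl)
  have hU : (U.card : ℝ) + (agdExplorationOrder G c v B a).length = n := by
    exact_mod_cast h.card_add
  have hwl : ∀ k ≤ agdTotalExplored G c v B, w l ≤ w k := by
    intro i hi
    have hi' : i < (agdExplorationOrder G c v B (agdRunningTime G c v B)).length := by
      rw [ho, List.length_append]; omega
    obtain ⟨z, hz⟩ : ∃ z, (agdExplorationOrder G c v B (agdRunningTime G c v B))[i]? = some z :=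
      ⟨_, List.getElem?_eq_getElem hi'⟩
    have hmem := List.mem_of_getElem? hz
    rw [← hcw _ i z hz, ← hcx]
    rw [ho, List.mem_append] at hmem
    rcases hmem with hmem | hmem
    · exact h.min _ hmem
    · exact not_lt.1 (hf _ (mem_of_mem_adjAmongFirst hmem).1 (mem_of_mem_adjAmongFirst hmem).2)
  refine ⟨⟨l, ?_, hwl⟩, ?_, ?_⟩
  -- `|U|` falls short of `n` by the number of explored vertices; `p` times that number is at most
  -- one more `visitError`, whence the factor `2`.
  · have h1 : p * U.card = p * n - p * (agdExplorationOrder G c v B a).length := by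
      rw [← hU]; ring
    have h2 : p * ((agdExplorationOrder G c v B a).length : ℝ) ≤ visitError n p η κ M := by
      unfold visitError
      have := mul_le_mul_of_nonneg_left e4 hp
      have : 0 ≤ M * κ := by positivity
      linarith
    linarith
  · intro m hm l' hl'm hmin
    rcases lt_or_ge m (agdExplorationOrder G c v B a).length with hma | hma
    · exact hb.age_lt m l' hma hl'm hmin
    have hdeg : ((adjAmongFirst G x U U.card).length : ℝ) ≤ p * n + η := by
      refine le_trans ?_ (hG.degree_le x)
      rw [← List.toFinset_card_of_nodup (nodup_adjAmongFirst x U _)]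
      norm_cast
      refine Finset.card_le_card fun u hu => ?_
      rw [List.mem_toFinset] at hu
      simpa using (mem_of_mem_adjAmongFirst hu).2
    have : l' = l := hw (le_antisymm (hmin l (by omega)) (hwl l' (by omega)))
    subst this
    have h1 := hb.length_le
    have h2 : (m : ℝ) ≤ agdTotalExplored G c v B := by exact_mod_cast hm
    linarith
  · have ht := abs_le.1 hb.time
    have hBpos : (0 : ℝ) < B := by exact_mod_cast hB
    have h1 : (U.card : ℝ) ≤ ⌈(U.card : ℝ) / B⌉₊ * B := by
      rw [← div_le_iff₀ hBpos]; exact Nat.le_ceil _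
    have h2 : (⌈(U.card : ℝ) / B⌉₊ : ℝ) * B ≤ U.card + B := by
      have := (Nat.ceil_lt_add_one (a := (U.card : ℝ) / B) (by positivity)).le
      have := mul_le_mul_of_nonneg_right this hBpos.le
      rwa [add_mul, one_mul, div_mul_cancel₀ _ hBpos.ne'] at this
    have h3 := mul_le_mul_of_nonneg_left h1 hp
    have h4 := mul_le_mul_of_nonneg_left h2 hp
    -- At most `M - 1` visits end with a move. The last visit costs one further `visitError`, and
    -- the rounding in `⌈|U| / B⌉` and the additional step cost `p * B` each; `M + 1` covers all of
    -- this.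
    have h5 : (V : ℝ) * (visitError n p η κ M + p * B)
        ≤ (M - 1) * (visitError n p η κ M + p * B) :=
      mul_le_mul_of_nonneg_right (by linarith) (by positivity)
    rw [hS, abs_le]
    push_cast
    constructor <;> nlinarith

end AGD

/-! ### Records of a sequence and the age of the current minimum -/

section Records

variable {w : ℕ → ℝ}

/-- The properties that almost every sequence of independent uniform costs has. -/
structure IsCostSequence (w : ℕ → ℝ) : Prop where
  injective : Function.Injective w
  pos : ∀ k, 0 < w k
  lt_one : ∀ k, w k < 1
  exists_lt : ∀ ε > 0, ∃ k, w k < ε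

theorem IsCostSequence.recordIndex_succ_spec (hw : IsCostSequence w) (j : ℕ) :
    recordIndex w j < recordIndex w (j + 1) ∧
    w (recordIndex w (j + 1)) < w (recordIndex w j) ∧
    ∀ m, recordIndex w j < m → m < recordIndex w (j + 1) → w (recordIndex w j) ≤ w m := by
  have hne : {m : ℕ | recordIndex w j < m ∧ w m < w (recordIndex w j)}.Nonempty := by
    obtain ⟨i, -, hi⟩ := Finset.exists_min_image (Finset.range (recordIndex w j + 1)) w ⟨0, by simp⟩
    obtain ⟨k, hk⟩ := hw.exists_lt (w i) (hw.pos i)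
    refine ⟨k, ?_, hk.trans_le (hi _ (by simp))⟩
    by_contra hcon
    exact absurd hk (not_lt.2 (hi k (by simp at hcon ⊢; omega)))
  have h := Nat.sInf_mem hne
  refine ⟨h.1, h.2, fun m hm hlt => ?_⟩
  by_contra hcon
  exact absurd (Nat.sInf_le (s := {m : ℕ | recordIndex w j < m ∧ w m < w (recordIndex w j)})
    ⟨hm, not_le.1 hcon⟩) (not_le.2 hlt)

theorem IsCostSequence.recordIndex_strictMono (hw : IsCostSequence w) :
    StrictMono (recordIndex w) :=
  strictMono_nat_of_lt_succ fun j => (hw.recordIndex_succ_spec j).1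

theorem IsCostSequence.record_strictAnti (hw : IsCostSequence w) :
    StrictAnti fun j => w (recordIndex w j) :=
  strictAnti_nat_of_succ_lt fun j => (hw.recordIndex_succ_spec j).2.1

theorem IsCostSequence.record_le (hw : IsCostSequence w) (j : ℕ) :
    ∀ m < recordIndex w (j + 1), w (recordIndex w j) ≤ w m := by
  induction j with
  | zero =>
    intro m hm
    rcases Nat.eq_zero_or_pos m with rfl | h
    · rfl
    · exact (hw.recordIndex_succ_spec 0).2.2 m h hm
  | succ j ih =>
    intro m hm
    rcases lt_trichotomy m (recordIndex w (j + 1)) with h | rfl | h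
    · exact (hw.recordIndex_succ_spec j).2.1.le.trans (ih m h)
    · rfl
    · exact (hw.recordIndex_succ_spec (j + 1)).2.2 m h hm

theorem IsCostSequence.exists_recordIndex_le (hw : IsCostSequence w) (m : ℕ) :
    ∃ j, recordIndex w j ≤ m ∧ m < recordIndex w (j + 1) := by
  have hex : ∃ j, m < recordIndex w j :=
    ⟨m + 1, (Nat.lt_succ_self m).trans_le (hw.recordIndex_strictMono.id_le _)⟩
  obtain ⟨j, hj⟩ : ∃ j, Nat.find hex = j + 1 := by
    refine Nat.exists_eq_succ_of_ne_zero fun h0 => ?_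
    have := Nat.find_spec hex
    simp [h0, recordIndex] at this
  refine ⟨j, not_lt.1 (Nat.find_min hex (by omega)), ?_⟩
  rw [← hj]
  exact Nat.find_spec hex

theorem IsCostSequence.exists_recordIndex_eq (hw : IsCostSequence w) {l : ℕ}
    (hl : ∀ k ≤ l, w l ≤ w k) : ∃ j, recordIndex w j = l := by
  obtain ⟨j, h1, h2⟩ := hw.exists_recordIndex_le l
  exact ⟨j, hw.injective (le_antisymm (hw.record_le j l h2) (hl _ h1))⟩

theorem IsCostSequence.recordDuration_pos (hw : IsCostSequence w) (j : ℕ) :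
    0 < recordDuration w j :=
  Nat.sub_pos_of_lt (hw.recordIndex_succ_spec j).1

theorem IsCostSequence.recordIndex_succ (hw : IsCostSequence w) (j : ℕ) :
    recordIndex w (j + 1) = recordIndex w j + recordDuration w j :=
  (Nat.add_sub_cancel' (hw.recordIndex_succ_spec j).1.le).symm

theorem IsCostSequence.recordIndex_eq_sum (hw : IsCostSequence w) (j : ℕ) :
    recordIndex w j = ∑ i ∈ Finset.range j, recordDuration w i := by
  induction j with
  | zero => rfl
  | succ j ih => rw [hw.recordIndex_succ, Finset.sum_range_succ, ih]

/-- The first index at which the current minimum of the sequence has stood for `D` terms. -/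
def ageTime (w : ℕ → ℝ) (D : ℕ) : ℕ := sInf {m | ∃ l, l + D ≤ m ∧ ∀ k ≤ m, w l ≤ w k}

theorem ageTime_le {D l m : ℕ} (hlm : l + D ≤ m) (h : ∀ k ≤ m, w l ≤ w k) : ageTime w D ≤ m :=
  Nat.sInf_le ⟨l, hlm, h⟩

theorem exists_ageTime {D : ℕ} (h : ∃ m l, l + D ≤ m ∧ ∀ k ≤ m, w l ≤ w k) :
    ∃ l, l + D ≤ ageTime w D ∧ ∀ k ≤ ageTime w D, w l ≤ w k :=
  Nat.sInf_mem (s := {m | ∃ l, l + D ≤ m ∧ ∀ k ≤ m, w l ≤ w k}) h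

theorem ageTime_mono {D D' : ℕ} (hD : D ≤ D') (h : ∃ m l, l + D' ≤ m ∧ ∀ k ≤ m, w l ≤ w k) :
    ageTime w D ≤ ageTime w D' := by
  obtain ⟨l, h1, h2⟩ := exists_ageTime h
  exact ageTime_le (by omega) h2

/-- Some record stands for exactly `D + 1` terms. -/
def HasRecordOfDuration (w : ℕ → ℝ) (D l : ℕ) : Prop :=
  (∀ k ≤ l + D, w l ≤ w k) ∧ ¬ ∀ k ≤ l + D + 1, w l ≤ w k

/-- If no record has a duration from `D + 1` to `D + d`, a minimum that has reached age `D` also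
reaches age `D + d`, in `d` further terms. -/
theorem ageTime_add_le {D d : ℕ} (hne : ∀ D, ∃ m l, l + D ≤ m ∧ ∀ k ≤ m, w l ≤ w k)
    (h : ∀ D', D ≤ D' → D' < D + d → ∀ l, ¬ HasRecordOfDuration w D' l) :
    ageTime w (D + d) ≤ ageTime w D + d := by
  induction d with
  | zero => simp
  | succ d ih =>
    have h1 := ih fun D' h1 h2 => h D' h1 (by omega)
    obtain ⟨l, h2, h3⟩ := exists_ageTime (hne (D + d))
    have h4 := h (D + d) (by omega) (by omega) l
    unfold HasRecordOfDuration at h4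
    push Not at h4
    have := ageTime_le (w := w) (D := D + (d + 1)) (l := l) (m := l + (D + d) + 1) (by omega)
      (h4 fun k hk => h3 k (by omega))
    omega

/-- At the end of the window the current minimum either precedes the window or can be taken to be
`q`, in its first half. In both cases its age is at least `D`. -/
theorem ageTime_lt_of_window {D k q : ℕ} (hq1 : 2 * D * k ≤ q) (hq2 : q < 2 * D * k + D)
    (hq : ∀ i, 2 * D * k ≤ i → i < 2 * D * (k + 1) → w q ≤ w i) :
    (∃ m l, l + D ≤ m ∧ ∀ k ≤ m, w l ≤ w k) ∧ ageTime w D < 2 * D * (k + 1) := by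
  have e : 2 * D * (k + 1) = 2 * D * k + 2 * D := by ring
  obtain ⟨l, hl, hmin⟩ := Finset.exists_min_image (Finset.range (2 * D * (k + 1))) w
    ⟨0, by simp; omega⟩
  simp only [Finset.mem_range] at hl hmin
  have key : ∃ l, l + D ≤ 2 * D * (k + 1) - 1 ∧ ∀ i ≤ 2 * D * (k + 1) - 1, w l ≤ w i := by
    rcases lt_or_ge l (2 * D * k) with h | h
    · exact ⟨l, by omega, fun i hi => hmin i (by omega)⟩
    · exact ⟨q, by omega, fun i hi => (hq l h hl).trans (hmin i (by omega))⟩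
  obtain ⟨l', h1, h2⟩ := key
  refine ⟨⟨_, l', h1, h2⟩, ?_⟩
  have := ageTime_le h1 h2
  omega

/-- A duration counts the terms up to and including the one that beats the record, so an unbeaten
minimum of age `D` has duration at least `D + 1`. This is why the condition `> K` on durations
matches age `K`. -/
theorem IsCostSequence.lt_recordDuration (hw : IsCostSequence w) {D m j : ℕ}
    (hlm : recordIndex w j + D ≤ m) (h : ∀ k ≤ m, w (recordIndex w j) ≤ w k) :
    D < recordDuration w j := by
  have h1 : m < recordIndex w (j + 1) := by
    by_contra hcon
    exact absurd (h _ (not_lt.1 hcon)) (not_le.2 (hw.recordIndex_succ_spec j).2.1)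
  have := hw.recordIndex_succ j
  omega

/-- The number of the first record that stands for more than `K` terms. -/
theorem IsCostSequence.exists_first_lt_recordDuration (hw : IsCostSequence w) (K : ℕ)
    (hne : ∃ m l, l + K ≤ m ∧ ∀ k ≤ m, w l ≤ w k) :
    ∃ J, K < recordDuration w J ∧ (∀ j < J, recordDuration w j ≤ K) ∧
      ageTime w K = recordIndex w J + K := by
  have hmem : ∀ m l, l + K ≤ m → (∀ k ≤ m, w l ≤ w k) →
      ∃ j, recordIndex w j = l ∧ K < recordDuration w j := fun m l h1 h2 => by
    obtain ⟨j, rfl⟩ := hw.exists_recordIndex_eq (fun k hk => h2 k (by omega))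
    exact ⟨j, rfl, hw.lt_recordDuration h1 h2⟩
  have hex : ∃ j, K < recordDuration w j := by
    obtain ⟨m, l, h1, h2⟩ := hne
    obtain ⟨j, -, h⟩ := hmem m l h1 h2
    exact ⟨j, h⟩
  refine ⟨Nat.find hex, Nat.find_spec hex, fun j hj => not_lt.1 (Nat.find_min hex hj), ?_⟩
  apply le_antisymm
  · refine ageTime_le le_rfl fun k hk => hw.record_le _ k ?_
    have := hw.recordIndex_succ (Nat.find hex)
    have := Nat.find_spec hex
    omega
  · obtain ⟨l, h1, h2⟩ := exists_ageTime hne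
    obtain ⟨j, rfl, h3⟩ := hmem _ l h1 h2
    have := hw.recordIndex_strictMono.monotone (Nat.find_min' hex h3)
    omega

theorem IsCostSequence.exists_record_lt (hw : IsCostSequence w) (t : ℝ) :
    ∃ j₀, ∀ j, j₀ ≤ j → t < - Real.log (w (recordIndex w j)) := by
  obtain ⟨k, hk⟩ := hw.exists_lt (Real.exp (-t)) (Real.exp_pos _)
  obtain ⟨j₀, h1, h2⟩ := hw.exists_recordIndex_le k
  refine ⟨j₀, fun j hj => ?_⟩
  have h3 : w (recordIndex w j) < Real.exp (-t) :=
    ((hw.record_strictAnti.antitone hj).trans (hw.record_le j₀ k h2)).trans_lt hk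
  have := (Real.log_lt_iff_lt_exp (hw.pos _)).2 h3
  linarith

theorem IsCostSequence.record_time_strictMono (hw : IsCostSequence w) :
    StrictMono fun j => - Real.log (w (recordIndex w j)) := fun _ _ h =>
  neg_lt_neg (Real.log_lt_log (hw.pos _) (hw.record_strictAnti h))

theorem IsCostSequence.record_time_pos (hw : IsCostSequence w) (j : ℕ) :
    0 < - Real.log (w (recordIndex w j)) :=
  neg_pos.2 (Real.log_neg (hw.pos _) (hw.lt_one _))

theorem IsCostSequence.finite_recordProcess_set (hw : IsCostSequence w) (t : ℝ) (P : ℕ → Prop) :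
    {j : ℕ | - Real.log (w (recordIndex w j)) ≤ t ∧ P j}.Finite := by
  obtain ⟨j₀, hj₀⟩ := hw.exists_record_lt t
  refine (Set.finite_Iio j₀).subset fun j hj => ?_
  by_contra hcon
  exact absurd (hj₀ j (not_lt.1 hcon)) (not_lt.2 hj.1)

/-- The times of the records increase, so `T_K` is the time of record `J`, and the processes with `i
< K` have then counted exactly the records before `J` of their own durations. All the durations
before `J` add up to `recordIndex w J`; those equal to `K` belong to no process and have to be added
by hand. -/
theorem IsCostSequence.poissonFunctional_add (hw : IsCostSequence w) {K J : ℕ}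
    (hJ : K < recordDuration w J) (hlt : ∀ j < J, recordDuration w j ≤ K) :
    poissonFunctional K (recordProcess w K)
      + K * ((Finset.range J).filter fun j => recordDuration w j = K).card
      = recordIndex w J + K := by
  have hT : sInf {t : ℝ≥0 | 0 < recordProcess w K K t}
      = (- Real.log (w (recordIndex w J))).toNNReal := by
    have : {t : ℝ≥0 | 0 < recordProcess w K K t}
        = Set.Ici (- Real.log (w (recordIndex w J))).toNNReal := by
      ext t
      unfold recordProcess
      simp only [lt_irrefl, if_false, Set.mem_ofPred_eq, Set.mem_Ici]
      rw [Set.ncard_pos (hw.finite_recordProcess_set _ _), Real.toNNReal_le_iff_le_coe]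
      constructor
      · rintro ⟨j, h1, h2⟩
        have : J ≤ j := by
          by_contra hcon
          exact absurd (hlt j (not_le.1 hcon)) (not_le.2 h2)
        exact (hw.record_time_strictMono.monotone this).trans h1
      · exact fun h => ⟨J, h, hJ⟩
    rw [this, csInf_Ici]
  have hN : ∀ i ∈ Finset.Ico 1 K, recordProcess w K i (sInf {t : ℝ≥0 | 0 < recordProcess w K K t})
      = ((Finset.range J).filter fun j => recordDuration w j = i).card := by
    intro i hi
    rw [Finset.mem_Ico] at hi
    rw [hT, ← Set.ncard_coe_finset]
    unfold recordProcess
    congr 1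
    ext j
    simp only [if_pos hi.2, Set.mem_ofPred_eq, Finset.coe_filter, Finset.mem_range]
    rw [Real.coe_toNNReal _ (hw.record_time_pos J).le]
    refine and_congr_left fun hj => ?_
    rw [hw.record_time_strictMono.le_iff_le]
    refine ⟨fun h => lt_of_le_of_ne h ?_, le_of_lt⟩
    rintro rfl
    omega
  unfold poissonFunctional
  rw [Finset.sum_congr rfl fun i hi => by rw [hN i hi], hw.recordIndex_eq_sum,
    ← Finset.sum_fiberwise_of_maps_to (s := Finset.range J) (t := Finset.Icc 1 K)
      (g := recordDuration w)
      (fun j hj => Finset.mem_Icc.2 ⟨hw.recordDuration_pos j, hlt j (Finset.mem_range.1 hj)⟩)]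
  have hsum : ∀ i, ∑ j ∈ (Finset.range J).filter (fun j => recordDuration w j = i),
      recordDuration w j = i * ((Finset.range J).filter fun j => recordDuration w j = i).card := by
    intro i
    rw [Finset.sum_congr rfl (fun j hj => (Finset.mem_filter.1 hj).2), Finset.sum_const,
      smul_eq_mul, mul_comm]
  simp only [hsum]
  rcases Nat.eq_zero_or_pos K with rfl | hK
  · simp
  · rw [← Finset.Ico_insert_right hK, Finset.sum_insert (by simp)]
    ring

/-- Passing from record numbers to indices `l` makes the expected count computable, as the event at
each `l` involves finitely many terms only. -/
theorem IsCostSequence.card_le_tsum (hw : IsCostSequence w) {K : ℕ} (J : ℕ) :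
    ((((Finset.range J).filter fun j => recordDuration w j = K + 1).card : ℕ) : ℝ≥0∞)
      ≤ ∑' l, Set.indicator {l | HasRecordOfDuration w K l} 1 l := by
  classical
  rw [← Finset.card_image_of_injective _ hw.recordIndex_strictMono.injective]
  refine le_trans (le_of_eq ?_) (ENNReal.sum_le_tsum
    (((Finset.range J).filter fun j => recordDuration w j = K + 1).image (recordIndex w)))
  rw [Finset.cast_card]
  refine Finset.sum_congr rfl fun l hl => ?_
  rw [Set.indicator_of_mem]
  · rfl
  obtain ⟨j, hj, rfl⟩ := Finset.mem_image.1 hl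
  have h1 := hw.recordIndex_succ j
  rw [(Finset.mem_filter.1 hj).2] at h1
  refine ⟨fun k hk => hw.record_le j k (by omega), fun hcon => ?_⟩
  exact absurd (hcon _ (by omega)) (not_le.2 (hw.recordIndex_succ_spec j).2.1)

end Records

/-! ### Uniform sequences: durations of records -/

section UniformSequence

/-- A sequence of independent random variables, uniform on `[0, 1]`. -/
structure IsUniformSequence {Ω : Type*} [MeasurableSpace Ω] (W : ℕ → Ω → ℝ) (μ : Measure Ω) :
    Prop where
  measurable : ∀ k, Measurable (W k)
  hasLaw : ∀ k, HasLaw (W k) (volume.restrict (Set.Icc (0 : ℝ) 1)) μ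
  iIndepFun : iIndepFun W μ

variable {Ω : Type*} [MeasurableSpace Ω] {μ : Measure Ω} {W : ℕ → Ω → ℝ}

theorem IsUniformSequence.indepFun_tuple (hW : IsUniformSequence W μ) {l : ℕ} {S : Finset ℕ}
    (hl : l ∉ S) : IndepFun (W l) (fun ω (k : S) => W k ω) μ :=
  (hW.iIndepFun.indepFun_finset {l} S (by simpa using hl) hW.measurable).comp
    (φ := fun z : ({l} : Finset ℕ) → ℝ => z ⟨l, Finset.mem_singleton_self l⟩) (ψ := id)
    (measurable_pi_apply _) measurable_id

theorem IsUniformSequence.measurable_forall_le (hW : IsUniformSequence W μ) (l m : ℕ) :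
    MeasurableSet {ω | ∀ k ≤ m, W l ω ≤ W k ω} := by
  rw [show {ω | ∀ k ≤ m, W l ω ≤ W k ω} = ⋂ k, ⋂ (_ : k ≤ m), {ω | W l ω ≤ W k ω} by ext; simp]
  exact MeasurableSet.iInter fun k => MeasurableSet.iInter fun _ =>
    measurableSet_le (hW.measurable l) (hW.measurable k)

theorem IsUniformSequence.measurableSet_hasRecordOfDuration (hW : IsUniformSequence W μ)
    (D l : ℕ) : MeasurableSet {ω | HasRecordOfDuration (fun k => W k ω) D l} :=
  (hW.measurable_forall_le l (l + D)).inter (hW.measurable_forall_le l (l + D + 1)).compl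

variable [IsProbabilityMeasure μ]

theorem volume_restrict_Icc_Ici {y : ℝ} (hy : y ∈ Set.Icc (0 : ℝ) 1) :
    volume.restrict (Set.Icc (0 : ℝ) 1) (Set.Ici y) = ENNReal.ofReal (1 - y) := by
  rw [Measure.restrict_apply measurableSet_Ici]
  have : Set.Ici y ∩ Set.Icc 0 1 = Set.Icc y 1 := by
    ext z
    simp only [Set.mem_inter_iff, Set.mem_Ici, Set.mem_Icc] at hy ⊢
    constructor
    · rintro ⟨h1, h2, h3⟩; exact ⟨h1, h3⟩
    · rintro ⟨h1, h2⟩; exact ⟨h1, hy.1.trans h1, h2⟩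
  rw [this, Real.volume_Icc]

theorem lintegral_one_sub_pow (s : ℕ) :
    ∫⁻ y in Set.Icc (0 : ℝ) 1, ENNReal.ofReal (1 - y) ^ s = ENNReal.ofReal (1 / (s + 1)) := by
  have h1 : ∫⁻ y in Set.Icc (0 : ℝ) 1, ENNReal.ofReal (1 - y) ^ s
      = ∫⁻ y in Set.Icc (0 : ℝ) 1, ENNReal.ofReal ((1 - y) ^ s) := by
    refine setLIntegral_congr_fun measurableSet_Icc fun y hy => ?_
    rw [ENNReal.ofReal_pow (by linarith [hy.2])]
  rw [h1, ← ofReal_integral_eq_lintegral_ofReal]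
  · rw [integral_Icc_eq_integral_Ioc, ← intervalIntegral.integral_of_le zero_le_one]
    rw [intervalIntegral.integral_comp_sub_left (fun y => y ^ s)]
    simp
  · exact (by fun_prop : Continuous fun y : ℝ => (1 - y) ^ s).continuousOn.integrableOn_Icc
  · filter_upwards [ae_restrict_mem measurableSet_Icc] with y hy
    exact pow_nonneg (by linarith [hy.2]) _

/-- By exchangeability, each of finitely many independent uniform random variables is equally likely
to be the smallest one. -/
theorem IsUniformSequence.measure_forall_le (hW : IsUniformSequence W μ) {l : ℕ} {S : Finset ℕ}
    (hl : l ∉ S) :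
    μ {ω | ∀ k ∈ S, W l ω ≤ W k ω} = ENNReal.ofReal (1 / (S.card + 1)) := by
  have hm : Measurable fun ω (k : S) => W k ω := measurable_pi_lambda _ fun k => hW.measurable k
  have hA : MeasurableSet {z : ℝ × (S → ℝ) | ∀ k, z.1 ≤ z.2 k} := by
    rw [show {z : ℝ × (S → ℝ) | ∀ k, z.1 ≤ z.2 k} = ⋂ k, {z | z.1 ≤ z.2 k} by
      ext; simp]
    exact MeasurableSet.iInter fun k => measurableSet_le (by fun_prop) (by fun_prop)
  have h1 : {ω | ∀ k ∈ S, W l ω ≤ W k ω} = (fun ω => (W l ω, fun k : S => W k ω)) ⁻¹'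
      {z : ℝ × (S → ℝ) | ∀ k, z.1 ≤ z.2 k} := by
    ext ω; simp
  rw [h1, ← Measure.map_apply ((hW.measurable l).prodMk hm) hA,
    (hW.indepFun_tuple hl).map_prod_eq_prod_map_map (hW.measurable l).aemeasurable hm.aemeasurable,
    (hW.hasLaw l).map_eq, Measure.prod_apply hA, ← lintegral_one_sub_pow]
  refine setLIntegral_congr_fun measurableSet_Icc fun y hy => ?_
  rw [Measure.map_apply hm (measurable_prodMk_left hA)]
  have h2 : (fun ω (k : S) => W k ω) ⁻¹' (Prod.mk y ⁻¹' {z : ℝ × (S → ℝ) | ∀ k, z.1 ≤ z.2 k})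
      = ⋂ k ∈ S, W k ⁻¹' Set.Ici y := by
    ext ω; simp
  rw [h2, hW.iIndepFun.measure_inter_preimage_eq_mul S (fun _ _ => measurableSet_Ici)]
  have h3 : ∀ k ∈ S, μ (W k ⁻¹' Set.Ici y) = ENNReal.ofReal (1 - y) := fun k _ => by
    rw [← Measure.map_apply (hW.measurable k) measurableSet_Ici, (hW.hasLaw k).map_eq,
      volume_restrict_Icc_Ici hy]
  rw [Finset.prod_congr rfl h3, Finset.prod_const]

theorem IsUniformSequence.measure_forall_le_range (hW : IsUniformSequence W μ) {l m : ℕ}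
    (hl : l ≤ m) : μ {ω | ∀ k ≤ m, W l ω ≤ W k ω} = ENNReal.ofReal (1 / (m + 1)) := by
  have h1 : {ω | ∀ k ≤ m, W l ω ≤ W k ω}
      = {ω | ∀ k ∈ (Finset.range (m + 1)).erase l, W l ω ≤ W k ω} := by
    ext ω
    simp only [Set.mem_ofPred_eq, Finset.mem_erase, Finset.mem_range]
    refine ⟨fun h k hk => h k (by omega), fun h k hk => ?_⟩
    rcases eq_or_ne k l with rfl | hne
    · rfl
    · exact h k ⟨hne, by omega⟩
  rw [h1, hW.measure_forall_le (by simp), Finset.card_erase_of_mem (by simp; omega)]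
  simp

/-- The event is the difference of two nested events of probabilities `1 / (l + D + 1)` and `1 / (l
+ D + 2)`. The second denominator is written with `l + 1` in place of `l` so that the sum over `l`
telescopes. -/
theorem IsUniformSequence.measure_hasRecordOfDuration (hW : IsUniformSequence W μ) (D l : ℕ) :
    μ {ω | HasRecordOfDuration (fun k => W k ω) D l}
      = ENNReal.ofReal (1 / (l + D + 1) - 1 / ((l + 1 : ℕ) + D + 1)) := by
  have h1 : {ω | HasRecordOfDuration (fun k => W k ω) D l}
      = {ω | ∀ k ≤ l + D, W l ω ≤ W k ω} \ {ω | ∀ k ≤ l + D + 1, W l ω ≤ W k ω} := rfl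
  have h2 : {ω | ∀ k ≤ l + D + 1, W l ω ≤ W k ω} ⊆ {ω | ∀ k ≤ l + D, W l ω ≤ W k ω} :=
    fun ω h k hk => h k (by omega)
  rw [h1, measure_sdiff h2
    (hW.measurable_forall_le _ _).nullMeasurableSet (measure_ne_top _ _),
    hW.measure_forall_le_range (by omega), hW.measure_forall_le_range (by omega),
    ← ENNReal.ofReal_sub _ (by positivity)]
  push_cast
  congr 3
  ring

theorem IsUniformSequence.tsum_measure_hasRecordOfDuration_le (hW : IsUniformSequence W μ)
    (D : ℕ) : ∑' l, μ {ω | HasRecordOfDuration (fun k => W k ω) D l}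
      ≤ ENNReal.ofReal (1 / (D + 1)) := by
  refine ENNReal.tsum_le_of_sum_range_le fun L => ?_
  simp only [hW.measure_hasRecordOfDuration]
  rw [← ENNReal.ofReal_sum_of_nonneg]
  · rw [Finset.sum_range_sub' (fun l : ℕ => 1 / ((l : ℝ) + D + 1))]
    refine ENNReal.ofReal_le_ofReal ?_
    have : (0 : ℝ) ≤ 1 / ((L : ℝ) + D + 1) := by positivity
    simp only [Nat.cast_zero, zero_add]
    linarith
  · intro l _
    rw [sub_nonneg]
    apply one_div_le_one_div_of_le (by positivity)
    push_cast
    linarith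

theorem IsUniformSequence.measure_exists_hasRecordOfDuration_le (hW : IsUniformSequence W μ)
    (D d : ℕ) :
    μ {ω | ∃ D', D ≤ D' ∧ D' < D + d ∧ ∃ l, HasRecordOfDuration (fun k => W k ω) D' l}
      ≤ ENNReal.ofReal (d / (D + 1)) := by
  have h1 : {ω | ∃ D', D ≤ D' ∧ D' < D + d ∧ ∃ l, HasRecordOfDuration (fun k => W k ω) D' l}
      = ⋃ D' ∈ Finset.Ico D (D + d), ⋃ l, {ω | HasRecordOfDuration (fun k => W k ω) D' l} := by
    ext ω
    simp only [Set.mem_ofPred_eq, Set.mem_iUnion, Finset.mem_Ico, exists_prop, and_assoc]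
  rw [h1]
  refine (measure_biUnion_finset_le _ _).trans ?_
  have h2 : ∀ D' ∈ Finset.Ico D (D + d),
      μ (⋃ l, {ω | HasRecordOfDuration (fun k => W k ω) D' l}) ≤ ENNReal.ofReal (1 / (D + 1)) := by
    intro D' hD'
    refine (measure_iUnion_le _).trans ((hW.tsum_measure_hasRecordOfDuration_le D').trans ?_)
    refine ENNReal.ofReal_le_ofReal (one_div_le_one_div_of_le (by positivity) ?_)
    have : (D : ℝ) ≤ D' := by exact_mod_cast (Finset.mem_Ico.1 hD').1
    linarith
  refine (Finset.sum_le_card_nsmul _ _ _ h2).trans (le_of_eq ?_)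
  rw [Nat.card_Ico, Nat.add_sub_cancel_left, ← ENNReal.ofReal_nsmul, nsmul_eq_mul, mul_one_div]

/-- None of the first `k` windows of length `2 * D` takes its minimum in its first half. -/
def lateWindows (W : ℕ → Ω → ℝ) (D k : ℕ) : Set Ω :=
  {ω | ∀ j < k, ¬ ∃ q, 2 * D * j ≤ q ∧ q < 2 * D * j + D ∧
    ∀ i, 2 * D * j ≤ i → i < 2 * D * (j + 1) → W q ω ≤ W i ω}

/-- Each position of the window carries the minimum with probability `1 / (2 * D)`, and its second
half has `D` positions. -/
theorem IsUniformSequence.measure_late_window_le (hW : IsUniformSequence W μ) {D : ℕ} (hD : 0 < D)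
    (k : ℕ) : μ {ω | ¬ ∃ q, 2 * D * k ≤ q ∧ q < 2 * D * k + D ∧
      ∀ i, 2 * D * k ≤ i → i < 2 * D * (k + 1) → W q ω ≤ W i ω} ≤ 1 / 2 := by
  have e : 2 * D * (k + 1) = 2 * D * k + 2 * D := by ring
  have hsub : {ω | ¬ ∃ q, 2 * D * k ≤ q ∧ q < 2 * D * k + D ∧
      ∀ i, 2 * D * k ≤ i → i < 2 * D * (k + 1) → W q ω ≤ W i ω} ⊆
      ⋃ q ∈ Finset.Ico (2 * D * k + D) (2 * D * (k + 1)),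
        {ω | ∀ i ∈ (Finset.Ico (2 * D * k) (2 * D * (k + 1))).erase q, W q ω ≤ W i ω} := by
    intro ω hω
    obtain ⟨q, hq, hmin⟩ := Finset.exists_min_image (Finset.Ico (2 * D * k) (2 * D * (k + 1)))
      (fun i => W i ω) ⟨2 * D * k, by simp; omega⟩
    rw [Finset.mem_Ico] at hq
    have hge : 2 * D * k + D ≤ q := by
      by_contra hcon
      exact hω ⟨q, hq.1, not_le.1 hcon, fun i h1 h2 => hmin i (Finset.mem_Ico.2 ⟨h1, h2⟩)⟩
    refine Set.mem_biUnion (Finset.mem_coe.2 (Finset.mem_Ico.2 ⟨hge, hq.2⟩)) ?_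
    exact fun i hi => hmin i (Finset.mem_of_mem_erase hi)
  refine (measure_mono hsub).trans ((measure_biUnion_finset_le _ _).trans ?_)
  have h2 : ∀ q ∈ Finset.Ico (2 * D * k + D) (2 * D * (k + 1)),
      μ {ω | ∀ i ∈ (Finset.Ico (2 * D * k) (2 * D * (k + 1))).erase q, W q ω ≤ W i ω}
        ≤ ENNReal.ofReal (1 / (2 * D)) := by
    intro q hq
    rw [Finset.mem_Ico] at hq
    rw [hW.measure_forall_le (by simp), Finset.card_erase_of_mem (Finset.mem_Ico.2 (by omega)),
      Nat.card_Ico, Nat.cast_sub (by omega), e, Nat.add_sub_cancel_left]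
    simp
  refine (Finset.sum_le_card_nsmul _ _ _ h2).trans (le_of_eq ?_)
  rw [Nat.card_Ico, ← ENNReal.ofReal_nsmul, nsmul_eq_mul, e,
    show 2 * D * k + 2 * D - (2 * D * k + D) = D by omega]
  have hD' : (D : ℝ) ≠ 0 := by positivity
  rw [show (D : ℝ) * (1 / (2 * D)) = 1 / 2 by field_simp, ENNReal.ofReal_div_of_pos two_pos]
  simp

/-- Disjoint windows are independent. `S` and `T` express the events through the first `2 * D * k`
terms and through the next window, so that the independence of these two blocks of variables
applies. -/
theorem IsUniformSequence.measure_lateWindows_le (hW : IsUniformSequence W μ) {D : ℕ} (hD : 0 < D)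
    (k : ℕ) : μ (lateWindows W D k) ≤ (1 / 2) ^ k := by
  induction k with
  | zero => simp [lateWindows]
  | succ k ih =>
    have hind := hW.iIndepFun.indepFun_finset (Finset.range (2 * D * k))
      (Finset.Ico (2 * D * k) (2 * D * (k + 1)))
      (by
        rw [Finset.disjoint_left]
        intro i hi hi'
        simp only [Finset.mem_range, Finset.mem_Ico] at hi hi'
        omega) hW.measurable
    have e : 2 * D * (k + 1) = 2 * D * k + 2 * D := by ring
    have hs1 : ∀ j < k, 2 * D * (j + 1) ≤ 2 * D * k := fun j hj => Nat.mul_le_mul_left _ hj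
    let S : Set (Finset.range (2 * D * k) → ℝ) := {z | ∀ j < k, ¬ ∃ q : Finset.range (2 * D * k),
      2 * D * j ≤ q.1 ∧ q.1 < 2 * D * j + D ∧ ∀ i : Finset.range (2 * D * k),
        2 * D * j ≤ i.1 → i.1 < 2 * D * (j + 1) → z q ≤ z i}
    let T : Set (Finset.Ico (2 * D * k) (2 * D * (k + 1)) → ℝ) :=
      {z | ¬ ∃ q : Finset.Ico (2 * D * k) (2 * D * (k + 1)), q.1 < 2 * D * k + D ∧
        ∀ i : Finset.Ico (2 * D * k) (2 * D * (k + 1)), z q ≤ z i}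
    have hSm : MeasurableSet S := by
      refine measurableSet_setOfPred.2 (Measurable.forall fun j => Measurable.imp measurable_const
        (Measurable.not (Measurable.exists fun q => ?_)))
      refine measurable_const.and (measurable_const.and (Measurable.forall fun i =>
        measurable_const.imp (measurable_const.imp ?_)))
      exact measurableSet_setOfPred.1 (measurableSet_le (measurable_pi_apply q) (measurable_pi_apply i))
    have hTm : MeasurableSet T := by
      refine measurableSet_setOfPred.2 (Measurable.not (Measurable.exists fun q => ?_))
      refine measurable_const.and (Measurable.forall fun i => ?_)
      exact measurableSet_setOfPred.1 (measurableSet_le (measurable_pi_apply q) (measurable_pi_apply i))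
    have hSe : (fun ω (i : Finset.range (2 * D * k)) => W i ω) ⁻¹' S = lateWindows W D k := by
      ext ω
      simp only [S, lateWindows, Set.mem_preimage, Set.mem_ofPred_eq]
      refine forall_congr' fun j => imp_congr_right fun hj => not_congr ?_
      have := hs1 j hj
      have e' : 2 * D * (j + 1) = 2 * D * j + 2 * D := by ring
      constructor
      · rintro ⟨q, h1, h2, h3⟩
        exact ⟨q, h1, h2, fun i hi1 hi2 => h3 ⟨i, Finset.mem_range.2 (by omega)⟩ hi1 hi2⟩
      · rintro ⟨q, h1, h2, h3⟩
        exact ⟨⟨q, Finset.mem_range.2 (by omega)⟩, h1, h2, fun i hi1 hi2 => h3 i hi1 hi2⟩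
    have hTe : (fun ω (i : Finset.Ico (2 * D * k) (2 * D * (k + 1))) => W i ω) ⁻¹' T
        = {ω | ¬ ∃ q, 2 * D * k ≤ q ∧ q < 2 * D * k + D ∧
          ∀ i, 2 * D * k ≤ i → i < 2 * D * (k + 1) → W q ω ≤ W i ω} := by
      ext ω
      simp only [T, Set.mem_preimage, Set.mem_ofPred_eq]
      refine not_congr ?_
      constructor
      · rintro ⟨q, h1, h2⟩
        exact ⟨q, (Finset.mem_Ico.1 q.2).1, h1,
          fun i hi1 hi2 => h2 ⟨i, Finset.mem_Ico.2 ⟨hi1, hi2⟩⟩⟩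
      · rintro ⟨q, h1, h2, h3⟩
        exact ⟨⟨q, Finset.mem_Ico.2 (by omega)⟩, h2, fun i =>
          h3 i (Finset.mem_Ico.1 i.2).1 (Finset.mem_Ico.1 i.2).2⟩
    have hsplit : lateWindows W D (k + 1) =
        (fun ω (i : Finset.range (2 * D * k)) => W i ω) ⁻¹' S ∩
        (fun ω (i : Finset.Ico (2 * D * k) (2 * D * (k + 1))) => W i ω) ⁻¹' T := by
      rw [hSe, hTe]
      ext ω
      simp only [lateWindows, Set.mem_inter_iff, Set.mem_ofPred_eq, Nat.lt_succ_iff_lt_or_eq,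
        or_imp, forall_and, forall_eq]
    rw [hsplit, hind.measure_inter_preimage_eq_mul _ _ hSm hTm, hSe, hTe, pow_succ]
    exact mul_le_mul' ih (hW.measure_late_window_le hD k)

end UniformSequence

/-! ### Almost sure properties and uniform integrability of the age time -/

section UniformSequence

variable {Ω : Type*} [MeasurableSpace Ω] {μ : Measure Ω} {W : ℕ → Ω → ℝ}

theorem measurable_sInf_set_nat : Measurable (sInf : Set ℕ → ℕ) := by
  refine measurable_to_countable' fun m => ?_
  have hmem : ∀ k : ℕ, MeasurableSet {S : Set ℕ | k ∈ S} := fun k => measurableSet_setOfPred.2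
    (measurable_set_mem k)
  -- As `sInf ∅ = 0` in `ℕ`, the fibre over `0` also contains the empty set.
  have h : (sInf : Set ℕ → ℕ) ⁻¹' {m} = ({S | m ∈ S} ∩ ⋂ k < m, {S | k ∈ S}ᶜ) ∪
      {S | m = 0 ∧ ∀ k, k ∉ S} := by
    ext S
    simp only [Set.mem_preimage, Set.mem_singleton_iff, Set.mem_union, Set.mem_inter_iff,
      Set.mem_ofPred_eq, Set.mem_iInter, Set.mem_compl_iff]
    constructor
    · rintro rfl
      rcases S.eq_empty_or_nonempty with rfl | hS
      · right; simp
      · exact Or.inl ⟨Nat.sInf_mem hS, fun k hk => Nat.notMem_of_lt_sInf hk⟩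
    · rintro (⟨h1, h2⟩ | ⟨rfl, h⟩)
      · exact le_antisymm (Nat.sInf_le h1) (le_csInf ⟨m, h1⟩ fun k hk =>
          not_lt.1 fun hlt => h2 k hlt hk)
      · rw [Set.eq_empty_of_forall_notMem h, Nat.sInf_empty]
  rw [h]
  refine ((hmem m).inter (MeasurableSet.iInter fun k => MeasurableSet.iInter fun _ =>
    (hmem k).compl)).union ?_
  rcases eq_or_ne m 0 with rfl | hm
  · simp only [true_and]
    rw [show {S : Set ℕ | ∀ k, k ∉ S} = ⋂ k, {S | k ∈ S}ᶜ by ext; simp]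
    exact MeasurableSet.iInter fun k => (hmem k).compl
  · simp [hm]

theorem IsUniformSequence.measurable_ageTime (hW : IsUniformSequence W μ) (D : ℕ) :
    Measurable fun ω => ageTime (fun k => W k ω) D := by
  refine measurable_sInf_set_nat.comp (measurable_set_iff.2 fun m => ?_)
  refine Measurable.exists fun l => measurable_const.and ?_
  exact measurableSet_setOfPred.1 (hW.measurable_forall_le l m)

theorem IsUniformSequence.ae_mem_Ioo (hW : IsUniformSequence W μ) :
    ∀ᵐ ω ∂μ, ∀ k, W k ω ∈ Set.Ioo (0 : ℝ) 1 := by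
  refine ae_all_iff.2 fun k => ?_
  have h := (hW.hasLaw k).ae_iff (p := fun y => y ∈ Set.Ioo (0 : ℝ) 1)
    (measurableSet_setOfPred.1 measurableSet_Ioo)
  rw [h, Measure.restrict_congr_set Ioo_ae_eq_Icc.symm]
  exact ae_restrict_mem measurableSet_Ioo

theorem IsUniformSequence.ae_exists_lt (hW : IsUniformSequence W μ) :
    ∀ᵐ ω ∂μ, ∀ ε > 0, ∃ k, W k ω < ε := by
  have h : ∀ r : ℕ, ∀ᵐ ω ∂μ, ∃ k, W k ω < 1 / ((r : ℝ) + 1) := by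
    intro r
    have hr : 1 / ((r : ℝ) + 1) ∈ Set.Icc (0 : ℝ) 1 :=
      ⟨by positivity, by rw [div_le_one (by positivity)]; linarith [Nat.cast_nonneg (α := ℝ) r]⟩
    have hb : ∀ N : ℕ, μ {ω | ¬ ∃ k, W k ω < 1 / ((r : ℝ) + 1)}
        ≤ ENNReal.ofReal (1 - 1 / ((r : ℝ) + 1)) ^ N := by
      intro N
      have h1 := hW.iIndepFun.measure_inter_preimage_eq_mul (Finset.range N)
        (sets := fun _ => Set.Ici (1 / ((r : ℝ) + 1))) (fun _ _ => measurableSet_Ici)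
      have h3 : ∀ k ∈ Finset.range N, μ (W k ⁻¹' Set.Ici (1 / ((r : ℝ) + 1)))
          = ENNReal.ofReal (1 - 1 / ((r : ℝ) + 1)) := fun k _ => by
        rw [← Measure.map_apply (hW.measurable k) measurableSet_Ici, (hW.hasLaw k).map_eq,
          volume_restrict_Icc_Ici hr]
      rw [Finset.prod_congr rfl h3, Finset.prod_const, Finset.card_range] at h1
      rw [← h1]
      refine measure_mono fun ω hω => ?_
      simp only [Set.mem_ofPred_eq, not_exists, not_lt] at hω
      simpa using fun k _ => hω k
    rw [ae_iff]
    have hlim : Tendsto (fun N => ENNReal.ofReal (1 - 1 / ((r : ℝ) + 1)) ^ N) atTop (𝓝 0) := by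
      refine ENNReal.tendsto_pow_atTop_nhds_zero_of_lt_one ?_
      rw [ENNReal.ofReal_lt_one]
      have : 0 < 1 / ((r : ℝ) + 1) := by positivity
      linarith
    exact le_antisymm (ge_of_tendsto' hlim hb) zero_le
  filter_upwards [ae_all_iff.2 h] with ω hω ε hε
  obtain ⟨r, hr⟩ := exists_nat_one_div_lt hε
  obtain ⟨k, hk⟩ := hω r
  exact ⟨k, hk.trans hr⟩

variable [IsProbabilityMeasure μ]

/-- `W i ≤ W j` and `W j ≤ W i` have probability `1 / 2` each and together cover the space, so their
intersection is null. -/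
theorem IsUniformSequence.ae_injective (hW : IsUniformSequence W μ) :
    ∀ᵐ ω ∂μ, Function.Injective fun k => W k ω := by
  have h : ∀ i j, i ≠ j → ∀ᵐ ω ∂μ, W i ω ≠ W j ω := by
    intro i j hij
    have half : ∀ i j, i ≠ j → μ {ω | W i ω ≤ W j ω} = ENNReal.ofReal (1 / 2) := by
      intro i j hij
      have := hW.measure_forall_le (l := i) (S := {j}) (by simpa using hij)
      simp only [Finset.mem_singleton, forall_eq, Finset.card_singleton, Nat.cast_one] at this
      rw [this]
      norm_num
    have hu : {ω | W i ω ≤ W j ω} ∪ {ω | W j ω ≤ W i ω} = Set.univ := by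
      ext ω
      simp [le_total]
    have h1 := measure_union_add_inter {ω | W i ω ≤ W j ω}
      (measurableSet_le (hW.measurable j) (hW.measurable i)) (μ := μ)
    rw [hu, measure_univ, half i j hij, half j i hij.symm, ← ENNReal.ofReal_add (by norm_num)
      (by norm_num), show (1 / 2 + 1 / 2 : ℝ) = 1 by norm_num, ENNReal.ofReal_one] at h1
    have h2 : μ ({ω | W i ω ≤ W j ω} ∩ {ω | W j ω ≤ W i ω}) = 0 := by
      have := ENNReal.add_right_inj (a := 1) (b := μ ({ω | W i ω ≤ W j ω} ∩ {ω | W j ω ≤ W i ω}))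
        (c := 0) ENNReal.one_ne_top
      exact this.1 (by rw [h1, add_zero])
    rw [ae_iff]
    refine measure_mono_null ?_ h2
    intro ω hω
    simp only [ne_eq, not_not, Set.mem_ofPred_eq] at hω
    exact ⟨hω.le, hω.ge⟩
  have h' : ∀ᵐ ω ∂μ, ∀ i j, i ≠ j → W i ω ≠ W j ω :=
    ae_all_iff.2 fun i => ae_all_iff.2 fun j => by
      by_cases hij : i = j
      · simp [hij]
      · filter_upwards [h i j hij] with ω hω _ using hω
  filter_upwards [h'] with ω hω i j hij
  by_contra hne
  exact hω i j hne hij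

theorem IsUniformSequence.ae_isCostSequence (hW : IsUniformSequence W μ) :
    ∀ᵐ ω ∂μ, IsCostSequence fun k => W k ω := by
  filter_upwards [hW.ae_injective, hW.ae_mem_Ioo, hW.ae_exists_lt] with ω h1 h2 h3
  exact ⟨h1, fun k => (h2 k).1, fun k => (h2 k).2, h3⟩

theorem not_mem_lateWindows {Ω : Type*} {W : ℕ → Ω → ℝ} {D k : ℕ} {ω : Ω} (h : ω ∉ lateWindows W D k) :
    (∃ m l, l + D ≤ m ∧ ∀ k ≤ m, W l ω ≤ W k ω) ∧ ageTime (fun k => W k ω) D < 2 * D * k := by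
  simp only [lateWindows, Set.mem_ofPred_eq, not_forall, not_not] at h
  obtain ⟨j, hj, q, h1, h2, h3⟩ := h
  obtain ⟨h4, h5⟩ := ageTime_lt_of_window (w := fun k => W k ω) h1 h2 h3
  exact ⟨h4, h5.trans_le (Nat.mul_le_mul_left _ hj)⟩

theorem IsUniformSequence.ae_exists_age (hW : IsUniformSequence W μ) :
    ∀ᵐ ω ∂μ, ∀ D, ∃ m l, l + D ≤ m ∧ ∀ k ≤ m, W l ω ≤ W k ω := by
  refine ae_all_iff.2 fun D => ?_
  rcases Nat.eq_zero_or_pos D with rfl | hD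
  · exact Eventually.of_forall fun ω => ⟨0, 0, by simp⟩
  rw [ae_iff]
  have hlim : Tendsto (fun k => (1 / 2 : ℝ≥0∞) ^ k) atTop (𝓝 0) :=
    ENNReal.tendsto_pow_atTop_nhds_zero_of_lt_one (by simp)
  refine le_antisymm (ge_of_tendsto' hlim fun k => ?_) zero_le
  refine (measure_mono fun ω hω => ?_).trans (hW.measure_lateWindows_le hD k)
  by_contra hcon
  exact hω (not_mem_lateWindows hcon).1

/-- Cut at multiples of `2 * D`: the age time is at most `2 * D` times the number of `k ≥ 0` with `2
* D * k ≤ ageTime`. Each such event forces `k` late windows, so its part in `A` has measure at most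
`μ A` and at most `(1 / 2) ^ k`. This is a quantitative uniform integrability of `ageTime / D`, with
a bound that depends on `A` only through `μ A`. -/
theorem IsUniformSequence.setLIntegral_ageTime_le (hW : IsUniformSequence W μ) {D : ℕ}
    (hD : 0 < D) (A : Set Ω) :
    ∫⁻ ω in A, (ageTime (fun k => W k ω) D : ℝ≥0∞) ∂μ
      ≤ 2 * D * ∑' k : ℕ, min (μ A) ((1 / 2) ^ k) := by
  have hm : ∀ k, MeasurableSet {ω | 2 * D * k ≤ ageTime (fun k => W k ω) D} := fun k =>
    measurableSet_le measurable_const (hW.measurable_ageTime D)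
  have hpt : ∀ ω, (ageTime (fun k => W k ω) D : ℝ≥0∞) ≤ ∑' k : ℕ, 2 * (D : ℝ≥0∞) *
      ({ω | 2 * D * k ≤ ageTime (fun k => W k ω) D}.indicator (1 : Ω → ℝ≥0∞) ω) := by
    intro ω
    set a := ageTime (fun k => W k ω) D
    refine le_trans ?_ (ENNReal.sum_le_tsum (Finset.range (a / (2 * D) + 1)))
    have : ∀ k ∈ Finset.range (a / (2 * D) + 1), 2 * (D : ℝ≥0∞) *
        ({ω | 2 * D * k ≤ ageTime (fun k => W k ω) D}.indicator (1 : Ω → ℝ≥0∞) ω) = 2 * D := by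
      intro k hk
      rw [Set.indicator_of_mem]
      · simp
      · rw [Finset.mem_range, Nat.lt_succ_iff, Nat.le_div_iff_mul_le (by omega)] at hk
        show 2 * D * k ≤ a
        rwa [mul_comm]
    rw [Finset.sum_congr rfl this, Finset.sum_const, Finset.card_range, nsmul_eq_mul]
    have := Nat.lt_mul_div_succ a (show 0 < 2 * D by omega)
    rw [mul_comm] at this
    exact_mod_cast this.le
  refine (lintegral_mono hpt).trans ?_
  rw [lintegral_tsum fun k => ((measurable_one.indicator (hm k)).const_mul _).aemeasurable]
  rw [← ENNReal.tsum_mul_left]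
  refine ENNReal.tsum_le_tsum fun k => ?_
  rw [lintegral_const_mul _ (measurable_one.indicator (hm k)), lintegral_indicator_one (hm k)]
  gcongr
  refine le_min ?_ ?_
  · exact (measure_mono (Set.subset_univ _)).trans (by simp)
  · refine (Measure.restrict_apply_le _ _).trans ((measure_mono fun ω hω => ?_).trans
      (hW.measure_lateWindows_le hD k))
    by_contra hcon
    exact absurd (not_mem_lateWindows hcon).2 (not_lt.2 hω)

theorem tsum_one_half_pow : ∑' k : ℕ, (1 / 2 : ℝ≥0∞) ^ k = 2 := by
  rw [ENNReal.tsum_geometric]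
  simp

/-- Dominated convergence for the counting measure, with the geometric series as dominating
function. -/
theorem tendsto_tsum_min_pow :
    Tendsto (fun a : ℝ≥0∞ => ∑' k : ℕ, min a ((1 / 2) ^ k)) (𝓝 0) (𝓝 0) := by
  have h := tendsto_lintegral_filter_of_dominated_convergence (μ := Measure.count) (l := 𝓝 0)
    (F := fun (a : ℝ≥0∞) (k : ℕ) => min a ((1 / 2 : ℝ≥0∞) ^ k)) (f := fun _ => 0)
    (fun k => (1 / 2) ^ k) (Eventually.of_forall fun a => Measurable.of_discrete)
    (Eventually.of_forall fun a => Eventually.of_forall fun k => min_le_right _ _)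
    (by rw [lintegral_count, tsum_one_half_pow]; simp)
    (Eventually.of_forall fun k => by
      have : Tendsto (fun a : ℝ≥0∞ => min a ((1 / 2 : ℝ≥0∞) ^ k)) (𝓝 0)
        (𝓝 (min 0 ((1 / 2 : ℝ≥0∞) ^ k))) := tendsto_id.min tendsto_const_nhds
      simpa using this)
  simpa [lintegral_count] using h

theorem IsUniformSequence.lintegral_ageTime_le (hW : IsUniformSequence W μ) {D : ℕ}
    (hD : 0 < D) : ∫⁻ ω, (ageTime (fun k => W k ω) D : ℝ≥0∞) ∂μ ≤ 4 * D := by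
  have h := hW.setLIntegral_ageTime_le hD Set.univ
  rw [setLIntegral_univ] at h
  refine h.trans ?_
  have : ∑' k : ℕ, min (μ Set.univ) ((1 / 2 : ℝ≥0∞) ^ k) ≤ 2 := by
    refine le_trans ?_ tsum_one_half_pow.le
    exact ENNReal.tsum_le_tsum fun k => min_le_right _ _
  calc 2 * (D : ℝ≥0∞) * ∑' k : ℕ, min (μ Set.univ) ((1 / 2 : ℝ≥0∞) ^ k) ≤ 2 * D * 2 := by gcongr
    _ = 4 * D := by ring

/-- Unless some duration falls in `D + 1, …, D + d`, the difference is at most `d`. That event has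
probability at most `d / (D + 1)`, and on it the larger age time is integrated by means of
`setLIntegral_ageTime_le`. -/
theorem IsUniformSequence.lintegral_ageTime_sub_le (hW : IsUniformSequence W μ) {D d : ℕ}
    (hD : 0 < D) :
    ∫⁻ ω, ((ageTime (fun k => W k ω) (D + d) : ℝ≥0∞) - ageTime (fun k => W k ω) D) ∂μ
      ≤ d + 2 * (D + d : ℕ) *
        ∑' k : ℕ, min (ENNReal.ofReal (d / (D + 1))) ((1 / 2 : ℝ≥0∞) ^ k) := by
  set A := {ω | ∃ D', D ≤ D' ∧ D' < D + d ∧ ∃ l, HasRecordOfDuration (fun k => W k ω) D' l}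
  have hA : MeasurableSet A := by
    have : A = ⋃ D', ⋃ (_ : D ≤ D'), ⋃ (_ : D' < D + d), ⋃ l,
        {ω | HasRecordOfDuration (fun k => W k ω) D' l} := by
      ext ω
      simp only [A, Set.mem_ofPred_eq, Set.mem_iUnion, exists_prop]
    rw [this]
    exact MeasurableSet.iUnion fun D' => MeasurableSet.iUnion fun _ => MeasurableSet.iUnion fun _ =>
      MeasurableSet.iUnion fun l => hW.measurableSet_hasRecordOfDuration D' l
  have hae : ∀ᵐ ω ∂μ, ((ageTime (fun k => W k ω) (D + d) : ℝ≥0∞) - ageTime (fun k => W k ω) D)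
      ≤ d + A.indicator (fun ω => (ageTime (fun k => W k ω) (D + d) : ℝ≥0∞)) ω := by
    filter_upwards [hW.ae_exists_age] with ω hω
    by_cases hωA : ω ∈ A
    · rw [Set.indicator_of_mem hωA]
      exact tsub_le_self.trans le_add_self
    · rw [Set.indicator_of_notMem hωA, add_zero, tsub_le_iff_left]
      have := ageTime_add_le (w := fun k => W k ω) (D := D) (d := d) hω
        fun D' h1 h2 l h3 => hωA ⟨D', h1, h2, l, h3⟩
      exact_mod_cast this
  refine (lintegral_mono_ae hae).trans ?_
  rw [lintegral_add_left measurable_const, lintegral_const, measure_univ, mul_one,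
    lintegral_indicator hA]
  gcongr
  refine (hW.setLIntegral_ageTime_le (by omega) A).trans ?_
  gcongr
  exact hW.measure_exists_hasRecordOfDuration_le D d

/-- The difference is `K` times the number of records of duration exactly `K` before the first
longer one; the sum over `l` bounds this number by all records of that duration. -/
theorem IsUniformSequence.ae_poissonFunctional_le (hW : IsUniformSequence W μ) {K : ℕ}
    (hK : 0 < K) : ∀ᵐ ω ∂μ,
      poissonFunctional K (recordProcess (fun k => W k ω) K) ≤ ageTime (fun k => W k ω) K ∧
      (ageTime (fun k => W k ω) K : ℝ≥0∞)
        ≤ poissonFunctional K (recordProcess (fun k => W k ω) K) + K * ∑' l,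
        Set.indicator {l | HasRecordOfDuration (fun k => W k ω) (K - 1) l} 1 l := by
  filter_upwards [hW.ae_isCostSequence, hW.ae_exists_age] with ω h1 h2
  obtain ⟨J, h3, h4, h5⟩ := h1.exists_first_lt_recordDuration K (h2 K)
  have h6 := h1.poissonFunctional_add h3 h4
  have h7 := h1.card_le_tsum (K := K - 1) J
  rw [Nat.sub_add_cancel hK] at h7
  refine ⟨by omega, ?_⟩
  rw [h5, ← h6]
  push_cast
  gcongr

/-- There are in mean at most `1 / K` records of duration `K`, so omitting them costs at most `1`,
whatever `K` is. -/
theorem IsUniformSequence.lintegral_tsum_hasRecordOfDuration_le (hW : IsUniformSequence W μ)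
    {K : ℕ} (hK : 0 < K) :
    ∫⁻ ω, (K : ℝ≥0∞) * ∑' l,
      Set.indicator {l | HasRecordOfDuration (fun k => W k ω) (K - 1) l} 1 l ∂μ ≤ 1 := by
  have hm : ∀ l, Measurable fun ω =>
      Set.indicator {l | HasRecordOfDuration (fun k => W k ω) (K - 1) l} (1 : ℕ → ℝ≥0∞) l :=
    fun l => (measurable_one (α := ℝ≥0∞)).indicator
      (hW.measurableSet_hasRecordOfDuration (K - 1) l)
  rw [lintegral_const_mul _ (Measurable.tsum hm),
    lintegral_tsum fun l => (hm l).aemeasurable]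
  have h1 : ∀ l, ∫⁻ ω, Set.indicator {l | HasRecordOfDuration (fun k => W k ω) (K - 1) l}
      (1 : ℕ → ℝ≥0∞) l ∂μ = μ {ω | HasRecordOfDuration (fun k => W k ω) (K - 1) l} := fun l =>
    lintegral_indicator_one (hW.measurableSet_hasRecordOfDuration (K - 1) l)
  simp only [h1]
  refine (mul_le_mul_right (hW.tsum_measure_hasRecordOfDuration_le (K - 1)) _).trans ?_
  have hK' : ((K - 1 : ℕ) : ℝ) + 1 = K := by exact_mod_cast Nat.sub_add_cancel hK
  rw [hK', ← ENNReal.ofReal_natCast, ← ENNReal.ofReal_mul (by positivity),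
    mul_one_div_cancel (by positivity), ENNReal.ofReal_one]

end UniformSequence

/-! ### The number of records -/

section UniformSequence

variable {Ω : Type*} [MeasurableSpace Ω] {μ : Measure Ω} {W : ℕ → Ω → ℝ}

/-- A process driven by an independent sequence is at each time measurable and independent of the
next term. -/
theorem IsUniformSequence.indepFun_of_recursion (hW : IsUniformSequence W μ) {α : Type*}
    [MeasurableSpace α] {X : ℕ → Ω → α} {f : ℝ → α} {step : α × ℝ → α} (hf : Measurable f)
    (hstep : Measurable step) (h0 : ∀ ω, X 0 ω = f (W 0 ω))
    (hs : ∀ m ω, X (m + 1) ω = step (X m ω, W (m + 1) ω)) (m : ℕ) :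
    Measurable (X m) ∧ IndepFun (X m) (W (m + 1)) μ := by
  have key : ∃ F : (Finset.range (m + 1) → ℝ) → α, Measurable F ∧
      ∀ ω, X m ω = F fun k => W k ω := by
    induction m with
    | zero =>
      exact ⟨fun z => f (z ⟨0, by simp⟩), hf.comp (measurable_pi_apply _), fun ω => h0 ω⟩
    | succ m ih =>
      obtain ⟨F, hF, hX⟩ := ih
      refine ⟨fun z => step (F fun k => z ⟨k.1, by have := Finset.mem_range.1 k.2; simp; omega⟩,
        z ⟨m + 1, by simp⟩), hstep.comp (Measurable.prodMk (hF.comp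
          (measurable_pi_lambda _ fun k => measurable_pi_apply _)) (measurable_pi_apply _)),
        fun ω => ?_⟩
      rw [hs, hX]
  obtain ⟨F, hF, hX⟩ := key
  have hX' : X m = F ∘ fun ω (k : Finset.range (m + 1)) => W k ω := funext hX
  rw [hX']
  refine ⟨hF.comp (measurable_pi_lambda _ fun k => hW.measurable k), ?_⟩
  exact ((hW.indepFun_tuple (l := m + 1) (S := Finset.range (m + 1)) (by simp)).symm).comp hF
    measurable_id

/-- The minimum of the terms `w 0, …, w m`. -/
def runningMin (w : ℕ → ℝ) : ℕ → ℝ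
  | 0 => w 0
  | m + 1 => min (runningMin w m) (w (m + 1))

theorem lt_runningMin_iff {w : ℕ → ℝ} {m : ℕ} {y : ℝ} :
    y < runningMin w m ↔ ∀ i ≤ m, y < w i := by
  induction m with
  | zero => simp [runningMin]
  | succ m ih =>
    rw [runningMin, lt_min_iff, ih]
    constructor
    · rintro ⟨h1, h2⟩ i hi
      rcases Nat.le_succ_iff.1 hi with h | rfl
      · exact h1 i h
      · exact h2
    · exact fun h => ⟨fun i hi => h i (by omega), h _ le_rfl⟩

theorem recordCount_zero (w : ℕ → ℝ) : recordCount w 0 = 1 := by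
  simp [recordCount, Finset.filter_singleton]

theorem recordCount_succ (w : ℕ → ℝ) (m : ℕ) :
    recordCount w (m + 1) = recordCount w m + if w (m + 1) < runningMin w m then 1 else 0 := by
  unfold recordCount
  rw [Finset.range_add_one (n := m + 1), Finset.filter_insert]
  have h : (∀ i < m + 1, w (m + 1) < w i) ↔ w (m + 1) < runningMin w m := by
    rw [lt_runningMin_iff]
    simp only [Nat.lt_succ_iff]
  simp only [h]
  split_ifs
  · rw [Finset.card_insert_of_notMem (by simp)]
  · simp

theorem recordCount_mono (w : ℕ → ℝ) : Monotone (recordCount w) :=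
  monotone_nat_of_le_succ fun m => by rw [recordCount_succ]; exact Nat.le_add_right _ _

/-- `∫₀ˣ 2 y dy + (1 - x) x = x`: the factor `2` at a record exactly offsets the mean decrease of
the minimum. So `2 ^ recordCount * runningMin` is a martingale. -/
theorem lintegral_min_weighted {x : ℝ} (hx : x ∈ Set.Icc (0 : ℝ) 1) (r : ℕ) :
    ∫⁻ y in Set.Icc (0 : ℝ) 1, 2 ^ (r + if y < x then 1 else 0) * ENNReal.ofReal (min x y)
      = 2 ^ r * ENNReal.ofReal x := by
  have h1 : ∀ y ∈ Set.Icc (0 : ℝ) 1,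
      (2 : ℝ≥0∞) ^ (r + if y < x then 1 else 0) * ENNReal.ofReal (min x y)
      = 2 ^ r * ENNReal.ofReal (if y < x then 2 * y else x) := by
    intro y hy
    split_ifs with h
    · rw [min_eq_right h.le, pow_add, ENNReal.ofReal_mul two_pos.le]
      simp [mul_assoc]
    · rw [min_eq_left (not_lt.1 h)]
      simp
  rw [setLIntegral_congr_fun measurableSet_Icc h1, lintegral_const_mul _ (by
    refine ENNReal.measurable_ofReal.comp (Measurable.ite measurableSet_Iio ?_ ?_) <;> fun_prop)]
  congr 1
  have hmeas : Measurable fun y : ℝ => if y < x then 2 * y else x :=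
    Measurable.ite measurableSet_Iio (by fun_prop) (by fun_prop)
  have hint : IntegrableOn (fun y : ℝ => if y < x then 2 * y else x) (Set.Icc 0 1) := by
    refine Measure.integrableOn_of_bounded (M := 2) (by simp) hmeas.aestronglyMeasurable ?_
    filter_upwards [ae_restrict_mem measurableSet_Icc] with y hy
    rw [Real.norm_eq_abs, abs_le]
    split_ifs <;> constructor <;> linarith [hy.1, hy.2, hx.1, hx.2]
  rw [← ofReal_integral_eq_lintegral_ofReal hint]
  · congr 1
    rw [integral_Icc_eq_integral_Ioc, ← intervalIntegral.integral_of_le zero_le_one]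
    have hii : ∀ a b, a ∈ Set.Icc (0 : ℝ) 1 → b ∈ Set.Icc (0 : ℝ) 1 → a ≤ b →
        IntervalIntegrable (fun y : ℝ => if y < x then 2 * y else x) volume a b :=
      fun a b ha hb hab => (intervalIntegrable_iff_integrableOn_Icc_of_le hab).2
        (hint.mono_set (Set.Icc_subset_Icc ha.1 hb.2))
    rw [← intervalIntegral.integral_add_adjacent_intervals
      (hii 0 x (by simp) hx hx.1) (hii x 1 hx (by simp) hx.2)]
    have e1 : ∫ y in (0 : ℝ)..x, (if y < x then 2 * y else x) = ∫ y in (0 : ℝ)..x, 2 * y := by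
      refine intervalIntegral.integral_congr_ae ?_
      filter_upwards [compl_mem_ae_iff.2 (measure_singleton x)] with y hne hy
      rw [Set.uIoc_of_le hx.1] at hy
      rw [if_pos (lt_of_le_of_ne hy.2 hne)]
    have e2 : ∫ y in x..1, (if y < x then 2 * y else x) = ∫ y in x..1, x := by
      refine intervalIntegral.integral_congr fun y hy => ?_
      rw [Set.uIcc_of_le hx.2] at hy
      simp [not_lt.2 hy.1]
    rw [e1, e2, intervalIntegral.integral_const_mul, integral_id, intervalIntegral.integral_const,
      smul_eq_mul]
    ring
  · filter_upwards [ae_restrict_mem measurableSet_Icc] with y hy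
    simp only [Pi.zero_apply]
    split_ifs
    · linarith [hy.1]
    · exact hx.1

theorem IsUniformSequence.measurable_recordCount (hW : IsUniformSequence W μ) (m : ℕ) :
    Measurable fun ω => recordCount (fun k => W k ω) m := by
  simp only [recordCount, Finset.card_filter]
  refine Finset.measurable_fun_sum _ fun k _ => Measurable.ite ?_ measurable_const measurable_const
  rw [show {ω | ∀ i < k, W k ω < W i ω} = ⋂ i, ⋂ (_ : i < k), {ω | W k ω < W i ω} by ext; simp]
  exact MeasurableSet.iInter fun i => MeasurableSet.iInter fun _ =>
    measurableSet_lt (hW.measurable k) (hW.measurable i)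

theorem IsUniformSequence.measurable_runningMin (hW : IsUniformSequence W μ) (m : ℕ) :
    Measurable fun ω => runningMin (fun k => W k ω) m := by
  induction m with
  | zero => exact hW.measurable 0
  | succ m ih => exact ih.min (hW.measurable _)

theorem IsUniformSequence.measure_runningMin_lt (hW : IsUniformSequence W μ) (m : ℕ) (ε : ℝ) :
    μ {ω | runningMin (fun k => W k ω) m < ε} ≤ (m + 1) * ENNReal.ofReal ε := by
  have hsub : {ω | runningMin (fun k => W k ω) m < ε} ⊆ ⋃ k ∈ Finset.range (m + 1),
      {ω | W k ω < ε} := by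
    intro ω hω
    by_contra hcon
    simp only [Set.mem_iUnion, Finset.mem_range, exists_prop, Set.mem_ofPred_eq, not_exists,
      not_and, not_lt] at hcon
    have : ∀ m', m' ≤ m → ε ≤ runningMin (fun k => W k ω) m' := by
      intro m'
      induction m' with
      | zero => exact fun _ => hcon 0 (by omega)
      | succ m' ih => exact fun h => le_min (ih (by omega)) (hcon _ (by omega))
    exact absurd hω (not_lt.2 (this m le_rfl))
  refine (measure_mono hsub).trans ((measure_biUnion_finset_le _ _).trans ?_)
  have h : ∀ k ∈ Finset.range (m + 1), μ {ω | W k ω < ε} ≤ ENNReal.ofReal ε := by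
    intro k _
    rw [show {ω | W k ω < ε} = W k ⁻¹' Set.Iio ε from rfl,
      ← Measure.map_apply (hW.measurable k) measurableSet_Iio, (hW.hasLaw k).map_eq,
      Measure.restrict_apply measurableSet_Iio]
    refine (measure_mono (t := Set.Icc 0 ε) fun y hy => ⟨hy.2.1, le_of_lt hy.1⟩).trans ?_
    rw [Real.volume_Icc, sub_zero]
  refine (Finset.sum_le_card_nsmul _ _ _ h).trans (le_of_eq ?_)
  rw [Finset.card_range, nsmul_eq_mul]
  push_cast
  rfl

variable [IsProbabilityMeasure μ]

theorem IsUniformSequence.lintegral_two_pow_recordCount (hW : IsUniformSequence W μ) (m : ℕ) :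
    ∫⁻ ω, 2 ^ recordCount (fun k => W k ω) m * ENNReal.ofReal (runningMin (fun k => W k ω) m) ∂μ
      = 1 := by
  have hrec := hW.indepFun_of_recursion (α := ℕ × ℝ)
    (X := fun m ω => (recordCount (fun k => W k ω) m, runningMin (fun k => W k ω) m))
    (f := fun y => (1, y))
    (step := fun z => (z.1.1 + if z.2 < z.1.2 then 1 else 0, min z.1.2 z.2))
    (by fun_prop)
    (Measurable.prodMk (Measurable.add (by fun_prop) (Measurable.ite
      (measurableSet_lt (by fun_prop) (by fun_prop)) measurable_const measurable_const))
      (by fun_prop))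
    (fun ω => by simp [recordCount_zero, runningMin])
    (fun m ω => by simp [recordCount_succ, runningMin])
  have hmem : ∀ m, ∀ᵐ ω ∂μ, runningMin (fun k => W k ω) m ∈ Set.Icc (0 : ℝ) 1 := by
    intro m
    filter_upwards [hW.ae_mem_Ioo] with ω hω
    induction m with
    | zero => exact Set.Ioo_subset_Icc_self (hω 0)
    | succ m ih =>
      exact ⟨le_min ih.1 (hω _).1.le, (min_le_left _ _).trans ih.2⟩
  have hpow : Measurable fun r : ℕ => (2 : ℝ≥0∞) ^ r := Measurable.of_discrete
  induction m with
  | zero =>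
    -- The initial term is treated as a step of the martingale from a fictitious minimum `1`.
    have h1 := lintegral_min_weighted (x := 1) (by simp) 0
    rw [pow_zero, ENNReal.ofReal_one, one_mul] at h1
    rw [← h1]
    simp only [recordCount_zero, runningMin]
    have hm : Measurable fun y : ℝ =>
        (2 : ℝ≥0∞) ^ (0 + if y < 1 then 1 else 0) * ENNReal.ofReal (min 1 y) :=
      Measurable.mul (hpow.comp (measurable_const.add (Measurable.ite measurableSet_Iio
        measurable_const measurable_const))) (by fun_prop)
    rw [← (hW.hasLaw 0).map_eq, lintegral_map hm (hW.measurable 0)]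
    refine lintegral_congr_ae ?_
    filter_upwards [hW.ae_mem_Ioo] with ω hω
    rw [if_pos (hω 0).2, min_eq_right (hω 0).2.le]
  | succ m ih =>
    obtain ⟨hXm, hXi⟩ := hrec m
    set X : Ω → ℕ × ℝ := fun ω => (recordCount (fun k => W k ω) m, runningMin (fun k => W k ω) m)
    let F : (ℕ × ℝ) × ℝ → ℝ≥0∞ := fun z =>
      2 ^ (z.1.1 + if z.2 < z.1.2 then 1 else 0) * ENNReal.ofReal (min z.1.2 z.2)
    have hF : Measurable F := by
      refine Measurable.mul (hpow.comp (Measurable.add (by fun_prop) (Measurable.ite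
        (measurableSet_lt (by fun_prop) (by fun_prop)) measurable_const measurable_const)))
        (by fun_prop)
    have h1 : ∫⁻ ω, 2 ^ recordCount (fun k => W k ω) (m + 1)
        * ENNReal.ofReal (runningMin (fun k => W k ω) (m + 1)) ∂μ
        = ∫⁻ ω, F (X ω, W (m + 1) ω) ∂μ := by
      simp only [recordCount_succ, runningMin, F, X]
    rw [h1, ← lintegral_map hF (hXm.prodMk (hW.measurable _)),
      hXi.map_prod_eq_prod_map_map hXm.aemeasurable (hW.measurable _).aemeasurable,
      (hW.hasLaw _).map_eq, lintegral_prod _ hF.aemeasurable,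
      lintegral_map (Measurable.lintegral_prod_right' hF) hXm, ← ih]
    refine lintegral_congr_ae ?_
    filter_upwards [hmem m] with ω hω
    exact lintegral_min_weighted hω _

/-- A sequence of `m + 1` independent uniform random variables does not have many records. -/
theorem IsUniformSequence.measure_lt_recordCount_le (hW : IsUniformSequence W μ) (m M : ℕ) {ε : ℝ}
    (hε : 0 < ε) :
    μ {ω | M < recordCount (fun k => W k ω) m}
      ≤ (m + 1) * ENNReal.ofReal ε + ENNReal.ofReal (1 / (2 ^ M * ε)) := by
  have hmarkov := mul_meas_ge_le_lintegral₀ (μ := μ) (f := fun ω =>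
    2 ^ recordCount (fun k => W k ω) m * ENNReal.ofReal (runningMin (fun k => W k ω) m))
    (((Measurable.of_discrete (f := fun r : ℕ => (2 : ℝ≥0∞) ^ r)).comp
      (hW.measurable_recordCount m)).mul (ENNReal.measurable_ofReal.comp
      (hW.measurable_runningMin m))).aemeasurable (ENNReal.ofReal (2 ^ M * ε))
  rw [hW.lintegral_two_pow_recordCount] at hmarkov
  have hpos : 0 < (2 : ℝ) ^ M * ε := by positivity
  have h1 : μ {ω | ENNReal.ofReal (2 ^ M * ε) ≤ 2 ^ recordCount (fun k => W k ω) m *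
      ENNReal.ofReal (runningMin (fun k => W k ω) m)} ≤ ENNReal.ofReal (1 / (2 ^ M * ε)) := by
    rw [ENNReal.ofReal_div_of_pos hpos, ENNReal.ofReal_one,
      ENNReal.le_div_iff_mul_le (Or.inl (ENNReal.ofReal_pos.2 hpos).ne')
        (Or.inl ENNReal.ofReal_ne_top), mul_comm]
    exact hmarkov
  refine (measure_mono (fun ω hω => ?_)).trans ((measure_union_le _ _).trans
    (add_le_add (hW.measure_runningMin_lt m ε) h1))
  rcases lt_or_ge (runningMin (fun k => W k ω) m) ε with h | h
  · exact Or.inl h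
  · right
    show ENNReal.ofReal (2 ^ M * ε) ≤ _
    rw [ENNReal.ofReal_mul (by positivity), ENNReal.ofReal_pow two_pos.le, ENNReal.ofReal_ofNat]
    gcongr
    · norm_num
    · exact le_of_lt hω

end UniformSequence

/-! ### Chernoff bounds -/

section Chernoff

variable {Ω : Type*} [MeasurableSpace Ω] {μ : Measure Ω} [IsProbabilityMeasure μ]

open Classical in
/-- The generating function of the number of events that occur, among events each family of which
occurs simultaneously with the probability it would have if they were independent. -/
theorem integral_pow_card_filter {ι : Type*} {S : Finset ι} {A : ι → Set Ω} {q : ℝ}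
    (hA : ∀ i ∈ S, MeasurableSet (A i)) (hq : ∀ T ⊆ S, μ.real (⋂ i ∈ T, A i) = q ^ T.card) (a : ℝ) :
    ∫ ω, (1 + a) ^ (S.filter fun i => ω ∈ A i).card ∂μ = (1 + a * q) ^ S.card := by
  have h1 : ∀ ω, (1 + a) ^ (S.filter fun i => ω ∈ A i).card
      = ∑ T ∈ S.powerset, (⋂ i ∈ T, A i).indicator (fun _ => a ^ T.card) ω := by
    intro ω
    rw [← Finset.prod_const, Finset.prod_filter]
    have : ∀ i ∈ S, (if ω ∈ A i then 1 + a else 1) = 1 + if ω ∈ A i then a else 0 := by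
      intro i _; split_ifs <;> simp
    rw [Finset.prod_congr rfl this, Finset.prod_one_add]
    refine Finset.sum_congr rfl fun T _ => ?_
    by_cases h : ∀ i ∈ T, ω ∈ A i
    · rw [Set.indicator_of_mem (by simpa using h), Finset.prod_congr rfl fun i hi => if_pos (h i hi),
        Finset.prod_const]
    · rw [Set.indicator_of_notMem (by simpa using h)]
      push Not at h
      obtain ⟨i, hi, hω⟩ := h
      exact Finset.prod_eq_zero hi (if_neg hω)
  have hm : ∀ T ∈ S.powerset, MeasurableSet (⋂ i ∈ T, A i) := fun T hT =>
    Finset.measurableSet_biInter T fun i hi => hA i (Finset.mem_powerset.1 hT hi)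
  simp only [h1]
  rw [integral_finsetSum _ fun T hT => (integrable_const _).indicator (hm T hT)]
  have h2 : ∀ T ∈ S.powerset, ∫ ω, (⋂ i ∈ T, A i).indicator (fun _ => a ^ T.card) ω ∂μ
      = ∏ i ∈ T, (a * q) := by
    intro T hT
    rw [integral_indicator_const _ (hm T hT), hq T (Finset.mem_powerset.1 hT), Finset.prod_const,
      mul_pow, smul_eq_mul, mul_comm]
  rw [Finset.sum_congr rfl h2, ← Finset.prod_one_add, Finset.prod_const]

open Classical in
theorem measurable_card_filter {ι : Type*} {S : Finset ι} {A : ι → Set Ω}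
    (hA : ∀ i ∈ S, MeasurableSet (A i)) :
    Measurable fun ω => (S.filter fun i => ω ∈ A i).card := by
  simp only [Finset.card_filter]
  exact Finset.measurable_fun_sum _ fun i hi =>
    Measurable.ite (hA i hi) measurable_const measurable_const

open Classical in
/-- Chernoff's bound: both tails are covered, by the sign of `θ`. -/
theorem measureReal_chernoff_le {ι : Type*} {S : Finset ι} {A : ι → Set Ω} {q : ℝ} (hq0 : 0 ≤ q) (hq1 : q ≤ 1)
    (hA : ∀ i ∈ S, MeasurableSet (A i)) (hq : ∀ T ⊆ S, μ.real (⋂ i ∈ T, A i) = q ^ T.card)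
    {θ : ℝ} (hθ : |θ| ≤ 1) (s : ℝ) :
    μ.real {ω | s ≤ θ * (((S.filter fun i => ω ∈ A i).card : ℝ) - q * S.card)}
      ≤ Real.exp (q * S.card * θ ^ 2 - s) := by
  have hint : Integrable (fun ω => Real.exp θ ^ (S.filter fun i => ω ∈ A i).card) μ := by
    refine Integrable.of_bound (C := Real.exp |θ| ^ S.card) (Measurable.aestronglyMeasurable
      ((Measurable.of_discrete (f := fun r : ℕ => Real.exp θ ^ r)).comp
        (measurable_card_filter hA))) (Eventually.of_forall fun ω => ?_)
    rw [Real.norm_of_nonneg (by positivity)]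
    calc Real.exp θ ^ (S.filter fun i => ω ∈ A i).card
        ≤ Real.exp |θ| ^ (S.filter fun i => ω ∈ A i).card := by
          gcongr; exact le_abs_self θ
      _ ≤ Real.exp |θ| ^ S.card :=
          pow_le_pow_right₀ (Real.one_le_exp (abs_nonneg _)) (Finset.card_filter_le _ _)
  have hmarkov := mul_meas_ge_le_integral_of_nonneg
    (Eventually.of_forall fun ω => by positivity) hint (Real.exp (θ * q * S.card + s))
  have h1 := integral_pow_card_filter hA hq (Real.exp θ - 1)
  rw [add_sub_cancel] at h1
  rw [h1] at hmarkov
  have h2 : {ω | s ≤ θ * (((S.filter fun i => ω ∈ A i).card : ℝ) - q * S.card)}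
      ⊆ {ω | Real.exp (θ * q * S.card + s) ≤ Real.exp θ ^ (S.filter fun i => ω ∈ A i).card} := by
    intro ω hω
    simp only [Set.mem_ofPred_eq] at hω ⊢
    rw [← Real.exp_nat_mul, Real.exp_le_exp]
    linarith
  -- `exp θ - 1 ≤ θ + θ ^ 2` for `|θ| ≤ 1`, then `1 + u ≤ exp u`.
  have h3 : (1 + (Real.exp θ - 1) * q) ^ S.card ≤ Real.exp (q * S.card * (θ + θ ^ 2)) := by
    have h4 : 1 + (Real.exp θ - 1) * q ≤ Real.exp (q * (θ + θ ^ 2)) := by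
      have h5 := (abs_le.1 (Real.abs_exp_sub_one_sub_id_le hθ)).2
      have h6 := Real.add_one_le_exp (q * (θ + θ ^ 2))
      nlinarith
    have h7 : 0 ≤ 1 + (Real.exp θ - 1) * q := by nlinarith [Real.exp_pos θ]
    calc (1 + (Real.exp θ - 1) * q) ^ S.card ≤ Real.exp (q * (θ + θ ^ 2)) ^ S.card := by gcongr
      _ = Real.exp (q * S.card * (θ + θ ^ 2)) := by rw [← Real.exp_nat_mul]; ring_nf
  have h4 := measureReal_mono (μ := μ) h2
  have h5 : Real.exp (θ * q * S.card + s) * μ.real {ω | s ≤ θ * (((S.filter fun i => ω ∈ A i).card :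
      ℝ) - q * S.card)} ≤ Real.exp (q * S.card * (θ + θ ^ 2)) :=
    (mul_le_mul_of_nonneg_left h4 (Real.exp_pos _).le).trans (hmarkov.trans h3)
  rw [← le_div_iff₀' (Real.exp_pos _), ← Real.exp_sub] at h5
  refine h5.trans (le_of_eq ?_)
  ring_nf

end Chernoff

/-! ### Pseudo-randomness of the Erdős–Rényi graph -/

section RandomGraph

open scoped unitInterval

theorem binomialRandom_forall_mem_edgeSet {V : Type*} [Countable V] (p : I) (E : Finset (Sym2 V))
    (hE : ∀ e ∈ E, ¬ e.IsDiag) :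
    SimpleGraph.binomialRandom V p {G | ∀ e ∈ E, e ∈ G.edgeSet}
      = (unitInterval.toNNReal p : ℝ≥0∞) ^ E.card := by
  have hm : MeasurableSet {G : SimpleGraph V | ∀ e ∈ E, e ∈ G.edgeSet} := by
    rw [show {G : SimpleGraph V | ∀ e ∈ E, e ∈ G.edgeSet} = ⋂ e ∈ E, {G | e ∈ G.edgeSet} by
      ext; simp]
    exact Finset.measurableSet_biInter E fun e _ => measurableSet_setOfPred.2
      ((measurable_set_mem e).comp SimpleGraph.measurable_edgeSet)
  rw [SimpleGraph.binomialRandom_eq_map, Measure.map_apply SimpleGraph.measurable_fromEdgeSet hm,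
    setBernoulli_apply']
  have h1 : (fun p : Sym2 V → Prop => {i | p i}) ⁻¹' (SimpleGraph.fromEdgeSet ⁻¹'
      {G : SimpleGraph V | ∀ e ∈ E, e ∈ G.edgeSet}) = Set.pi (E : Set (Sym2 V)) fun _ => {True} := by
    ext f
    simp only [Set.mem_preimage, Set.mem_ofPred_eq, SimpleGraph.edgeSet_fromEdgeSet, Set.mem_sdiff,
      Set.mem_pi, Finset.mem_coe, Set.mem_singleton_iff, eq_iff_iff, iff_true, Sym2.mem_diagSet]
    exact forall₂_congr fun e he => and_iff_left (hE e he)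
  rw [h1, Measure.infinitePi_pi _ (fun _ _ => MeasurableSet.of_discrete), ← Finset.prod_const]
  refine Finset.prod_congr rfl fun e he => ?_
  have h2 : e ∈ (Sym2.diagSetᶜ : Set (Sym2 V)) := by simpa using hE e he
  simp only [h2]
  rw [Measure.add_apply, Measure.smul_apply, Measure.smul_apply,
    Measure.dirac_apply' _ MeasurableSet.of_discrete,
    Measure.dirac_apply' _ MeasurableSet.of_discrete]
  simp [ENNReal.smul_def]

variable {Ω : Type*} [MeasurableSpace Ω] {μ : Measure Ω} {n : ℕ} {p : I}
  {G : Ω → SimpleGraph (Fin n)}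

theorem measureReal_forall_mem_edgeSet (hG : HasLaw G (SimpleGraph.binomialRandom (Fin n) p) μ)
    (E : Finset (Sym2 (Fin n))) (hE : ∀ e ∈ E, ¬ e.IsDiag) :
    μ.real {ω | ∀ e ∈ E, e ∈ (G ω).edgeSet} = (p : ℝ) ^ E.card := by
  have hm : MeasurableSet {G : SimpleGraph (Fin n) | ∀ e ∈ E, e ∈ G.edgeSet} := by
    rw [show {G : SimpleGraph (Fin n) | ∀ e ∈ E, e ∈ G.edgeSet} = ⋂ e ∈ E, {G | e ∈ G.edgeSet} by
      ext; simp]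
    exact Finset.measurableSet_biInter E fun e _ => measurableSet_setOfPred.2
      ((measurable_set_mem e).comp SimpleGraph.measurable_edgeSet)
  rw [hG.measureReal_eq hm, measureReal_def, binomialRandom_forall_mem_edgeSet p E hE]
  simp

theorem measurableSet_adj (hG : Measurable G) (x u : Fin n) :
    MeasurableSet {ω | (G ω).Adj x u} :=
  measurableSet_setOfPred.2 (SimpleGraph.measurable_iff_adj.1 hG x u)

theorem measurableSet_isPseudoRandom (hGm : Measurable G) (p η κ : ℝ) :
    MeasurableSet {ω | IsPseudoRandom (G ω) p η κ} :=
  have : MeasurableSingletonClass (SimpleGraph (Fin n)) := ⟨fun H => by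
    have h : ({H} : Set (SimpleGraph (Fin n))) = SimpleGraph.edgeSet ⁻¹' {H.edgeSet} := by
      ext H'; simp
    rw [h]
    exact SimpleGraph.measurable_edgeSet (measurableSet_singleton _)⟩
  hGm (Set.toFinite {H : SimpleGraph (Fin n) | IsPseudoRandom H p η κ}).measurableSet

variable [IsProbabilityMeasure μ]

open Classical in
theorem measureReal_card_sub_le (hGm : Measurable G)
    (hG : HasLaw G (SimpleGraph.binomialRandom (Fin n) p) μ) {θ : ℝ} (hθ0 : 0 ≤ θ) (hθ1 : θ ≤ 1)
    (η : ℝ) (x : Fin n) {q : ℕ} (hq : q ≤ n) :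
    μ.real {ω | ¬ |((Finset.univ.filter fun u : Fin n =>
      (G ω).Adj x u ∧ u.val < q).card : ℝ) - p * q| ≤ η}
      ≤ 2 * Real.exp (p * n * θ ^ 2 - θ * (η - 1)) := by
  -- `x` is not a possible neighbour of itself. Leaving it out changes `p * q` by at most `1`,
  -- whence `η - 1` in the exponent.
  set S := Finset.univ.filter fun u : Fin n => u ≠ x ∧ u.val < q
  have hp0 : (0 : ℝ) ≤ p := p.2.1
  have hp1 : (p : ℝ) ≤ 1 := p.2.2
  have hA : ∀ u ∈ S, MeasurableSet {ω | (G ω).Adj x u} := fun u _ => measurableSet_adj hGm x u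
  have hprob : ∀ T ⊆ S, μ.real (⋂ u ∈ T, {ω | (G ω).Adj x u}) = (p : ℝ) ^ T.card := by
    intro T hT
    have h1 : (⋂ u ∈ T, {ω | (G ω).Adj x u})
        = {ω | ∀ e ∈ T.image fun u => s(x, u), e ∈ (G ω).edgeSet} := by
      ext ω; simp
    rw [h1, measureReal_forall_mem_edgeSet hG, Finset.card_image_of_injective]
    · intro a b hab; simp only [Sym2.eq_iff] at hab; grind
    · intro e he
      obtain ⟨u, hu, rfl⟩ := Finset.mem_image.1 he
      rw [Sym2.mk_isDiag_iff]
      exact fun h => ((Finset.mem_filter.1 (hT hu)).2.1 h.symm)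
  have hcard : ∀ ω, (Finset.univ.filter fun u : Fin n => (G ω).Adj x u ∧ u.val < q)
      = S.filter fun u => ω ∈ {ω | (G ω).Adj x u} := by
    intro ω
    ext u
    simp only [S, Finset.mem_filter, Finset.mem_univ, true_and, Set.mem_ofPred_eq]
    constructor
    · rintro ⟨h1, h2⟩; exact ⟨⟨h1.ne', h2⟩, h1⟩
    · rintro ⟨⟨-, h2⟩, h1⟩; exact ⟨h1, h2⟩
  have hSq : (S.card : ℝ) ≤ q ∧ (q : ℝ) ≤ S.card + 1 := by
    have h1 : (Finset.univ.filter fun u : Fin n => u.val < q).card = q := by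
      rw [Fin.card_filter_val_lt]; omega
    have h2 : S = (Finset.univ.filter fun u : Fin n => u.val < q).erase x := by
      ext u; simp [S]
    have h3 := Finset.pred_card_le_card_erase (s := Finset.univ.filter fun u : Fin n => u.val < q)
      (a := x)
    have h4 := Finset.card_erase_le (s := Finset.univ.filter fun u : Fin n => u.val < q) (a := x)
    rw [← h2, h1] at h3 h4
    constructor
    · exact_mod_cast h4
    · have : q ≤ S.card + 1 := by omega
      exact_mod_cast this
  have hsub : {ω | ¬ |((Finset.univ.filter fun u : Fin n =>
      (G ω).Adj x u ∧ u.val < q).card : ℝ) - p * q| ≤ η} ⊆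
      {ω | θ * (η - 1) ≤ θ * (((S.filter fun u => ω ∈ {ω | (G ω).Adj x u}).card : ℝ) - p * S.card)} ∪
      {ω | θ * (η - 1) ≤ -θ * (((S.filter fun u => ω ∈ {ω | (G ω).Adj x u}).card : ℝ)
        - p * S.card)} := by
    intro ω hω
    simp only [Set.mem_ofPred_eq, hcard, not_le, lt_abs] at hω
    have h1 : (p : ℝ) * S.card ≤ p * q := mul_le_mul_of_nonneg_left hSq.1 hp0
    have h2 : (p : ℝ) * q ≤ p * S.card + 1 := by
      have := mul_le_mul_of_nonneg_left hSq.2 hp0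
      linarith
    rcases hω with hω | hω
    · left
      exact mul_le_mul_of_nonneg_left (by simp only [Set.mem_ofPred_eq]; linarith) hθ0
    · right
      simp only [Set.mem_ofPred_eq, neg_mul, ← mul_neg]
      exact mul_le_mul_of_nonneg_left (by linarith) hθ0
  have hexp : Real.exp (p * S.card * θ ^ 2 - θ * (η - 1))
      ≤ Real.exp (p * n * θ ^ 2 - θ * (η - 1)) := by
    rw [Real.exp_le_exp]
    have : (S.card : ℝ) ≤ n := hSq.1.trans (by exact_mod_cast hq)
    gcongr
  have c1 := measureReal_chernoff_le (μ := μ) hp0 hp1 hA hprob (θ := θ)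
    (by rwa [abs_of_nonneg hθ0]) (θ * (η - 1))
  have c2 := measureReal_chernoff_le (μ := μ) hp0 hp1 hA hprob (θ := -θ)
    (by rwa [abs_neg, abs_of_nonneg hθ0]) (θ * (η - 1))
  rw [neg_sq] at c2
  refine (measureReal_mono hsub).trans ((measureReal_union_le _ _).trans ?_)
  linarith

open Classical in
-- For `u` other than `x` and `y` the pairs `{x, u}` and `{y, u}` are all distinct, so being a
-- common neighbour has probability `p ^ 2`, independently over `u`. Chernoff's bound with `θ = 1`
-- involves `p ^ 2 |S|` twice, once as the mean and once as the quadratic term.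
theorem measureReal_codegree_le (hGm : Measurable G)
    (hG : HasLaw G (SimpleGraph.binomialRandom (Fin n) p) μ) (κ : ℝ) {x y : Fin n} (hxy : x ≠ y) :
    μ.real {ω | ¬ ((Finset.univ.filter fun u : Fin n => (G ω).Adj x u ∧ (G ω).Adj y u).card : ℝ) ≤ κ}
      ≤ Real.exp (2 * n * p ^ 2 - κ) := by
  set S := Finset.univ.filter fun u : Fin n => u ≠ x ∧ u ≠ y
  have hp0 : (0 : ℝ) ≤ p ^ 2 := sq_nonneg _
  have hp1 : (p : ℝ) ^ 2 ≤ 1 := pow_le_one₀ p.2.1 p.2.2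
  have hA : ∀ u ∈ S, MeasurableSet {ω | (G ω).Adj x u ∧ (G ω).Adj y u} := fun u _ =>
    (measurableSet_adj hGm x u).inter (measurableSet_adj hGm y u)
  have hprob : ∀ T ⊆ S, μ.real (⋂ u ∈ T, {ω | (G ω).Adj x u ∧ (G ω).Adj y u})
      = ((p : ℝ) ^ 2) ^ T.card := by
    intro T hT
    have h1 : (⋂ u ∈ T, {ω | (G ω).Adj x u ∧ (G ω).Adj y u})
        = {ω | ∀ e ∈ (T.image fun u => s(x, u)) ∪ T.image fun u => s(y, u),
          e ∈ (G ω).edgeSet} := by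
      ext ω
      simp only [Set.mem_iInter, Set.mem_ofPred_eq, Finset.mem_union, Finset.mem_image, or_imp,
        forall_and, forall_exists_index, and_imp, forall_apply_eq_imp_iff₂,
        SimpleGraph.mem_edgeSet]
    rw [h1, measureReal_forall_mem_edgeSet hG, Finset.card_union_of_disjoint,
      Finset.card_image_of_injective, Finset.card_image_of_injective]
    · ring
    · intro a b hab; simp only [Sym2.eq_iff] at hab; grind
    · intro a b hab; simp only [Sym2.eq_iff] at hab; grind
    · rw [Finset.disjoint_left]
      intro e he he'
      obtain ⟨u, hu, rfl⟩ := Finset.mem_image.1 he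
      obtain ⟨z, hz, hzu⟩ := Finset.mem_image.1 he'
      rw [Sym2.eq_iff] at hzu
      rcases hzu with ⟨h, -⟩ | ⟨-, h⟩
      · exact hxy h.symm
      · exact (Finset.mem_filter.1 (hT hz)).2.1 h
    · intro e he
      rcases Finset.mem_union.1 he with he | he <;> obtain ⟨u, hu, rfl⟩ := Finset.mem_image.1 he <;>
        rw [Sym2.mk_isDiag_iff]
      · exact fun h => ((Finset.mem_filter.1 (hT hu)).2.1 h.symm)
      · exact fun h => ((Finset.mem_filter.1 (hT hu)).2.2 h.symm)
  have hcard : ∀ ω, (Finset.univ.filter fun u : Fin n => (G ω).Adj x u ∧ (G ω).Adj y u)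
      = S.filter fun u => ω ∈ {ω | (G ω).Adj x u ∧ (G ω).Adj y u} := by
    intro ω
    ext u
    simp only [S, Finset.mem_filter, Finset.mem_univ, true_and, Set.mem_ofPred_eq]
    exact ⟨fun h => ⟨⟨h.1.ne', h.2.ne'⟩, h⟩, fun h => h.2⟩
  have hS : (S.card : ℝ) ≤ n := by
    have := Finset.card_le_univ S
    rw [Fintype.card_fin] at this
    exact_mod_cast this
  have hpS : (p : ℝ) ^ 2 * S.card ≤ p ^ 2 * n := mul_le_mul_of_nonneg_left hS hp0
  have c1 := measureReal_chernoff_le (μ := μ) hp0 hp1 hA hprob (θ := 1) (by simp)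
    (κ - p ^ 2 * S.card)
  refine (measureReal_mono fun ω hω => ?_).trans (c1.trans ?_)
  · simp only [Set.mem_ofPred_eq, hcard, not_le] at hω ⊢
    linarith
  · rw [Real.exp_le_exp]
    linarith

theorem measureReal_not_isPseudoRandom_le (hGm : Measurable G)
    (hG : HasLaw G (SimpleGraph.binomialRandom (Fin n) p) μ) {θ : ℝ} (hθ0 : 0 ≤ θ) (hθ1 : θ ≤ 1)
    (η κ : ℝ) :
    μ.real {ω | ¬ IsPseudoRandom (G ω) p η κ}
      ≤ n * (n + 1) * (2 * Real.exp (p * n * θ ^ 2 - θ * (η - 1)))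
        + n * n * Real.exp (2 * n * p ^ 2 - κ) := by
  classical
  have hsub : {ω | ¬ IsPseudoRandom (G ω) p η κ} ⊆
      (⋃ z ∈ (Finset.univ : Finset (Fin n)) ×ˢ Finset.range (n + 1),
        {ω | ¬ |((Finset.univ.filter fun u : Fin n =>
          (G ω).Adj z.1 u ∧ u.val < z.2).card : ℝ) - p * z.2| ≤ η}) ∪
      ⋃ z ∈ (Finset.univ : Finset (Fin n × Fin n)).filter fun z => z.1 ≠ z.2,
        {ω | ¬ ((Finset.univ.filter fun u : Fin n =>
          (G ω).Adj z.1 u ∧ (G ω).Adj z.2 u).card : ℝ) ≤ κ} := by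
    intro ω hω
    by_contra hcon
    simp only [Set.mem_union, Set.mem_iUnion, exists_prop, Set.mem_ofPred_eq, not_or, not_exists,
      not_and, not_not, Finset.mem_product, Finset.mem_univ, true_and, Finset.mem_range,
      Finset.mem_filter, Prod.forall] at hcon
    exact hω ⟨fun x q hq => hcon.1 x q (by omega), fun x y hxy => hcon.2 x y hxy⟩
  refine (measureReal_mono hsub).trans ((measureReal_union_le _ _).trans (add_le_add ?_ ?_))
  · refine (measureReal_biUnion_finset_le _ _).trans ((Finset.sum_le_card_nsmul _ _ _ fun z hz =>
      measureReal_card_sub_le hGm hG hθ0 hθ1 η z.1 (q := z.2) ?_).trans (le_of_eq ?_))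
    · have := Finset.mem_range.1 (Finset.mem_product.1 hz).2
      omega
    · rw [Finset.card_product, Finset.card_univ, Fintype.card_fin, Finset.card_range, nsmul_eq_mul]
      push_cast
      ring
  · refine (measureReal_biUnion_finset_le _ _).trans ((Finset.sum_le_card_nsmul _ _ _ fun z hz =>
      measureReal_codegree_le hGm hG κ (Finset.mem_filter.1 hz).2).trans ?_)
    rw [nsmul_eq_mul]
    gcongr
    have h1 := Finset.card_filter_le (Finset.univ : Finset (Fin n × Fin n)) fun z => z.1 ≠ z.2
    rw [Finset.card_univ, Fintype.card_prod, Fintype.card_fin] at h1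
    exact_mod_cast h1

end RandomGraph

/-! ### Expectations of products over the records -/

section RecordProduct

/-- After the terms `w 0, …, w m`: the product of `h x i` over the records of value `x` that stood
for `i` terms before being beaten, the value of the current record, and its age. -/
def recordState (h : ℝ → ℕ → ℂ) (w : ℕ → ℝ) : ℕ → ℂ × ℝ × ℕ
  | 0 => (1, w 0, 0)
  | m + 1 => if w (m + 1) < (recordState h w m).2.1
      then ((recordState h w m).1 * h (recordState h w m).2.1 ((recordState h w m).2.2 + 1),
        w (m + 1), 0)
      else ((recordState h w m).1, (recordState h w m).2.1, (recordState h w m).2.2 + 1)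

/-- The transition of `recordState`. -/
def recordStep (h : ℝ → ℕ → ℂ) (z : (ℂ × ℝ × ℕ) × ℝ) : ℂ × ℝ × ℕ :=
  if z.2 < z.1.2.1 then (z.1.1 * h z.1.2.1 (z.1.2.2 + 1), z.2, 0)
  else (z.1.1, z.1.2.1, z.1.2.2 + 1)

theorem measurable_uncurry_nat {E : Type*} [MeasurableSpace E] {h : ℝ → ℕ → E}
    (hh : ∀ a, Measurable fun x => h x a) : Measurable fun z : ℝ × ℕ => h z.1 z.2 :=
  measurable_from_prod_countable_left hh

theorem measurable_recordStep {h : ℝ → ℕ → ℂ} (hh : ∀ a, Measurable fun x => h x a) :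
    Measurable (recordStep h) := by
  refine Measurable.ite (measurableSet_lt (by fun_prop) (by fun_prop)) ?_ (by fun_prop)
  refine Measurable.prodMk (Measurable.mul (by fun_prop) ?_) (by fun_prop)
  exact (measurable_uncurry_nat hh).comp (g := fun z : ℝ × ℕ => h z.1 z.2)
    (f := fun z : (ℂ × ℝ × ℕ) × ℝ => (z.1.2.1, z.1.2.2 + 1)) (by fun_prop)

theorem norm_recordState_le {h : ℝ → ℕ → ℂ} (hh : ∀ x a, ‖h x a‖ ≤ 1) (w : ℕ → ℝ) (m : ℕ) :
    ‖(recordState h w m).1‖ ≤ 1 := by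
  induction m with
  | zero => simp [recordState]
  | succ m ih =>
    rw [recordState]
    split_ifs
    · simp only [norm_mul]
      exact mul_le_one₀ ih (norm_nonneg _) (hh _ _)
    · exact ih

theorem recordState_value (h : ℝ → ℕ → ℂ) (w : ℕ → ℝ) (m : ℕ) :
    (recordState h w m).2.1 = runningMin w m := by
  induction m with
  | zero => rfl
  | succ m ih =>
    rw [recordState, runningMin, ← ih]
    split_ifs with hlt
    · exact (min_eq_right hlt.le).symm
    · exact (min_eq_left (not_lt.1 hlt)).symm

/-- The analytic data of the distribution of a product over the records. -/
structure RecordGenerator (h R : ℝ → ℕ → ℂ) (ψ : ℝ → ℂ) (δ b : ℝ) (Z : Set ℝ) : Prop where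
  measurable_h : ∀ a, Measurable fun x => h x a
  norm_h_le : ∀ x a, ‖h x a‖ ≤ 1
  measurable_R : ∀ a, Measurable fun x => R x a
  norm_R_le : ∀ x ∈ Set.Ioo (0 : ℝ) 1, ∀ a, ‖x * R x a‖ ≤ b
  R_eq : ∀ x ∈ Set.Ioo (0 : ℝ) 1, ∀ a, R x a = h x (a + 1) + (1 - x) * R x (a + 1)
  R_zero : ∀ x ∈ Set.Ioo (0 : ℝ) 1, x * R x 0 = 1 + x * ψ x
  pos : 0 < δ
  R_small : ∀ x ∈ Set.Ioo (0 : ℝ) 1, x < δ → ∀ a, x * R x a = 1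
  measurable_ψ : Measurable ψ
  norm_ψ_le : ∀ x ∈ Set.Ioo (0 : ℝ) 1, ‖ψ x‖ ≤ b
  countable : Z.Countable
  continuousAt : ∀ x ∈ Set.Ioo (0 : ℝ) 1 \ Z, ContinuousAt ψ x

namespace RecordGenerator

variable {h R : ℝ → ℕ → ℂ} {ψ : ℝ → ℂ} {δ b : ℝ} {Z : Set ℝ}

/-- The primitive of `ψ`. -/
def primitive (ψ : ℝ → ℂ) (x : ℝ) : ℂ := ∫ y in (0 : ℝ)..x, (Set.Ioo (0 : ℝ) 1).indicator ψ y

/-- The expected contribution of the records to come, from a record of value `x` and age `a` on. -/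
def value (R : ℝ → ℕ → ℂ) (ψ : ℝ → ℂ) (x : ℝ) (a : ℕ) : ℂ :=
  x * R x a * Complex.exp (primitive ψ x)

variable (hgen : RecordGenerator h R ψ δ b Z)

include hgen

theorem b_nonneg : 0 ≤ b :=
  (norm_nonneg _).trans (hgen.norm_ψ_le (1 / 2) (by norm_num))

theorem norm_indicator_le (x : ℝ) : ‖(Set.Ioo (0 : ℝ) 1).indicator ψ x‖ ≤ b := by
  by_cases hx : x ∈ Set.Ioo (0 : ℝ) 1
  · rw [Set.indicator_of_mem hx]; exact hgen.norm_ψ_le x hx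
  · rw [Set.indicator_of_notMem hx, norm_zero]; exact hgen.b_nonneg

theorem measurable_indicator : Measurable ((Set.Ioo (0 : ℝ) 1).indicator ψ) :=
  hgen.measurable_ψ.indicator measurableSet_Ioo

theorem intervalIntegrable (c d : ℝ) :
    IntervalIntegrable ((Set.Ioo (0 : ℝ) 1).indicator ψ) volume c d := by
  rw [intervalIntegrable_iff]
  exact Measure.integrableOn_of_bounded (M := b) (by simp)
    hgen.measurable_indicator.aestronglyMeasurable (Eventually.of_forall hgen.norm_indicator_le)

theorem continuous_primitive : Continuous (primitive ψ) :=
  intervalIntegral.continuous_primitive hgen.intervalIntegrable 0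

theorem norm_primitive_le {x : ℝ} (hx : x ∈ Set.Icc (0 : ℝ) 1) : ‖primitive ψ x‖ ≤ b := by
  refine (intervalIntegral.norm_integral_le_of_norm_le_const
    fun y _ => hgen.norm_indicator_le y).trans ?_
  rw [sub_zero, abs_of_nonneg hx.1]
  exact mul_le_of_le_one_right hgen.b_nonneg hx.2

theorem measurable_value (a : ℕ) : Measurable fun x => value R ψ x a :=
  ((Complex.measurable_ofReal).mul (hgen.measurable_R a)).mul
    (Complex.measurable_exp.comp hgen.continuous_primitive.measurable)

theorem norm_value_le {x : ℝ} (hx : x ∈ Set.Ioo (0 : ℝ) 1) (a : ℕ) :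
    ‖value R ψ x a‖ ≤ b * Real.exp b := by
  unfold value
  rw [norm_mul]
  refine mul_le_mul (hgen.norm_R_le x hx a) ?_ (norm_nonneg _) hgen.b_nonneg
  exact (Complex.norm_exp_le_exp_norm _).trans
    (Real.exp_le_exp.2 (hgen.norm_primitive_le (Set.Ioo_subset_Icc_self hx)))

theorem integrableOn_value (a : ℕ) : IntegrableOn (fun x => value R ψ x a) (Set.Icc 0 1) := by
  rw [integrableOn_Icc_iff_integrableOn_Ioo]
  refine Measure.integrableOn_of_bounded (M := b * Real.exp b) (by simp)
    (hgen.measurable_value a).aestronglyMeasurable ?_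
  filter_upwards [ae_restrict_mem measurableSet_Ioo] with x hx using hgen.norm_value_le hx a

/-- This identity explains the form of `value`. Here `x * R x a` plays the role of the mean factor
of the current record, which is beaten at each term with probability `x`. The next record is uniform
on `[0, x]`, so if the later ones contribute `exp Ψ(x)`, then `x exp Ψ(x)` must be the integral of
`value y 0` over `[0, x]`. Differentiation and `R_zero` turn this into `Ψ' = ψ`. -/
theorem hasDerivAt {x : ℝ} (hx : x ∈ Set.Ioo (0 : ℝ) 1 \ Z) :
    HasDerivAt (fun x : ℝ => (x : ℂ) * Complex.exp (primitive ψ x)) (value R ψ x 0) x := by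
  have h1 : HasDerivAt (primitive ψ) (ψ x) x := by
    have hc : ContinuousAt ((Set.Ioo (0 : ℝ) 1).indicator ψ) x :=
      (hgen.continuousAt x hx).congr (by
        filter_upwards [isOpen_Ioo.mem_nhds hx.1] with y hy
        rw [Set.indicator_of_mem hy])
    have := intervalIntegral.integral_hasDerivAt_right (hgen.intervalIntegrable 0 x)
      (hgen.measurable_indicator.stronglyMeasurable.stronglyMeasurableAtFilter) hc
    rwa [Set.indicator_of_mem hx.1] at this
  have h2 := (Complex.ofRealCLM.hasDerivAt (x := x)).mul h1.cexp
  simp only [Complex.ofRealCLM_apply, Complex.ofReal_one] at h2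
  refine h2.congr_deriv ?_
  unfold value
  rw [hgen.R_zero x hx.1]
  ring

/-- In the application `ψ` may jump at finitely many points; the fundamental theorem is used off a
countable set for that reason. -/
theorem integral_value {x : ℝ} (hx : x ∈ Set.Icc (0 : ℝ) 1) :
    ∫ y in (0 : ℝ)..x, value R ψ y 0 = x * Complex.exp (primitive ψ x) := by
  have := integral_eq_of_hasDerivAt_off_countable_of_le
    (fun x : ℝ => (x : ℂ) * Complex.exp (primitive ψ x)) (fun y => value R ψ y 0) hx.1
    hgen.countable
    ((Complex.continuous_ofReal.mul (Complex.continuous_exp.comp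
      hgen.continuous_primitive)).continuousOn)
    (fun y hy => hgen.hasDerivAt ⟨⟨hy.1.1, hy.1.2.trans_le hx.2⟩, hy.2⟩)
    ((intervalIntegrable_iff_integrableOn_Icc_of_le hx.1).2
      ((hgen.integrableOn_value 0).mono_set (Set.Icc_subset_Icc_right hx.2)))
  rw [this]
  simp

/-- The one-step equation of the value function. -/
theorem integral_step {x : ℝ} (hx : x ∈ Set.Ioo (0 : ℝ) 1) (a : ℕ) :
    ∫ y in Set.Icc (0 : ℝ) 1, (if y < x then h x (a + 1) * value R ψ y 0 else value R ψ x (a + 1))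
      = value R ψ x a := by
  have e1 : ∫ y in (0 : ℝ)..x,
      (if y < x then h x (a + 1) * value R ψ y 0 else value R ψ x (a + 1))
      = h x (a + 1) * (x * Complex.exp (primitive ψ x)) := by
    rw [← hgen.integral_value (Set.Ioo_subset_Icc_self hx),
      ← intervalIntegral.integral_const_mul]
    refine intervalIntegral.integral_congr_Ioo_of_le hx.1.le fun y hy => ?_
    simp [hy.2]
  have e2 : ∫ y in x..1,
      (if y < x then h x (a + 1) * value R ψ y 0 else value R ψ x (a + 1))
      = (1 - x) * value R ψ x (a + 1) := by
    rw [intervalIntegral.integral_congr (g := fun _ => value R ψ x (a + 1)),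
      intervalIntegral.integral_const]
    · simp
    · intro y hy
      rw [Set.uIcc_of_le hx.2.le] at hy
      simp [not_lt.2 hy.1]
  have hint : IntegrableOn (fun y => if y < x then h x (a + 1) * value R ψ y 0
      else value R ψ x (a + 1)) (Set.Icc 0 1) := by
    rw [integrableOn_Icc_iff_integrableOn_Ioo]
    refine Measure.integrableOn_of_bounded (M := b * Real.exp b) (by simp)
      (Measurable.ite measurableSet_Iio (measurable_const.mul (hgen.measurable_value 0))
        measurable_const).aestronglyMeasurable ?_
    filter_upwards [ae_restrict_mem measurableSet_Ioo] with y hy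
    split_ifs
    · rw [norm_mul, ← one_mul (b * Real.exp b)]
      exact mul_le_mul (hgen.norm_h_le _ _) (hgen.norm_value_le hy 0) (norm_nonneg _) zero_le_one
    · exact hgen.norm_value_le hx _
  have hii : ∀ c d, c ∈ Set.Icc (0 : ℝ) 1 → d ∈ Set.Icc (0 : ℝ) 1 → c ≤ d →
      IntervalIntegrable (fun y => if y < x then h x (a + 1) * value R ψ y 0
        else value R ψ x (a + 1)) volume c d := fun c d hc hd hcd =>
    (intervalIntegrable_iff_integrableOn_Icc_of_le hcd).2
      (hint.mono_set (Set.Icc_subset_Icc hc.1 hd.2))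
  rw [integral_Icc_eq_integral_Ioc, ← intervalIntegral.integral_of_le zero_le_one,
    ← intervalIntegral.integral_add_adjacent_intervals
      (hii 0 x (by simp) (Set.Ioo_subset_Icc_self hx) hx.1.le)
      (hii x 1 (Set.Ioo_subset_Icc_self hx) (by simp) hx.2.le), e1, e2]
  unfold value
  rw [hgen.R_eq x hx a]
  ring

/-- Below `δ` the records contribute nothing, so `ψ` vanishes on `(0, x]`. This lets the martingale
end in the product itself. -/
theorem value_small {x : ℝ} (hx : x ∈ Set.Ioo (0 : ℝ) 1) (hxδ : x < δ) (a : ℕ) :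
    value R ψ x a = 1 := by
  have h1 : primitive ψ x = 0 := by
    refine intervalIntegral.integral_zero_ae (Eventually.of_forall fun y hy => ?_)
    rw [Set.uIoc_of_le hx.1.le] at hy
    have hy' : y ∈ Set.Ioo (0 : ℝ) 1 := ⟨hy.1, hy.2.trans_lt hx.2⟩
    rw [Set.indicator_of_mem hy']
    have h2 := hgen.R_zero y hy'
    rw [hgen.R_small y hy' (hy.2.trans_lt hxδ)] at h2
    have h3 : (y : ℂ) * ψ y = 0 := by linear_combination -h2
    exact (mul_eq_zero.1 h3).resolve_left (by exact_mod_cast hy.1.ne')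
  rw [value, h1, hgen.R_small x hx hxδ]
  simp

end RecordGenerator
end RecordProduct

section RecordProduct

variable {Ω : Type*} [MeasurableSpace Ω] {μ : Measure Ω} [IsProbabilityMeasure μ] {W : ℕ → Ω → ℝ}
  {h R : ℝ → ℕ → ℂ} {ψ : ℝ → ℂ} {δ b : ℝ} {Z : Set ℝ}

theorem IsUniformSequence.ae_runningMin_mem_Ioo {Ω : Type*} [MeasurableSpace Ω] {μ : Measure Ω}
    {W : ℕ → Ω → ℝ} (hW : IsUniformSequence W μ) :
    ∀ᵐ ω ∂μ, ∀ m, runningMin (fun k => W k ω) m ∈ Set.Ioo (0 : ℝ) 1 := by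
  filter_upwards [hW.ae_mem_Ioo] with ω hω m
  induction m with
  | zero => exact hω 0
  | succ m ih => exact ⟨lt_min ih.1 (hω _).1, (min_le_left _ _).trans_lt ih.2⟩

theorem runningMin_le (w : ℕ → ℝ) {k m : ℕ} (hk : k ≤ m) : runningMin w m ≤ w k :=
  not_lt.1 fun hlt => lt_irrefl _ (lt_runningMin_iff.1 hlt k hk)

/-- The product over the records already beaten, times the expected contribution of the rest, is a
martingale: `integral_step` is its one-step equation, and its initial mean is `∫₀¹ value y 0 dy`. -/
theorem IsUniformSequence.integral_record_martingale (hW : IsUniformSequence W μ)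
    (hgen : RecordGenerator h R ψ δ b Z) (m : ℕ) :
    Measurable (fun ω => (recordState h (fun k => W k ω) m).1 *
      RecordGenerator.value R ψ (recordState h (fun k => W k ω) m).2.1
        (recordState h (fun k => W k ω) m).2.2) ∧
    ∫ ω, (recordState h (fun k => W k ω) m).1 *
      RecordGenerator.value R ψ (recordState h (fun k => W k ω) m).2.1
        (recordState h (fun k => W k ω) m).2.2 ∂μ
      = Complex.exp (∫ x in (0 : ℝ)..1, ψ x) := by
  have hrec := hW.indepFun_of_recursion (α := ℂ × ℝ × ℕ)
    (X := fun m ω => recordState h (fun k => W k ω) m) (f := fun y => (1, y, 0))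
    (step := recordStep h) (by fun_prop) (measurable_recordStep hgen.measurable_h)
    (fun ω => rfl) (fun m ω => rfl)
  let Φ : ℂ × ℝ × ℕ → ℂ := fun s => s.1 * RecordGenerator.value R ψ s.2.1 s.2.2
  have hΦ : Measurable Φ := measurable_fst.mul
    ((measurable_uncurry_nat hgen.measurable_value).comp measurable_snd)
  refine ⟨hΦ.comp (hrec m).1, ?_⟩
  induction m with
  | zero =>
    have h1 : ∀ ω, (recordState h (fun k => W k ω) 0).1 *
        RecordGenerator.value R ψ (recordState h (fun k => W k ω) 0).2.1
        (recordState h (fun k => W k ω) 0).2.2 = RecordGenerator.value R ψ (W 0 ω) 0 :=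
      fun ω => one_mul _
    simp only [h1]
    have h2 := (hW.hasLaw 0).integral_comp (f := fun x => RecordGenerator.value R ψ x 0)
      (hgen.measurable_value 0).aestronglyMeasurable
    simp only [Function.comp_def] at h2
    rw [h2, integral_Icc_eq_integral_Ioc,
      ← intervalIntegral.integral_of_le zero_le_one, hgen.integral_value (by simp)]
    simp only [Complex.ofReal_one, one_mul]
    congr 1
    refine intervalIntegral.integral_congr_Ioo_of_le zero_le_one fun y hy => ?_
    rw [Set.indicator_of_mem hy]
  | succ m ih =>
    rw [← ih]
    obtain ⟨hXm, hXi⟩ := hrec m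
    set X : Ω → ℂ × ℝ × ℕ := fun ω => recordState h (fun k => W k ω) m
    have hstep : ∀ ω, recordState h (fun k => W k ω) (m + 1) = recordStep h (X ω, W (m + 1) ω) :=
      fun ω => rfl
    have hF : Measurable fun z => Φ (recordStep h z) :=
      hΦ.comp (measurable_recordStep hgen.measurable_h)
    have hbound : ∀ᵐ ω ∂μ, ‖Φ (recordState h (fun k => W k ω) (m + 1))‖ ≤ b * Real.exp b := by
      filter_upwards [hW.ae_runningMin_mem_Ioo] with ω hω
      simp only [Φ]
      rw [norm_mul, ← one_mul (b * Real.exp b)]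
      refine mul_le_mul (norm_recordState_le hgen.norm_h_le _ _) (hgen.norm_value_le ?_ _)
        (norm_nonneg _) zero_le_one
      rw [recordState_value]
      exact hω _
    have hmap : μ.map (fun ω => (X ω, W (m + 1) ω))
        = (μ.map X).prod (volume.restrict (Set.Icc (0 : ℝ) 1)) := by
      rw [hXi.map_prod_eq_prod_map_map hXm.aemeasurable (hW.measurable _).aemeasurable,
        (hW.hasLaw _).map_eq]
    have hint : Integrable (fun z => Φ (recordStep h z))
        ((μ.map X).prod (volume.restrict (Set.Icc (0 : ℝ) 1))) := by
      rw [← hmap, integrable_map_measure hF.aestronglyMeasurable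
        (hXm.prodMk (hW.measurable _)).aemeasurable]
      exact Integrable.of_bound (hF.comp (hXm.prodMk (hW.measurable _))).aestronglyMeasurable _
        hbound
    have h1 : ∫ ω, Φ (recordState h (fun k => W k ω) (m + 1)) ∂μ
        = ∫ s, (∫ y in Set.Icc (0 : ℝ) 1, Φ (recordStep h (s, y))) ∂(μ.map X) := by
      have : IsProbabilityMeasure (μ.map X) := Measure.isProbabilityMeasure_map hXm.aemeasurable
      simp only [hstep]
      rw [← integral_map (φ := fun ω => (X ω, W (m + 1) ω)) (f := fun z => Φ (recordStep h z))
        (hXm.prodMk (hW.measurable _)).aemeasurable hF.aestronglyMeasurable, hmap,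
        integral_prod _ hint]
    refine h1.trans ?_
    rw [integral_map hXm.aemeasurable hint.integral_prod_left.aestronglyMeasurable]
    refine integral_congr_ae ?_
    filter_upwards [hW.ae_runningMin_mem_Ioo] with ω hω
    have hx : (X ω).2.1 ∈ Set.Ioo (0 : ℝ) 1 := by
      rw [show (X ω).2.1 = runningMin (fun k => W k ω) m from recordState_value h _ m]
      exact hω m
    have h2 : ∀ y, Φ (recordStep h (X ω, y)) = (X ω).1 * (if y < (X ω).2.1 then
        h (X ω).2.1 ((X ω).2.2 + 1) * RecordGenerator.value R ψ y 0
        else RecordGenerator.value R ψ (X ω).2.1 ((X ω).2.2 + 1)) := by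
      intro y
      simp only [Φ, recordStep]
      split_ifs
      · ring
      · rfl
    simp only [h2]
    rw [integral_const_mul, hgen.integral_step hx]

/-- The expectation of a product over the records of a sequence of independent uniform variables. -/
theorem IsUniformSequence.integral_record_product (hW : IsUniformSequence W μ)
    (hgen : RecordGenerator h R ψ δ b Z) {Q : Ω → ℂ}
    (hQ : ∀ᵐ ω ∂μ, ∀ᶠ m in atTop, (recordState h (fun k => W k ω) m).1 = Q ω) :
    ∫ ω, Q ω ∂μ = Complex.exp (∫ x in (0 : ℝ)..1, ψ x) := by
  have hlim := tendsto_integral_of_dominated_convergence (μ := μ)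
    (F := fun m ω => (recordState h (fun k => W k ω) m).1 *
      RecordGenerator.value R ψ (recordState h (fun k => W k ω) m).2.1
        (recordState h (fun k => W k ω) m).2.2) (f := Q) (fun _ => b * Real.exp b)
    (fun m => (hW.integral_record_martingale hgen m).1.aestronglyMeasurable)
    (integrable_const _) ?_ ?_
  · simp only [fun m => (hW.integral_record_martingale hgen m).2] at hlim
    exact tendsto_nhds_unique hlim tendsto_const_nhds
  · intro m
    filter_upwards [hW.ae_runningMin_mem_Ioo] with ω hω
    rw [norm_mul, ← one_mul (b * Real.exp b)]
    refine mul_le_mul (norm_recordState_le hgen.norm_h_le _ _) (hgen.norm_value_le ?_ _)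
      (norm_nonneg _) zero_le_one
    rw [recordState_value]
    exact hω _
  -- Almost surely the minimum eventually falls below `δ`, and from then on the value function
  -- equals `1`.
  · filter_upwards [hW.ae_runningMin_mem_Ioo, hQ, hW.ae_exists_lt] with ω h1 h2 h3
    obtain ⟨k, hk⟩ := h3 δ hgen.pos
    refine tendsto_const_nhds.congr' ?_
    filter_upwards [h2, eventually_ge_atTop k] with m hm hkm
    rw [hm, recordState_value, hgen.value_small (h1 m) ((runningMin_le _ hkm).trans_lt hk), mul_one]

end RecordProduct

/-! ### The factors of the characteristic function -/

section RecordFactor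

variable {K : ℕ} {f : ℕ → ℝ → ℝ} {T : ℝ} {C : Set ℝ}

/-- The factor, in a characteristic function, of a record of value `x` and of class `i`. -/
def classFactor (f : ℕ → ℝ → ℝ) (i : ℕ) (x : ℝ) : ℂ :=
  Complex.exp (Complex.I * (f i (- Real.log x) : ℝ))

/-- The factor of a record of value `x` that stands for `i` terms. -/
def recordFactor (K : ℕ) (f : ℕ → ℝ → ℝ) (x : ℝ) (i : ℕ) : ℂ :=
  if i = K then 1 else classFactor f (min i K) x

/-- The sum `∑ i, (1 - x) ^ i * recordFactor K f x (a + 1 + i)`. -/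
def recordResolvent (K : ℕ) (f : ℕ → ℝ → ℝ) (x : ℝ) (a : ℕ) : ℂ :=
  1 / x + ∑ i ∈ Finset.Ico (a + 1) K, (1 - x : ℂ) ^ (i - (a + 1)) * (classFactor f i x - 1)
    + (1 - x : ℂ) ^ (K - a) * (classFactor f K x - 1) / x

/-- The exponent of the characteristic function, before the change of variables `x = exp (-t)`. -/
def recordExponent (K : ℕ) (f : ℕ → ℝ → ℝ) (x : ℝ) : ℂ :=
  ∑ i ∈ Finset.Ico 1 K, (1 - x : ℂ) ^ (i - 1) * (classFactor f i x - 1)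
    + (1 - x : ℂ) ^ K * (classFactor f K x - 1) / x

theorem norm_classFactor (f : ℕ → ℝ → ℝ) (i : ℕ) (x : ℝ) : ‖classFactor f i x‖ = 1 := by
  rw [classFactor, mul_comm, Complex.norm_exp_ofReal_mul_I]

theorem norm_classFactor_sub_one_le (f : ℕ → ℝ → ℝ) (i : ℕ) (x : ℝ) :
    ‖classFactor f i x - 1‖ ≤ 2 := by
  refine (norm_sub_le _ _).trans ?_
  rw [norm_classFactor, norm_one]
  norm_num

theorem measurable_classFactor (hf : ∀ i, Measurable (f i)) (i : ℕ) :
    Measurable (classFactor f i) := by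
  have := hf i
  unfold classFactor
  fun_prop

theorem classFactor_eq_one (hT : ∀ i t, T < t → f i t = 0) {x : ℝ} (hx : 0 < x)
    (hxT : x < Real.exp (-T)) (i : ℕ) : classFactor f i x = 1 := by
  have : T < - Real.log x := by
    rw [lt_neg, Real.log_lt_iff_lt_exp hx]
    exact hxT
  rw [classFactor, hT i _ this]
  simp

theorem continuousAt_classFactor (hC : ∀ i, ∀ t ∉ C, ContinuousAt (f i) t) {x : ℝ} (hx : 0 < x)
    (hxC : x ∉ (fun t => Real.exp (-t)) '' C) (i : ℕ) : ContinuousAt (classFactor f i) x := by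
  have h1 : - Real.log x ∉ C := fun h => hxC ⟨_, h, by simp [Real.exp_log hx]⟩
  have h2 : ContinuousAt (fun x => f i (- Real.log x)) x :=
    ContinuousAt.comp (f := fun x => - Real.log x) (hC i _ h1)
      (Real.continuousAt_log hx.ne').neg
  unfold classFactor
  fun_prop

theorem norm_one_sub_pow_le {x : ℝ} (hx : x ∈ Set.Ioo (0 : ℝ) 1) (k : ℕ) :
    ‖(1 - x : ℂ) ^ k‖ ≤ 1 := by
  rw [norm_pow]
  refine pow_le_one₀ (norm_nonneg _) ?_
  rw [show (1 - x : ℂ) = ((1 - x : ℝ) : ℂ) by push_cast; ring, Complex.norm_real, Real.norm_eq_abs,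
    abs_of_nonneg (by linarith [hx.2])]
  linarith [hx.1]

theorem norm_sum_classFactor_le {x : ℝ} (hx : x ∈ Set.Ioo (0 : ℝ) 1) (a : ℕ) (g : ℕ → ℕ) :
    ‖∑ i ∈ Finset.Ico (a + 1) K, (1 - x : ℂ) ^ g i * (classFactor f i x - 1)‖ ≤ 2 * K := by
  refine (norm_sum_le_of_le (n := fun _ => 2) _ fun i _ => ?_).trans ?_
  · rw [norm_mul, ← one_mul (2 : ℝ)]
    exact mul_le_mul (norm_one_sub_pow_le hx _) (norm_classFactor_sub_one_le f i x)
      (norm_nonneg _) zero_le_one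
  · rw [Finset.sum_const, Nat.card_Ico, nsmul_eq_mul, mul_comm]
    gcongr
    exact Nat.sub_le _ _

theorem norm_pow_mul_classFactor_le {x : ℝ} (hx : x ∈ Set.Ioo (0 : ℝ) 1) (k i : ℕ) :
    ‖(1 - x : ℂ) ^ k * (classFactor f i x - 1)‖ ≤ 2 := by
  rw [norm_mul, ← one_mul (2 : ℝ)]
  exact mul_le_mul (norm_one_sub_pow_le hx _) (norm_classFactor_sub_one_le f i x)
    (norm_nonneg _) zero_le_one

theorem mul_recordResolvent {x : ℝ} (hx : 0 < x) (a : ℕ) :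
    x * recordResolvent K f x a = 1
      + x * ∑ i ∈ Finset.Ico (a + 1) K, (1 - x : ℂ) ^ (i - (a + 1)) * (classFactor f i x - 1)
      + (1 - x : ℂ) ^ (K - a) * (classFactor f K x - 1) := by
  have : (x : ℂ) ≠ 0 := by exact_mod_cast hx.ne'
  rw [recordResolvent, mul_add, mul_add, mul_one_div_cancel this, mul_div_cancel₀ _ this]

/-- The three cases are a next duration `a + 1` below `K`, equal to `K` (no class, factor `1`) and
above `K`. The truncation in `K - a` is intended: from age `K` on, the record is certain to belong
to class `K`. -/
theorem recordResolvent_eq {x : ℝ} (hx : 0 < x) (a : ℕ) :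
    recordResolvent K f x a
      = recordFactor K f x (a + 1) + (1 - x) * recordResolvent K f x (a + 1) := by
  have hx0 : (x : ℂ) ≠ 0 := by exact_mod_cast hx.ne'
  unfold recordResolvent recordFactor
  rcases lt_trichotomy (a + 1) K with h | h | h
  · rw [if_neg h.ne, min_eq_left h.le, Finset.sum_eq_sum_Ico_succ_bot h, Nat.sub_self, pow_zero,
      show K - a = K - (a + 1) + 1 by omega, mul_add, mul_add, Finset.mul_sum]
    have e : ∑ i ∈ Finset.Ico (a + 1 + 1) K,
        (1 - x : ℂ) ^ (i - (a + 1)) * (classFactor f i x - 1)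
        = ∑ i ∈ Finset.Ico (a + 1 + 1) K,
          (1 - x : ℂ) * ((1 - x : ℂ) ^ (i - (a + 1 + 1)) * (classFactor f i x - 1)) := by
      refine Finset.sum_congr rfl fun i hi => ?_
      rw [Finset.mem_Ico] at hi
      rw [show i - (a + 1) = i - (a + 1 + 1) + 1 by omega]
      ring
    rw [e]
    field_simp
    ring
  · rw [if_pos h, Finset.Ico_eq_empty_of_le h.ge, Finset.Ico_eq_empty_of_le (by omega),
      show K - a = 1 by omega, show K - (a + 1) = 0 by omega, Finset.sum_empty]
    field_simp
    ring
  · rw [if_neg h.ne', Finset.Ico_eq_empty_of_le h.le, Finset.Ico_eq_empty_of_le (by omega),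
      show K - a = 0 by omega, show K - (a + 1) = 0 by omega, Finset.sum_empty,
      min_eq_right h.le]
    field_simp
    ring

/-- As all `f i` vanish after `T`, all factors are `1` for values below `exp (-T)`. This provides
the threshold and also bounds the quotient by `x` in the exponent. -/
theorem recordGenerator (hf : ∀ i, Measurable (f i)) (hT : ∀ i t, T < t → f i t = 0)
    (hC : C.Countable) (hCf : ∀ i, ∀ t ∉ C, ContinuousAt (f i) t) :
    RecordGenerator (recordFactor K f) (recordResolvent K f) (recordExponent K f) (Real.exp (-T))
      (3 + 2 * K + 2 / Real.exp (-T)) ((fun t => Real.exp (-t)) '' C) where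
  measurable_h a := by
    unfold recordFactor
    split_ifs
    · exact measurable_const
    · exact measurable_classFactor hf _
  norm_h_le x a := by
    unfold recordFactor
    split_ifs
    · simp
    · rw [norm_classFactor]
  measurable_R a := by
    have := measurable_classFactor hf
    unfold recordResolvent
    fun_prop
  norm_R_le x hx a := by
    rw [mul_recordResolvent hx.1]
    have h1 : ‖(x : ℂ) * ∑ i ∈ Finset.Ico (a + 1) K,
        (1 - x : ℂ) ^ (i - (a + 1)) * (classFactor f i x - 1)‖ ≤ 2 * K := by
      rw [norm_mul, ← one_mul (2 * K : ℝ)]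
      refine mul_le_mul ?_ (norm_sum_classFactor_le hx a _) (norm_nonneg _) zero_le_one
      rw [Complex.norm_real, Real.norm_eq_abs, abs_of_pos hx.1]
      exact hx.2.le
    have h2 := norm_pow_mul_classFactor_le (f := f) hx (K - a) K
    have h3 : 0 < 2 / Real.exp (-T) := by positivity
    refine (norm_add₃_le).trans ?_
    rw [norm_one]
    linarith
  R_eq x hx a := recordResolvent_eq hx.1 a
  R_zero x hx := by
    rw [mul_recordResolvent hx.1, recordExponent, mul_add, Nat.sub_zero, zero_add,
      mul_div_cancel₀ _ (by exact_mod_cast hx.1.ne'), add_assoc]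
  pos := Real.exp_pos _
  R_small x hx hxT a := by
    rw [mul_recordResolvent hx.1]
    simp [classFactor_eq_one hT hx.1 hxT]
  measurable_ψ := by
    have := measurable_classFactor hf
    unfold recordExponent
    fun_prop
  norm_ψ_le x hx := by
    have h1 := norm_sum_classFactor_le (f := f) (K := K) hx 0 (fun i => i - 1)
    have h2 : ‖(1 - x : ℂ) ^ K * (classFactor f K x - 1) / x‖ ≤ 2 / Real.exp (-T) := by
      by_cases hxT : x < Real.exp (-T)
      · rw [classFactor_eq_one hT hx.1 hxT]
        simp only [sub_self, mul_zero, zero_div, norm_zero]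
        positivity
      · rw [norm_div, Complex.norm_real, Real.norm_eq_abs, abs_of_pos hx.1]
        exact div_le_div₀ zero_le_two (norm_pow_mul_classFactor_le hx _ _) (Real.exp_pos _)
          (not_lt.1 hxT)
    refine (norm_add_le _ _).trans ?_
    linarith
  countable := hC.image _
  continuousAt x hx := by
    have h1 := continuousAt_classFactor hCf hx.1.1 hx.2
    have h2 : (x : ℂ) ≠ 0 := by exact_mod_cast hx.1.1.ne'
    unfold recordExponent
    have h3 : ContinuousAt (fun x : ℝ => (x : ℂ)) x := Complex.continuous_ofReal.continuousAt
    refine ContinuousAt.add (tendsto_finsetSum _ fun i _ => ?_) (ContinuousAt.div ?_ h3 h2)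
    · exact ((continuousAt_const.sub h3).pow _).mul ((h1 i).sub continuousAt_const)
    · exact ((continuousAt_const.sub h3).pow _).mul ((h1 K).sub continuousAt_const)

theorem ofReal_poissonIntensity (K i : ℕ) (t : ℝ) : (poissonIntensity K i t : ℂ) =
    if i < K then (1 - Real.exp (-t) : ℂ) ^ (i - 1) * Real.exp (-t)
      else (1 - Real.exp (-t) : ℂ) ^ K := by
  unfold poissonIntensity
  split_ifs <;> push_cast <;> rfl

/-- Change of variables `x = exp (-t)`. The Jacobian `exp (-t)` completes the intensities of the
classes `i < K`, while for class `K` it cancels the `1 / x`; hence the different shape of `λ_K`. -/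
theorem integral_recordExponent (hK : 0 < K) :
    ∫ x in (0 : ℝ)..1, recordExponent K f x = ∫ t in Set.Ioi (0 : ℝ),
      ∑ i ∈ Finset.Icc 1 K,
        (poissonIntensity K i t : ℂ) * (Complex.exp (Complex.I * (f i t : ℝ)) - 1) := by
  have himg : (fun t => Real.exp (-t)) '' Set.Ioi (0 : ℝ) = Set.Ioo 0 1 := by
    ext x
    constructor
    · rintro ⟨t, ht, rfl⟩
      exact ⟨Real.exp_pos _, Real.exp_lt_one_iff.2 (neg_neg_of_pos ht)⟩
    · rintro ⟨h0, h1⟩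
      exact ⟨- Real.log x, neg_pos.2 (Real.log_neg h0 h1), by simp [Real.exp_log h0]⟩
  have hd : ∀ t ∈ Set.Ioi (0 : ℝ), HasDerivWithinAt (fun t => Real.exp (-t)) (- Real.exp (-t))
      (Set.Ioi 0) t := fun t _ => by
    simpa using ((hasDerivAt_neg t).exp).hasDerivWithinAt
  rw [intervalIntegral.integral_of_le zero_le_one, integral_Ioc_eq_integral_Ioo, ← himg,
    integral_image_eq_integral_abs_deriv_smul measurableSet_Ioi hd
      (fun s _ t _ h => neg_injective (Real.exp_injective h))]
  refine setIntegral_congr_fun measurableSet_Ioi fun t _ => ?_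
  have h0 : (Real.exp (-t) : ℂ) ≠ 0 := by exact_mod_cast (Real.exp_pos _).ne'
  have hcf : ∀ i, classFactor f i (Real.exp (-t)) = Complex.exp (Complex.I * (f i t : ℝ)) := by
    intro i
    rw [classFactor, Real.log_exp, neg_neg]
  simp only [abs_neg, abs_of_pos (Real.exp_pos _), Complex.real_smul, recordExponent, hcf]
  rw [mul_add, mul_div_cancel₀ _ h0, Finset.mul_sum, show Finset.Icc 1 K = Finset.Ico 1 (K + 1) from rfl,
    Finset.sum_Ico_succ_top hK, ofReal_poissonIntensity, if_neg (lt_irrefl K)]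
  congr 1
  refine Finset.sum_congr rfl fun i hi => ?_
  rw [ofReal_poissonIntensity, if_pos (Finset.mem_Ico.1 hi).2]
  ring

end RecordFactor

/-! ### From products over the records to the counting processes -/

section RecordProcess

variable {w : ℕ → ℝ} {K : ℕ}

theorem IsCostSequence.recordState_recordIndex_add (hw : IsCostSequence w) (h : ℝ → ℕ → ℂ)
    (r : ℕ) : ∀ a < recordDuration w r, recordState h w (recordIndex w r + a) =
      (∏ j ∈ Finset.range r, h (w (recordIndex w j)) (recordDuration w j), w (recordIndex w r),
        a) := by
  have hstay : ∀ r, recordState h w (recordIndex w r) =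
      (∏ j ∈ Finset.range r, h (w (recordIndex w j)) (recordDuration w j), w (recordIndex w r),
        0) → ∀ a < recordDuration w r, recordState h w (recordIndex w r + a) =
      (∏ j ∈ Finset.range r, h (w (recordIndex w j)) (recordDuration w j), w (recordIndex w r),
        a) := by
    intro r hr a
    induction a with
    | zero => exact fun _ => hr
    | succ a ih =>
      intro ha
      have hlt : recordIndex w r + a + 1 < recordIndex w (r + 1) := by
        rw [hw.recordIndex_succ]; omega
      rw [← add_assoc, recordState, ih (by omega), if_neg]
      exact not_lt.2 ((hw.recordIndex_succ_spec r).2.2 _ (by omega) hlt)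
  induction r with
  | zero => exact hstay 0 (by simp [recordIndex, recordState])
  | succ r ih =>
    refine hstay (r + 1) ?_
    have hpos := hw.recordDuration_pos r
    have e : recordIndex w (r + 1) = recordIndex w r + (recordDuration w r - 1) + 1 := by
      rw [hw.recordIndex_succ]; omega
    have hlt := (hw.recordIndex_succ_spec r).2.1
    rw [e] at hlt ⊢
    rw [recordState, ih _ (by omega), if_pos hlt, Finset.prod_range_succ, Nat.sub_add_cancel hpos]

theorem IsCostSequence.eventually_recordState_eq (hw : IsCostSequence w) {h : ℝ → ℕ → ℂ} {J : ℕ}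
    (hJ : ∀ j, J ≤ j → h (w (recordIndex w j)) (recordDuration w j) = 1) :
    ∀ᶠ m in atTop, (recordState h w m).1 =
      ∏ j ∈ Finset.range J, h (w (recordIndex w j)) (recordDuration w j) := by
  filter_upwards [eventually_ge_atTop (recordIndex w J)] with m hm
  obtain ⟨r, h1, h2⟩ := hw.exists_recordIndex_le m
  obtain ⟨a, rfl⟩ := Nat.exists_eq_add_of_le h1
  rw [hw.recordIndex_succ] at h2
  rw [hw.recordState_recordIndex_add h r a (by omega)]
  have hJr : J ≤ r := by
    by_contra hcon
    have := hw.recordIndex_strictMono.monotone (show r + 1 ≤ J by omega)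
    rw [hw.recordIndex_succ] at this
    omega
  refine (Finset.prod_subset (Finset.range_mono hJr) fun j _ hj => hJ j ?_).symm
  simpa using hj

/-- Whether a record that stands for `d` terms belongs to the class `i`. -/
def InClass (K i d : ℕ) : Prop := if i < K then d = i else K < d

open Classical in
-- The classes are disjoint and miss only the duration `K` among the positive ones, so at most one
-- summand survives.
theorem recordFactor_eq (hK : 0 < K) (f : ℕ → ℝ → ℝ) (x : ℝ) {d : ℕ} (hd : 0 < d) :
    recordFactor K f x d = Complex.exp (Complex.I *
      ((∑ i ∈ Finset.Icc 1 K, if InClass K i d then f i (- Real.log x) else 0 : ℝ) : ℂ)) := by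
  unfold recordFactor
  split_ifs with h
  · rw [Finset.sum_eq_zero]
    · simp
    · intro i hi
      rw [Finset.mem_Icc] at hi
      refine if_neg fun hcl => ?_
      unfold InClass at hcl
      split_ifs at hcl <;> omega
  · rw [Finset.sum_eq_single (min d K), if_pos, classFactor]
    · unfold InClass
      split_ifs <;> omega
    · intro i hi hne
      rw [Finset.mem_Icc] at hi
      refine if_neg fun hcl => ?_
      unfold InClass at hcl
      split_ifs at hcl <;> omega
    · intro hcon
      exact absurd (Finset.mem_Icc.2 ⟨by omega, min_le_right _ _⟩) hcon

open Classical in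
theorem recordProcess_eq_sum {T : ℝ} {J : ℕ}
    (hJ : ∀ j, J ≤ j → T < - Real.log (w (recordIndex w j))) (i : ℕ) {t : ℝ≥0} (ht : t ≤ T) :
    (recordProcess w K i t : ℝ) = ∑ j ∈ Finset.range J, if InClass K i (recordDuration w j) then
      (if - Real.log (w (recordIndex w j)) ≤ t then 1 else 0) else 0 := by
  have h1 : {j : ℕ | - Real.log (w (recordIndex w j)) ≤ t ∧
      if i < K then recordDuration w j = i else K < recordDuration w j}
      = ↑((Finset.range J).filter fun j => - Real.log (w (recordIndex w j)) ≤ t ∧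
        InClass K i (recordDuration w j)) := by
    ext j
    rw [Finset.mem_coe, Finset.mem_filter, Finset.mem_range]
    refine ⟨fun h => ⟨?_, h⟩, fun h => h.2⟩
    by_contra hcon
    have := hJ j (not_lt.1 hcon)
    linarith [h.1]
  rw [recordProcess, h1, Set.ncard_coe_finset, Finset.card_filter]
  push_cast
  refine Finset.sum_congr rfl fun j _ => ?_
  by_cases h2 : InClass K i (recordDuration w j) <;> simp [h2]

variable {Ω : Type*} [MeasurableSpace Ω] {μ : Measure Ω} [IsProbabilityMeasure μ] {W : ℕ → Ω → ℝ}

/-- The joint characteristic function of the processes of the records at finitely many times. -/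
theorem IsUniformSequence.integral_exp_recordProcess (hW : IsUniformSequence W μ) (hK : 0 < K)
    {ι : Type*} [Fintype ι] (θ : ℕ → ι → ℝ) (t : ι → ℝ≥0) :
    ∫ ω, Complex.exp (Complex.I * ((∑ i ∈ Finset.Icc 1 K, ∑ a,
      θ i a * recordProcess (fun k => W k ω) K i (t a) : ℝ) : ℂ)) ∂μ
    = Complex.exp (∫ s in Set.Ioi (0 : ℝ), ∑ i ∈ Finset.Icc 1 K, (poissonIntensity K i s : ℂ) *
      (Complex.exp (Complex.I * ((∑ a, if s ≤ t a then θ i a else 0 : ℝ) : ℂ)) - 1)) := by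
  classical
  -- With this step function, the sum of `f i` over the times of the records of class `i` is `∑ a, θ
  -- i a * N^{(i)}_{t a}`.
  set f : ℕ → ℝ → ℝ := fun i s => ∑ a, if s ≤ t a then θ i a else 0 with hf
  obtain ⟨T, hT⟩ : ∃ T : ℝ, ∀ a, (t a : ℝ) ≤ T := by
    obtain ⟨T, hT⟩ := (Set.finite_range fun a => (t a : ℝ)).bddAbove
    exact ⟨T, fun a => hT ⟨a, rfl⟩⟩
  have hfm : ∀ i, Measurable (f i) := fun i =>
    Finset.measurable_sum _ fun a _ => Measurable.ite measurableSet_Iic measurable_const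
      measurable_const
  have hfT : ∀ i s, T < s → f i s = 0 := fun i s hs =>
    Finset.sum_eq_zero fun a _ => if_neg (not_le.2 ((hT a).trans_lt hs))
  have hC : (Set.range fun a => (t a : ℝ)).Countable := Set.countable_range _
  have hfc : ∀ i, ∀ s ∉ Set.range (fun a => (t a : ℝ)), ContinuousAt (f i) s := by
    intro i s hs
    refine tendsto_finsetSum _ fun a _ => ?_
    have hne : (t a : ℝ) ≠ s := fun h => hs ⟨a, h⟩
    rcases hne.lt_or_gt with h | h
    · refine (continuousAt_const (y := (0 : ℝ))).congr ?_
      filter_upwards [lt_mem_nhds h] with u hu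
      rw [if_neg (not_le.2 hu)]
    · refine (continuousAt_const (y := θ i a)).congr ?_
      filter_upwards [gt_mem_nhds h] with u hu
      rw [if_pos hu.le]
  have hgen := recordGenerator (K := K) hfm hfT hC hfc
  rw [← integral_recordExponent hK, hW.integral_record_product hgen]
  filter_upwards [hW.ae_isCostSequence] with ω hω
  obtain ⟨J, hJ⟩ := hω.exists_record_lt T
  have hfinal := hω.eventually_recordState_eq (h := recordFactor K f) (J := J) fun j hj => by
    rw [recordFactor_eq hK f _ (hω.recordDuration_pos j), Finset.sum_eq_zero]
    · simp
    · intro i _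
      rw [hfT i _ (hJ j hj), ite_self]
  filter_upwards [hfinal] with m hm
  rw [hm]
  simp only [recordFactor_eq hK f _ (hω.recordDuration_pos _)]
  rw [← Complex.exp_sum, ← Finset.mul_sum, ← Complex.ofReal_sum, Finset.sum_comm]
  congr 3
  refine Finset.sum_congr rfl fun i _ => ?_
  simp only [recordProcess_eq_sum (w := fun k => W k ω) hJ i (hT _), Finset.mul_sum]
  rw [Finset.sum_comm]
  refine Finset.sum_congr rfl fun j _ => ?_
  by_cases hcl : InClass K i (recordDuration (fun k => W k ω) j)
  · simp only [if_pos hcl, hf, mul_ite, mul_one, mul_zero]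
  · simp only [if_neg hcl, mul_zero, Finset.sum_const_zero]

end RecordProcess

/-! ### Characteristic functions of the processes and of their increments -/

section PoissonProcesses

variable {K : ℕ}

theorem measurable_poissonIntensity (K i : ℕ) : Measurable (poissonIntensity K i) := by
  unfold poissonIntensity
  split_ifs <;> fun_prop

theorem poissonIntensity_mem_Icc (K i : ℕ) {s : ℝ} (hs : 0 ≤ s) :
    poissonIntensity K i s ∈ Set.Icc (0 : ℝ) 1 := by
  have h0 := Real.exp_pos (-s)
  have h1 : Real.exp (-s) ≤ 1 := Real.exp_le_one_iff.2 (by linarith)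
  have h2 : ∀ k, (1 - Real.exp (-s)) ^ k ∈ Set.Icc (0 : ℝ) 1 := fun k =>
    ⟨pow_nonneg (by linarith) _, pow_le_one₀ (by linarith) (by linarith)⟩
  unfold poissonIntensity
  split_ifs
  · exact ⟨mul_nonneg (h2 _).1 h0.le, mul_le_one₀ (h2 _).2 h0.le h1⟩
  · exact h2 K

/-- The logarithm of the joint characteristic function of the values at the times `t` of a Poisson
process of intensity `poissonIntensity K i`. -/
def processExponent {ι : Type*} [Fintype ι] (K i : ℕ) (θ : ι → ℝ) (t : ι → ℝ≥0) : ℂ :=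
  ∫ s in Set.Ioi (0 : ℝ), (poissonIntensity K i s : ℂ) *
    (Complex.exp (Complex.I * ((∑ a, if s ≤ t a then θ a else 0 : ℝ) : ℂ)) - 1)

theorem integrableOn_processExponent {ι : Type*} [Fintype ι] (K i : ℕ) (θ : ι → ℝ)
    (t : ι → ℝ≥0) : IntegrableOn (fun s : ℝ => (poissonIntensity K i s : ℂ) *
    (Complex.exp (Complex.I * ((∑ a, if s ≤ t a then θ a else 0 : ℝ) : ℂ)) - 1))
    (Set.Ioi 0) := by
  obtain ⟨T, hT⟩ : ∃ T : ℝ, ∀ a, (t a : ℝ) ≤ T := by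
    obtain ⟨T, hT⟩ := (Set.finite_range fun a => (t a : ℝ)).bddAbove
    exact ⟨T, fun a => hT ⟨a, rfl⟩⟩
  have h1 : Measurable fun s : ℝ => ∑ a, if s ≤ t a then θ a else 0 :=
    Finset.measurable_sum _ fun a _ => Measurable.ite measurableSet_Iic measurable_const
      measurable_const
  have h2 : IntegrableOn (fun s : ℝ => (poissonIntensity K i s : ℂ) *
      (Complex.exp (Complex.I * ((∑ a, if s ≤ t a then θ a else 0 : ℝ) : ℂ)) - 1))
      (Set.Ioc 0 T) := by
    have := measurable_poissonIntensity K i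
    refine Measure.integrableOn_of_bounded (M := 2) (by simp)
      (Measurable.aestronglyMeasurable (by fun_prop)) ?_
    filter_upwards [ae_restrict_mem measurableSet_Ioc] with s hs
    have h3 := poissonIntensity_mem_Icc K i hs.1.le
    rw [norm_mul, ← one_mul (2 : ℝ), Complex.norm_real, Real.norm_eq_abs, abs_of_nonneg h3.1]
    refine mul_le_mul h3.2 ((norm_sub_le _ _).trans ?_) (norm_nonneg _) zero_le_one
    rw [mul_comm Complex.I, Complex.norm_exp_ofReal_mul_I, norm_one]
    norm_num
  refine h2.of_forall_sdiff_eq_zero measurableSet_Ioi fun s hs => ?_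
  have hs2 : T < s := not_le.1 fun h => hs.2 ⟨hs.1, h⟩
  have h4 : ∑ a, (if s ≤ t a then θ a else 0) = 0 :=
    Finset.sum_eq_zero fun a _ => if_neg (not_le.2 ((hT a).trans_lt hs2))
  rw [h4]
  simp

theorem processExponent_zero {ι : Type*} [Fintype ι] (K i : ℕ) (t : ι → ℝ≥0) :
    processExponent K i 0 t = 0 := by
  simp [processExponent]

theorem exp_sum_ite_sub_one {κ : Type*} [Fintype κ] {A : κ → Prop} [DecidablePred A] (ξ : κ → ℝ)
    (hA : ∀ k l, A k → A l → k = l) :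
    Complex.exp (Complex.I * ((∑ k, if A k then ξ k else 0 : ℝ) : ℂ)) - 1
      = ∑ k, if A k then Complex.exp (Complex.I * ξ k) - 1 else 0 := by
  by_cases h : ∃ k, A k
  · obtain ⟨k, hk⟩ := h
    have hne : ∀ l, l ≠ k → ¬ A l := fun l hl hAl => hl (hA _ _ hAl hk)
    rw [Finset.sum_eq_single k (fun l _ hl => if_neg (hne l hl)) (by simp),
      Finset.sum_eq_single k (fun l _ hl => if_neg (hne l hl)) (by simp), if_pos hk, if_pos hk]
  · push Not at h
    simp [h]

/-- An increment over `(s k, t k]` puts the weight `ξ k` on `t k` and `-ξ k` on `s k`, whence the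
index type `κ ⊕ κ`. The intervals are disjoint, so at each `u` at most one of them is active and
`exp - 1` is additive. -/
theorem processExponent_increments {κ : Type*} [Fintype κ] (K i : ℕ) (ξ : κ → ℝ) {s t : κ → ℝ≥0}
    (hst : ∀ k, s k ≤ t k)
    (hdisj : ∀ k l, ∀ u : ℝ, s k < u → u ≤ t k → s l < u → u ≤ t l → k = l) :
    processExponent K i (Sum.elim ξ (-ξ)) (Sum.elim t s) = ∑ k,
      ((∫ u in (s k : ℝ)..t k, poissonIntensity K i u : ℝ) : ℂ) *
        (Complex.exp (Complex.I * ξ k) - 1) := by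
  classical
  have h1 : ∀ u : ℝ, ∑ a, (if u ≤ Sum.elim t s a then Sum.elim ξ (-ξ) a else 0)
      = ∑ k, if s k < u ∧ u ≤ t k then ξ k else 0 := by
    intro u
    rw [Fintype.sum_sum_type, ← Finset.sum_add_distrib]
    refine Finset.sum_congr rfl fun k _ => ?_
    change (if u ≤ (t k : ℝ) then ξ k else 0) + (if u ≤ (s k : ℝ) then -ξ k else 0) = _
    have := NNReal.coe_le_coe.2 (hst k)
    by_cases hs : u ≤ s k
    · rw [if_pos hs, if_pos (hs.trans this), if_neg fun h => absurd hs (not_le.2 h.1)]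
      simp
    · rw [if_neg hs, add_zero]
      simp [not_le.1 hs]
  have hexp : ∀ u : ℝ,
      Complex.exp (Complex.I * ((∑ k, if s k < u ∧ u ≤ t k then ξ k else 0 : ℝ) : ℂ)) - 1
      = ∑ k, if s k < u ∧ u ≤ t k then Complex.exp (Complex.I * ξ k) - 1 else 0 := fun u =>
    exp_sum_ite_sub_one ξ fun k l hk hl => hdisj k l u hk.1 hk.2 hl.1 hl.2
  unfold processExponent
  simp only [h1, hexp, Finset.mul_sum]
  have hii : ∀ k, IntegrableOn (fun u : ℝ => (poissonIntensity K i u : ℂ)) (Set.Ioc (s k) (t k)) := by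
    intro k
    have := measurable_poissonIntensity K i
    refine Measure.integrableOn_of_bounded (M := 1) (by simp)
      (Measurable.aestronglyMeasurable (by fun_prop)) ?_
    filter_upwards [ae_restrict_mem measurableSet_Ioc] with u hu
    have h3 := poissonIntensity_mem_Icc K i ((s k).2.trans hu.1.le)
    rw [Complex.norm_real, Real.norm_eq_abs, abs_of_nonneg h3.1]
    exact h3.2
  have h2 : ∀ k, (fun u : ℝ => (poissonIntensity K i u : ℂ) *
      (if s k < u ∧ u ≤ t k then Complex.exp (Complex.I * ξ k) - 1 else 0))
      = (Set.Ioc (s k : ℝ) (t k)).indicator fun u => (poissonIntensity K i u : ℂ) *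
        (Complex.exp (Complex.I * ξ k) - 1) := by
    intro k
    ext u
    rw [Set.indicator_apply]
    simp only [Set.mem_Ioc, mul_ite, mul_zero]
  have h3 : ∀ k, Set.Ioi (0 : ℝ) ∩ Set.Ioc (s k : ℝ) (t k) = Set.Ioc (s k : ℝ) (t k) := fun k =>
    Set.inter_eq_right.2 fun u hu => (s k).2.trans_lt hu.1
  rw [integral_finsetSum]
  · refine Finset.sum_congr rfl fun k _ => ?_
    rw [h2, setIntegral_indicator measurableSet_Ioc, h3, integral_mul_const, integral_complex_ofReal,
      intervalIntegral.integral_of_le (NNReal.coe_le_coe.2 (hst k))]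
  · intro k _
    rw [h2, integrable_indicator_iff measurableSet_Ioc, IntegrableOn,
      Measure.restrict_restrict measurableSet_Ioc, Set.inter_comm, h3]
    exact (hii k).mul_const _

variable {Ω : Type*} [MeasurableSpace Ω] {μ : Measure Ω} [IsProbabilityMeasure μ] {W : ℕ → Ω → ℝ}

theorem IsUniformSequence.integral_exp_recordProcesses (hW : IsUniformSequence W μ) (hK : 0 < K)
    {ι : Type*} [Fintype ι] (θ : ℕ → ι → ℝ) (t : ι → ℝ≥0) :
    ∫ ω, Complex.exp (Complex.I * ((∑ i ∈ Finset.Icc 1 K, ∑ a,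
      θ i a * recordProcess (fun k => W k ω) K i (t a) : ℝ) : ℂ)) ∂μ
    = ∏ i ∈ Finset.Icc 1 K, Complex.exp (processExponent K i (θ i) t) := by
  rw [hW.integral_exp_recordProcess hK, integral_finsetSum _ fun i _ =>
    integrableOn_processExponent K i (θ i) t, Complex.exp_sum]
  rfl

theorem IsUniformSequence.integral_exp_single_recordProcess (hW : IsUniformSequence W μ) {i : ℕ}
    (hi : i ∈ Finset.Icc 1 K) {ι : Type*} [Fintype ι] (θ : ι → ℝ) (t : ι → ℝ≥0) :
    ∫ ω, Complex.exp (Complex.I * ((∑ a,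
      θ a * recordProcess (fun k => W k ω) K i (t a) : ℝ) : ℂ)) ∂μ
    = Complex.exp (processExponent K i θ t) := by
  classical
  have h := hW.integral_exp_recordProcesses (K := K)
    (by have := Finset.mem_Icc.1 hi; omega) (Pi.single i θ) t
  have h1 : ∀ ω, ∑ i' ∈ Finset.Icc 1 K, ∑ a, (Pi.single i θ : ℕ → ι → ℝ) i' a *
      (recordProcess (fun k => W k ω) K i' (t a) : ℝ)
      = ∑ a, θ a * recordProcess (fun k => W k ω) K i (t a) := by
    intro ω
    rw [Finset.sum_eq_single i]
    · simp
    · intro j _ hj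
      simp [hj]
    · exact fun hcon => absurd hi hcon
  simp only [h1] at h
  rw [h, Finset.prod_eq_single i]
  · simp
  · intro j _ hj
    rw [Pi.single_eq_of_ne hj, processExponent_zero, Complex.exp_zero]
  · exact fun hcon => absurd hi hcon

theorem IsUniformSequence.integral_exp_increments (hW : IsUniformSequence W μ) {i : ℕ}
    (hi : i ∈ Finset.Icc 1 K) {κ : Type*} [Fintype κ] (ξ : κ → ℝ) {s t : κ → ℝ≥0}
    (hst : ∀ k, s k ≤ t k)
    (hdisj : ∀ k l, ∀ u : ℝ, s k < u → u ≤ t k → s l < u → u ≤ t l → k = l) :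
    ∫ ω, Complex.exp (Complex.I * ((∑ k, ξ k * (recordProcess (fun k => W k ω) K i (t k)
      - recordProcess (fun k => W k ω) K i (s k)) : ℝ) : ℂ)) ∂μ
    = ∏ k, Complex.exp (((∫ u in (s k : ℝ)..t k, poissonIntensity K i u : ℝ) : ℂ) *
        (Complex.exp (Complex.I * ξ k) - 1)) := by
  rw [← Complex.exp_sum, ← processExponent_increments K i ξ hst hdisj,
    ← hW.integral_exp_single_recordProcess hi]
  congr 1
  ext ω
  congr 3
  rw [Fintype.sum_sum_type, ← Finset.sum_add_distrib]
  refine Finset.sum_congr rfl fun k _ => ?_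
  simp only [Sum.elim_inl, Sum.elim_inr, Pi.neg_apply]
  ring

end PoissonProcesses

/-! ### The processes are independent Poisson processes -/

section PoissonProcesses

variable {w : ℕ → ℝ} {K : ℕ}

theorem IsCostSequence.monotone_recordProcess (hw : IsCostSequence w) (K i : ℕ) :
    Monotone (recordProcess w K i) := fun _ t hst =>
  Set.ncard_le_ncard (fun _ hj => ⟨hj.1.trans (NNReal.coe_le_coe.2 hst), hj.2⟩)
    (hw.finite_recordProcess_set t fun j =>
      if i < K then recordDuration w j = i else K < recordDuration w j)

theorem IsCostSequence.recordProcess_zero (hw : IsCostSequence w) (K i : ℕ) :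
    recordProcess w K i 0 = 0 := by
  rw [recordProcess, Set.ncard_eq_zero (hw.finite_recordProcess_set _ fun j =>
      if i < K then recordDuration w j = i else K < recordDuration w j)]
  exact Set.eq_empty_of_forall_notMem fun j hj => absurd hj.1 (not_le.2 (hw.record_time_pos j))

/-- Only finitely many records have a time at most `t + 1`, so the count is constant on a right
neighbourhood of `t`. -/
theorem IsCostSequence.continuousWithinAt_recordProcess (hw : IsCostSequence w) (K i : ℕ)
    (t : ℝ≥0) : ContinuousWithinAt (recordProcess w K i) (Set.Ici t) t := by
  obtain ⟨j₀, hj₀⟩ := hw.exists_record_lt (t + 1)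
  have h1 : ∀ᶠ s : ℝ≥0 in 𝓝[≥] t, s < t + 1 :=
    nhdsWithin_le_nhds (gt_mem_nhds (lt_add_one t))
  have h2 : ∀ᶠ s : ℝ≥0 in 𝓝[≥] t, ∀ j ∈ Finset.range j₀,
      (t : ℝ) < - Real.log (w (recordIndex w j)) → (s : ℝ) < - Real.log (w (recordIndex w j)) := by
    refine nhdsWithin_le_nhds ((Filter.eventually_all_finset _).2 fun j _ => ?_)
    by_cases h : (t : ℝ) < - Real.log (w (recordIndex w j))
    · filter_upwards [NNReal.continuous_coe.continuousAt.eventually (gt_mem_nhds h)] with s hs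
      exact fun _ => hs
    · exact Eventually.of_forall fun s hs => absurd hs h
  refine tendsto_const_nhds.congr' ?_
  filter_upwards [h1, h2, self_mem_nhdsWithin] with s hs1 hs2 hs3
  unfold recordProcess
  congr 1
  ext j
  refine and_congr_left fun _ => ⟨fun h => h.trans (NNReal.coe_le_coe.2 hs3), fun h => ?_⟩
  by_contra hcon
  by_cases hj : j < j₀
  · exact absurd (hs2 j (Finset.mem_range.2 hj) (not_le.1 hcon)) (not_lt.2 h)
  · have h3 := hj₀ j (not_lt.1 hj)
    have h4 : (s : ℝ) < t + 1 := by exact_mod_cast hs1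
    linarith

variable {Ω : Type*} [MeasurableSpace Ω] {μ : Measure Ω} {W : ℕ → Ω → ℝ}

theorem IsUniformSequence.measurable_comp (hW : IsUniformSequence W μ) {m : Ω → ℕ}
    (hm : Measurable m) : Measurable fun ω => W (m ω) ω :=
  (measurable_from_prod_countable_right (f := fun z : ℕ × Ω => W z.1 z.2) hW.measurable).comp
    (hm.prodMk measurable_id)

theorem IsUniformSequence.measurable_recordIndex (hW : IsUniformSequence W μ) (j : ℕ) :
    Measurable fun ω => recordIndex (fun k => W k ω) j := by
  induction j with
  | zero => exact measurable_const
  | succ j ih =>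
    refine measurable_sInf_set_nat.comp (measurable_set_iff.2 fun m => ?_)
    exact (measurableSet_setOfPred.1 (measurableSet_lt ih measurable_const)).and
      (measurableSet_setOfPred.1 (measurableSet_lt (hW.measurable m) (hW.measurable_comp ih)))

theorem IsUniformSequence.measurable_recordProcess (hW : IsUniformSequence W μ) (K i : ℕ)
    (t : ℝ≥0) : Measurable fun ω => recordProcess (fun k => W k ω) K i t := by
  refine measurable_ncard.comp (measurable_set_iff.2 fun j => ?_)
  have h1 := hW.measurable_comp (hW.measurable_recordIndex j)
  have h2 : Measurable fun ω => recordDuration (fun k => W k ω) j :=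
    (hW.measurable_recordIndex (j + 1)).sub (hW.measurable_recordIndex j)
  refine (measurableSet_setOfPred.1 (measurableSet_le
    (Real.measurable_log.comp h1).neg measurable_const)).and ?_
  split_ifs
  · exact measurableSet_setOfPred.1 (measurableSet_eq_fun h2 measurable_const)
  · exact measurableSet_setOfPred.1 (measurableSet_lt measurable_const h2)

theorem iIndepFun_of_natCast {ι : Type*} {X : ι → Ω → ℕ}
    (h : iIndepFun (fun i ω => (X i ω : ℝ)) μ) : iIndepFun X μ := by
  have := h.comp (fun _ x => ⌊x⌋₊) fun _ => Nat.measurable_floor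
  simpa [Function.comp_def] using this

variable [IsProbabilityMeasure μ]

/-- Increments are formed by truncated subtraction in `ℕ`. Monotone paths make it agree almost
surely with the real difference, to which characteristic functions apply. -/
theorem IsUniformSequence.ae_natCast_increment (hW : IsUniformSequence W μ) (K i : ℕ) {s t : ℝ≥0}
    (hst : s ≤ t) : (fun ω => ((recordProcess (fun k => W k ω) K i t
      - recordProcess (fun k => W k ω) K i s : ℕ) : ℝ)) =ᵐ[μ] fun ω =>
      (recordProcess (fun k => W k ω) K i t : ℝ) - recordProcess (fun k => W k ω) K i s := by
  filter_upwards [hW.ae_isCostSequence] with ω hω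
  exact Nat.cast_sub (hω.monotone_recordProcess K i hst)

theorem IsUniformSequence.charFun_increment (hW : IsUniformSequence W μ) {i : ℕ}
    (hi : i ∈ Finset.Icc 1 K) {s t : ℝ≥0} (hst : s ≤ t) (ξ : ℝ) :
    charFun (μ.map fun ω => (recordProcess (fun k => W k ω) K i t : ℝ)
      - recordProcess (fun k => W k ω) K i s) ξ
    = Complex.exp (((∫ u in (s : ℝ)..t, poissonIntensity K i u : ℝ) : ℂ) *
        (Complex.exp (Complex.I * ξ) - 1)) := by
  have h := hW.integral_exp_increments hi (fun _ : Unit => ξ) (s := fun _ => s) (t := fun _ => t)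
    (fun _ => hst) (fun _ _ _ _ _ _ _ => rfl)
  have hm1 := hW.measurable_recordProcess K i t
  have hm2 := hW.measurable_recordProcess K i s
  rw [charFun_apply_real, integral_map (Measurable.aemeasurable (by fun_prop))
    (Measurable.aestronglyMeasurable (by fun_prop))]
  simp only [Finset.univ_unique, Finset.sum_singleton, Finset.prod_singleton] at h
  rw [← h]
  congr 1
  ext ω
  push_cast
  ring_nf

/-- The intervals between consecutive times are disjoint, so the joint characteristic function of
the increments factorises. -/
theorem IsUniformSequence.hasIndepIncrements_recordProcess (hW : IsUniformSequence W μ) {i : ℕ}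
    (hi : i ∈ Finset.Icc 1 K) :
    HasIndepIncrements (fun t ω => recordProcess (fun k => W k ω) K i t) μ := by
  intro n t ht
  have hle : ∀ k : Fin n, t k.castSucc ≤ t k.succ := fun k => ht k.castSucc_lt_succ.le
  have hm := hW.measurable_recordProcess K i
  refine iIndepFun_of_natCast ((iIndepFun_congr fun k =>
    hW.ae_natCast_increment K i (hle k)).2 ?_)
  rw [iIndepFun_iff_charFun_pi fun k => Measurable.aemeasurable (by fun_prop)]
  intro ξ
  simp only [fun k => hW.charFun_increment hi (hle k)]
  rw [← hW.integral_exp_increments hi _ hle, charFun_apply, integral_map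
    (Measurable.aemeasurable (by fun_prop)) (Measurable.aestronglyMeasurable (by fun_prop))]
  · congr 1
    ext ω
    rw [PiLp.inner_apply, mul_comm]
    simp
  · have key : ∀ k l : Fin n, k < l → ∀ u : ℝ, u ≤ t k.succ → t l.castSucc < u → False := by
      intro k l hkl u h1 h2
      have h3 : t k.succ ≤ t l.castSucc := ht (Fin.succ_le_castSucc_iff.2 hkl)
      exact absurd (h2.trans_le h1) (not_lt.2 (NNReal.coe_le_coe.2 h3))
    intro k l u h1 h2 h3 h4
    rcases lt_trichotomy k l with h | h | h
    · exact (key k l h u h2 h3).elim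
    · exact h
    · exact (key l k h u h4 h1).elim

theorem IsUniformSequence.isInhomogeneousPoisson_recordProcess (hW : IsUniformSequence W μ)
    {i : ℕ} (hi : i ∈ Finset.Icc 1 K) :
    IsInhomogeneousPoisson (fun t ω => recordProcess (fun k => W k ω) K i t)
      (poissonIntensity K i) μ where
  measurable := hW.measurable_recordProcess K i
  zero := hW.ae_isCostSequence.mono fun _ hw => hw.recordProcess_zero K i
  monotone := hW.ae_isCostSequence.mono fun _ hw => hw.monotone_recordProcess K i
  rightContinuous := hW.ae_isCostSequence.mono fun _ hw => hw.continuousWithinAt_recordProcess K i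
  indepIncrements := hW.hasIndepIncrements_recordProcess hi
  increment_law s t hst := by
    have hm := hW.measurable_recordProcess K i
    refine ⟨Measurable.aemeasurable (by fun_prop), ?_⟩
    apply (MeasurableEmbedding.natCast (α := ℝ)).map_injective
    rw [Measure.map_map (by fun_prop) (by fun_prop), Function.comp_def,
      Measure.map_congr (hW.ae_natCast_increment K i hst)]
    have : IsProbabilityMeasure (μ.map fun ω => (recordProcess (fun k => W k ω) K i t : ℝ)
        - recordProcess (fun k => W k ω) K i s) :=
      Measure.isProbabilityMeasure_map (Measurable.aemeasurable (by fun_prop))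
    apply Measure.ext_of_charFun
    ext ξ
    rw [hW.charFun_increment hi hst, charFun_map_cast_poissonMeasure, mul_comm (ξ : ℂ)]
    congr 2
    have h0 : 0 ≤ ∫ u in (s : ℝ)..t, poissonIntensity K i u :=
      intervalIntegral.integral_nonneg (NNReal.coe_le_coe.2 hst) fun u hu =>
        (poissonIntensity_mem_Icc K i (s.2.trans hu.1)).1
    exact congrArg _ (Real.coe_toNNReal _ h0).symm

/-- The exponent of the joint characteristic function is a sum over the classes, so the function is
the product of those of the single processes. -/
theorem IsUniformSequence.iIndepFun_recordProcess_finset (hW : IsUniformSequence W μ) (K : ℕ)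
    (U : Finset ℝ≥0) : ProbabilityTheory.iIndepFun (fun (i : Finset.Icc 1 K) ω (t : U) =>
      recordProcess (fun k => W k ω) K i t) μ := by
  have hm := hW.measurable_recordProcess K
  obtain rfl | hK := K.eq_zero_or_pos
  · have : IsEmpty (Finset.Icc 1 0) := ⟨fun i => by simpa using i.2⟩
    exact iIndepFun.of_subsingleton
  have h : ProbabilityTheory.iIndepFun (fun (i : Finset.Icc 1 K) ω => WithLp.toLp 2 fun t : U =>
      (recordProcess (fun k => W k ω) K i t : ℝ)) μ := by
    rw [iIndepFun_iff_charFun_pi fun k => Measurable.aemeasurable (by fun_prop)]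
    intro ξ
    let θ : ℕ → U → ℝ := fun i t => if h : i ∈ Finset.Icc 1 K then ξ ⟨i, h⟩ t else 0
    have hθ : ∀ (i : Finset.Icc 1 K) t, θ i t = ξ i t := fun i t => by simp only [θ, i.2, dif_pos]
    have h1 : ∀ i : Finset.Icc 1 K, charFun (μ.map fun ω => WithLp.toLp 2 fun t : U =>
        (recordProcess (fun k => W k ω) K i t : ℝ)) (ξ i)
        = Complex.exp (processExponent K i (θ i) fun t : U => (t : ℝ≥0)) := by
      intro i
      rw [← hW.integral_exp_single_recordProcess i.2, charFun_apply, integral_map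
        (Measurable.aemeasurable (by fun_prop)) (Measurable.aestronglyMeasurable (by fun_prop))]
      congr 1
      ext ω
      rw [PiLp.inner_apply, mul_comm]
      simp [hθ]
    simp only [h1]
    rw [Finset.prod_coe_sort (Finset.Icc 1 K)
      fun i => Complex.exp (processExponent K i (θ i) fun t : U => (t : ℝ≥0)),
      ← hW.integral_exp_recordProcesses hK, charFun_apply, integral_map
        (Measurable.aemeasurable (by fun_prop)) (Measurable.aestronglyMeasurable (by fun_prop))]
    congr 1
    ext ω
    rw [PiLp.inner_apply, mul_comm, ← Finset.sum_coe_sort (Finset.Icc 1 K)]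
    simp [hθ, PiLp.inner_apply]
  have := h.comp (fun _ (z : EuclideanSpace ℝ U) (t : U) => ⌊z t⌋₊) fun _ =>
    measurable_pi_lambda _ fun t => Nat.measurable_floor.comp (by fun_prop)
  simpa [Function.comp_def] using this

theorem IsUniformSequence.iIndepFun_recordProcess (hW : IsUniformSequence W μ) (K : ℕ) :
    ProbabilityTheory.iIndepFun (fun (i : Finset.Icc 1 K) ω (t : ℝ≥0) =>
      recordProcess (fun k => W k ω) K i t) μ := by
  classical
  refine iIndepFun.iIndepFun_process (fun i t => hW.measurable_recordProcess K i t) fun I J => ?_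
  -- The times `J i` may vary with `i`; all the vectors are read off one common finite set of times.
  have hsub : ∀ i, J i ⊆ Finset.univ.biUnion J := fun i =>
    Finset.subset_biUnion_of_mem J (Finset.mem_univ i)
  exact ((hW.iIndepFun_recordProcess_finset K (Finset.univ.biUnion J)).precomp
    (g := fun i : I => (i : Finset.Icc 1 K)) Subtype.val_injective).comp
    (fun i z (t : J i) => z ⟨t, hsub i t.2⟩) fun i =>
      measurable_pi_lambda _ fun t => measurable_pi_apply _

end PoissonProcesses

/-! ### Mean error bounds at fixed `n` -/

section Assembly

/-- The upper integral of `f` is at most `b`. -/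
def UpperIntegralLE {Ω : Type*} [MeasurableSpace Ω] (μ : Measure Ω) (f : Ω → ℝ≥0∞)
    (b : ℝ≥0∞) : Prop :=
  ∃ F, Measurable F ∧ (∀ᵐ ω ∂μ, f ω ≤ F ω) ∧ ∫⁻ ω, F ω ∂μ ≤ b

namespace UpperIntegralLE

variable {Ω : Type*} [MeasurableSpace Ω] {μ : Measure Ω} {f g : Ω → ℝ≥0∞} {a b : ℝ≥0∞}

theorem lintegral_le (h : UpperIntegralLE μ f b) : ∫⁻ ω, f ω ∂μ ≤ b := by
  obtain ⟨F, -, h2, h3⟩ := h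
  exact (lintegral_mono_ae h2).trans h3

theorem congr_right (h : UpperIntegralLE μ f a) (hab : a = b) : UpperIntegralLE μ f b :=
  hab ▸ h

theorem mono (h : UpperIntegralLE μ f b) (hgf : ∀ ω, g ω ≤ f ω) : UpperIntegralLE μ g b := by
  obtain ⟨F, h1, h2, h3⟩ := h
  exact ⟨F, h1, h2.mono fun ω hω => (hgf ω).trans hω, h3⟩

/-- Without measurability `∫⁻` is a lower integral and need not be subadditive; bounds through
measurable majorants are. They spare any proof that the running time and the number of explored
vertices are measurable. -/
theorem add (hf : UpperIntegralLE μ f a) (hg : UpperIntegralLE μ g b) :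
    UpperIntegralLE μ (fun ω => f ω + g ω) (a + b) := by
  obtain ⟨F, hF1, hF2, hF3⟩ := hf
  obtain ⟨F', hG1, hG2, hG3⟩ := hg
  refine ⟨fun ω => F ω + F' ω, hF1.add hG1, ?_, ?_⟩
  · filter_upwards [hF2, hG2] with ω h1 h2 using add_le_add h1 h2
  · rw [lintegral_add_left hF1]
    exact add_le_add hF3 hG3

theorem const_mul (hf : UpperIntegralLE μ f a) (r : ℝ≥0∞) :
    UpperIntegralLE μ (fun ω => r * f ω) (r * a) := by
  obtain ⟨F, hF1, hF2, hF3⟩ := hf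
  refine ⟨fun ω => r * F ω, hF1.const_mul r, ?_, ?_⟩
  · filter_upwards [hF2] with ω h1
    gcongr
  · rw [lintegral_const_mul _ hF1]
    gcongr

end UpperIntegralLE

theorem ofReal_abs_sub_le_natCast {a b k : ℕ} (h1 : a ≤ b + k) (h2 : b ≤ a + k) :
    ENNReal.ofReal |(a : ℝ) - b| ≤ k := by
  refine ENNReal.ofReal_le_of_le_toReal ?_
  rw [ENNReal.toReal_natCast, abs_le]
  have h3 : (a : ℝ) ≤ b + k := by exact_mod_cast h1
  have h4 : (b : ℝ) ≤ a + k := by exact_mod_cast h2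
  constructor <;> linarith

variable {Ω : Type*} [MeasurableSpace Ω] {μ : Measure Ω} {W : ℕ → Ω → ℝ}
  {n : ℕ} {G : Ω → SimpleGraph (Fin n)} {v : Ω → Fin n} {c : Ω → Fin n → ℝ} {B : ℕ}
  {p η κ M : ℝ} {q : ℝ≥0∞}

theorem measurableSet_not_isPseudoRandom_or_lt (hW : IsUniformSequence W μ)
    (hGm : Measurable G) : MeasurableSet
      {ω | ¬ IsPseudoRandom (G ω) p η κ ∨ M < recordCount (fun k => W k ω) n} := by
  have h : Measurable fun ω => (recordCount (fun k => W k ω) n : ℝ) := by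
    have := hW.measurable_recordCount n
    fun_prop
  exact (measurableSet_isPseudoRandom hGm p η κ).compl.union (measurableSet_lt measurable_const h)

variable [IsProbabilityMeasure μ]

/-- On the typical event both `E` and `ageTime W K` lie between `ageTime W D` and `ageTime W (D +
d)`, and the functional differs from `ageTime W K` only by the records of duration `K`. On the
atypical event `E ≤ n` and the functional is at most `ageTime W K`. -/
theorem IsUniformSequence.upperIntegralLE_agdTotalExplored_sub (hW : IsUniformSequence W μ)
    (hGm : Measurable G)
    (hcW : ∀ᵐ ω ∂μ, AGDCostsDrawnFrom (G ω) (c ω) (v ω) B (fun k => W k ω))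
    (hB : 0 < B) (hp : 0 ≤ p) (hη : 0 ≤ η) (hκ : 0 ≤ κ) {D K d : ℕ} (hD0 : 0 < D) (hDK : D ≤ K)
    (hKd : K ≤ D + d) (hD : (D : ℝ) ≤ p * n - 2 * visitError n p η κ M)
    (hd : p * B + 2 * visitError n p η κ M + (p * n + η) < (D + d : ℕ))
    (hq : μ {ω | ¬ IsPseudoRandom (G ω) p η κ ∨ M < recordCount (fun k => W k ω) n} ≤ q) :
    UpperIntegralLE μ (fun ω => ENNReal.ofReal |(agdTotalExplored (G ω) (c ω) (v ω) B : ℝ)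
      - poissonFunctional K (recordProcess (fun k => W k ω) K)|)
    ((d + 2 * (D + d : ℕ) * ∑' k : ℕ, min (ENNReal.ofReal (d / (D + 1))) ((1 / 2) ^ k))
      + (1 + (n * q + 2 * K * ∑' k : ℕ, min q ((1 / 2) ^ k)))) := by
  set A := {ω | ¬ IsPseudoRandom (G ω) p η κ ∨ M < recordCount (fun k => W k ω) n} with hAdef
  have hA : MeasurableSet A := measurableSet_not_isPseudoRandom_or_lt hW hGm
  have hage := hW.measurable_ageTime
  have hpt : ∀ᵐ ω ∂μ, ENNReal.ofReal |(agdTotalExplored (G ω) (c ω) (v ω) B : ℝ)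
      - poissonFunctional K (recordProcess (fun k => W k ω) K)|
      ≤ ((ageTime (fun k => W k ω) (D + d) : ℝ≥0∞) - ageTime (fun k => W k ω) D)
        + ((K : ℝ≥0∞) * ∑' l,
          Set.indicator {l | HasRecordOfDuration (fun k => W k ω) (K - 1) l} 1 l
        + A.indicator (fun ω => (n : ℝ≥0∞) + ageTime (fun k => W k ω) K) ω) := by
    filter_upwards [hcW, hW.ae_injective, hW.ae_exists_age,
      hW.ae_poissonFunctional_le (hD0.trans_le hDK)] with ω hcw hinj hex hpf
    obtain ⟨hpf1, hpf2⟩ := hpf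
    set w : ℕ → ℝ := fun k => W k ω
    replace hex : ∀ D, ∃ m l, l + D ≤ m ∧ ∀ k ≤ m, w l ≤ w k := hex
    set E := agdTotalExplored (G ω) (c ω) (v ω) B
    set S := poissonFunctional K (recordProcess w K)
    by_cases hω : ω ∈ A
    · rw [Set.indicator_of_mem hω]
      refine le_trans ?_ (le_add_self.trans le_add_self)
      have hE : E ≤ n := (agdRunningTime_le hB).2
      have := ofReal_abs_sub_le_natCast (a := E) (b := S) (k := n + ageTime w K) (by omega)
        (by omega)
      exact_mod_cast this
    · simp only [hAdef, Set.mem_ofPred_eq, not_or, not_not, not_lt] at hω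
      obtain ⟨⟨l, hl1, hl2⟩, h2, -⟩ := agd_estimates hB hω.1 hp hη hκ
        (fun m hm => (Nat.cast_le.2 (recordCount_mono w hm.le)).trans hω.2) hinj hcw hd
      have hE1 : ageTime w D ≤ E := by
        refine ageTime_le (l := l) ?_ hl2
        have : (l : ℝ) + D ≤ E := by linarith
        exact_mod_cast this
      have hE2 : E ≤ ageTime w (D + d) := by
        obtain ⟨l', h3, h4⟩ := exists_ageTime (hex (D + d))
        by_contra hcon
        have h5 := h2 _ (not_le.1 hcon).le l' (by omega) h4
        have h6 : ((l' + (D + d) : ℕ) : ℝ) ≤ ageTime w (D + d) := Nat.cast_le.2 h3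
        push_cast at h5 h6
        linarith
      have hK1 := ageTime_mono hDK (hex K)
      have hK2 := ageTime_mono hKd (hex (D + d))
      have h7 := ofReal_abs_sub_le_natCast (a := E) (b := S)
        (k := (ageTime w (D + d) - ageTime w D) + (ageTime w K - S)) (by omega) (by omega)
      refine h7.trans ?_
      rw [Nat.cast_add, ENNReal.natCast_sub, ENNReal.natCast_sub]
      gcongr
      exact le_add_right (tsub_le_iff_left.2 hpf2)
  have hmA : Measurable (A.indicator fun ω => (n : ℝ≥0∞) + ageTime (fun k => W k ω) K) :=
    Measurable.indicator (by fun_prop) hA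
  have hmR : Measurable fun ω => (K : ℝ≥0∞) * ∑' l,
      Set.indicator {l | HasRecordOfDuration (fun k => W k ω) (K - 1) l} (1 : ℕ → ℝ≥0∞) l :=
    (Measurable.tsum fun l => (measurable_one (α := ℝ≥0∞)).indicator
      (hW.measurableSet_hasRecordOfDuration (K - 1) l)).const_mul _
  refine ⟨_, Measurable.add (by fun_prop) (hmR.add hmA), hpt, ?_⟩
  simp only [Pi.add_apply]
  rw [lintegral_add_left (by fun_prop), lintegral_add_right _ hmA, lintegral_indicator hA,
    lintegral_add_left measurable_const, setLIntegral_const]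
  gcongr
  · exact hW.lintegral_ageTime_sub_le hD0
  · exact hW.lintegral_tsum_hasRecordOfDuration_le (hD0.trans_le hDK)
  · exact (hW.setLIntegral_ageTime_le (hD0.trans_le hDK) A).trans (by gcongr)

theorem IsUniformSequence.upperIntegralLE_agdRunningTime_sub (hW : IsUniformSequence W μ)
    (hGm : Measurable G)
    (hcW : ∀ᵐ ω ∂μ, AGDCostsDrawnFrom (G ω) (c ω) (v ω) B (fun k => W k ω))
    (hB : 0 < B) (hp : 0 ≤ p) (hη : 0 ≤ η) (hκ : 0 ≤ κ)
    (hq : μ {ω | ¬ IsPseudoRandom (G ω) p η κ ∨ M < recordCount (fun k => W k ω) n} ≤ q) :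
    UpperIntegralLE μ (fun ω => ENNReal.ofReal |p * B * agdRunningTime (G ω) (c ω) (v ω) B
      - agdTotalExplored (G ω) (c ω) (v ω) B|)
    (ENNReal.ofReal ((M + 1) * (visitError n p η κ M + p * B))
      + ENNReal.ofReal (p * B * (n * n + 1) + n) * q) := by
  set A := {ω | ¬ IsPseudoRandom (G ω) p η κ ∨ M < recordCount (fun k => W k ω) n} with hAdef
  have hA : MeasurableSet A := measurableSet_not_isPseudoRandom_or_lt hW hGm
  have hpt : ∀ᵐ ω ∂μ, ENNReal.ofReal |p * B * agdRunningTime (G ω) (c ω) (v ω) B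
      - agdTotalExplored (G ω) (c ω) (v ω) B|
      ≤ ENNReal.ofReal ((M + 1) * (visitError n p η κ M + p * B))
        + A.indicator (fun _ => ENNReal.ofReal (p * B * (n * n + 1) + n)) ω := by
    filter_upwards [hcW, hW.ae_injective] with ω hcw hinj
    by_cases hω : ω ∈ A
    · rw [Set.indicator_of_mem hω]
      refine le_add_left (ENNReal.ofReal_le_ofReal ?_)
      obtain ⟨h1, h2⟩ := agdRunningTime_le (G := G ω) (c := c ω) (v := v ω) hB
      have h3 : (agdRunningTime (G ω) (c ω) (v ω) B : ℝ) ≤ n * n + 1 := by exact_mod_cast h1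
      have h4 : (agdTotalExplored (G ω) (c ω) (v ω) B : ℝ) ≤ n := by exact_mod_cast h2
      have h5 : p * B * agdRunningTime (G ω) (c ω) (v ω) B ≤ p * B * (n * n + 1) := by gcongr
      have h6 : 0 ≤ p * B * agdRunningTime (G ω) (c ω) (v ω) B := by positivity
      rw [abs_le]
      constructor <;> linarith [(Nat.cast_nonneg _ : (0 : ℝ) ≤ agdTotalExplored (G ω) (c ω) (v ω) B)]
    · simp only [hAdef, Set.mem_ofPred_eq, not_or, not_not, not_lt] at hω
      -- The time estimate does not involve the age bound, so any admissible value of it may be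
      -- inserted.
      exact le_add_right (ENNReal.ofReal_le_ofReal (agd_estimates hB hω.1 hp hη hκ
        (fun m hm => (Nat.cast_le.2 (recordCount_mono _ hm.le)).trans hω.2) hinj hcw
        (lt_add_one _)).2.2)
  refine ⟨_, measurable_const.add (measurable_const.indicator hA), hpt, ?_⟩
  simp only [Pi.add_apply]
  rw [lintegral_add_left measurable_const, lintegral_const, measure_univ, mul_one,
    lintegral_indicator_const hA]
  gcongr

theorem IsUniformSequence.upperIntegralLE_poissonFunctional (hW : IsUniformSequence W μ) {K : ℕ}
    (hK : 0 < K) :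
    UpperIntegralLE μ (fun ω => (poissonFunctional K (recordProcess (fun k => W k ω) K) : ℝ≥0∞))
      (4 * K) := by
  have hm := hW.measurable_ageTime K
  refine ⟨fun ω => ageTime (fun k => W k ω) K, by fun_prop, ?_, hW.lintegral_ageTime_le hK⟩
  filter_upwards [hW.ae_poissonFunctional_le hK] with ω hω
  exact_mod_cast hω.1

end Assembly

/-! ### Choice of the error parameters -/

section Parameters

/-- A small exponent. -/
def errorExponent (α : ℝ) : ℝ := α * (1 - α) / 10

/-- The order of magnitude of the fluctuations of the degrees. -/
def degreeError (α x : ℝ) : ℝ := x ^ ((1 - α) / 2 + 2 * errorExponent α)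

/-- A bound for the codegrees. -/
def codegreeBound (lam α x : ℝ) : ℝ := 2 * x * (lam * x ^ (-α)) ^ 2 + x ^ errorExponent α

/-- The error made at each visit of a vertex. -/
def visitErrorBound (lam α : ℝ) (n : ℕ) : ℝ :=
  visitError n (lam * (n : ℝ) ^ (-α)) (degreeError α n) (codegreeBound lam α n)
    ((n : ℝ) ^ errorExponent α)

/-- A bound for the probability of atypical behaviour. -/
def atypicalBound (lam α x : ℝ) : ℝ :=
  (2 * Real.exp (lam + 1) + 4) * ((x + 1) ^ 2 * Real.exp (-(1 / 3) * x ^ errorExponent α))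

variable {lam α : ℝ}

theorem errorExponent_bounds (hα0 : 0 < α) (hα1 : α < 1) :
    0 < errorExponent α ∧ 10 * errorExponent α ≤ α ∧ 10 * errorExponent α ≤ 1 - α := by
  unfold errorExponent
  refine ⟨by have := mul_pos hα0 (sub_pos.2 hα1); linarith, ?_, ?_⟩ <;> nlinarith

theorem degreeError_le (hα0 : 0 < α) (hα1 : α < 1) {x : ℝ} (hx : 1 ≤ x) :
    degreeError α x ≤ x ^ (1 - α - 2 * errorExponent α) := by
  obtain ⟨h1, h2, h3⟩ := errorExponent_bounds hα0 hα1
  exact Real.rpow_le_rpow_of_exponent_le hx (by linarith)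

/-- Write `δ` for `errorExponent α`; up to `M = n^δ` records are allowed. The degrees give the
exponent `(1 - α) / 2 + 2 δ` and the codegrees `δ + 1 - 2 α` and `2 δ`; all are at most `1 - α - 2
δ`, since `10 δ` is at most `α` and at most `1 - α`. The margin `2 δ` leaves room for a further
multiplication by `M`. -/
theorem visitErrorBound_le (hlam : 0 < lam) (hα0 : 0 < α) (hα1 : α < 1) {n : ℕ} (hn : 1 ≤ n) :
    visitErrorBound lam α n ≤ (3 + 3 * lam ^ 2 + 2 * lam) *
      (n : ℝ) ^ (1 - α - 2 * errorExponent α) := by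
  obtain ⟨h1, h2, h3⟩ := errorExponent_bounds hα0 hα1
  have hx : (1 : ℝ) ≤ n := by exact_mod_cast hn
  have hz := degreeError_le hα0 hα1 hx
  unfold visitErrorBound visitError codegreeBound
  set δ := errorExponent α
  set x : ℝ := (n : ℝ)
  have hx0 : 0 < x := by linarith
  set T := x ^ (1 - α - 2 * δ)
  set z := degreeError α x with hzdef
  set y := x ^ δ with hy
  set u := x ^ (-α) with hu
  have hle : ∀ e, e ≤ 1 - α - 2 * δ → x ^ e ≤ T := fun e he =>
    Real.rpow_le_rpow_of_exponent_le hx he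
  have f2 : y * (x * u * u) ≤ T := by
    have : y * (x * u * u) = x ^ (δ + (1 + -α + -α)) := by
      rw [Real.rpow_add hx0, Real.rpow_add hx0, Real.rpow_add hx0, Real.rpow_one]
    rw [this]
    exact hle _ (by linarith)
  have f3 : y * y ≤ T := by
    rw [hy, ← Real.rpow_add hx0]
    exact hle _ (by linarith)
  have f4 : 1 ≤ T := Real.one_le_rpow hx (by linarith)
  have f5 : u ≤ T := hle _ (by linarith)
  have f6 : u * y * z ≤ T := by
    rw [hu, hy, hzdef, degreeError, ← Real.rpow_add hx0, ← Real.rpow_add hx0]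
    exact hle _ (by linarith)
  have e : z + (y * (2 * x * (lam * u) ^ 2 + y) + 1) + lam * u * (1 + y * (lam * u * x + z))
      = z + 3 * lam ^ 2 * (y * (x * u * u)) + y * y + 1 + lam * u + lam * (u * y * z) := by ring
  rw [e]
  have g2 := mul_le_mul_of_nonneg_left f2 (by positivity : 0 ≤ 3 * lam ^ 2)
  have g5 := mul_le_mul_of_nonneg_left f5 hlam.le
  have g6 := mul_le_mul_of_nonneg_left f6 hlam.le
  linarith

variable {Ω : Type*} [MeasurableSpace Ω] {μ : Measure Ω} [IsProbabilityMeasure μ] {W : ℕ → Ω → ℝ}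

theorem measure_not_isPseudoRandom_le {n : ℕ} {G : Ω → SimpleGraph (Fin n)} (hlam : 0 < lam)
    (hα0 : 0 < α) (hα1 : α < 1) (hn : 1 ≤ n) (hGm : Measurable G)
    (hG : HasLaw G (SimpleGraph.binomialRandom (Fin n)
      (Set.projIcc 0 1 zero_le_one (lam * (n : ℝ) ^ (-α)))) μ)
    (hp : lam * (n : ℝ) ^ (-α) ≤ 1) :
    μ.real {ω | ¬ IsPseudoRandom (G ω) (lam * (n : ℝ) ^ (-α)) (degreeError α n)
      (codegreeBound lam α n)}
    ≤ (2 * Real.exp (lam + 1) + 1) * (((n : ℝ) + 1) ^ 2 *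
      Real.exp (-(1 / 3) * (n : ℝ) ^ errorExponent α)) := by
  obtain ⟨h1, h2, h3⟩ := errorExponent_bounds hα0 hα1
  have hx : (1 : ℝ) ≤ n := by exact_mod_cast hn
  have hx0 : (0 : ℝ) < n := by linarith
  have hpc : ((Set.projIcc 0 1 zero_le_one (lam * (n : ℝ) ^ (-α)) : unitInterval) : ℝ)
      = lam * (n : ℝ) ^ (-α) := by
    rw [Set.projIcc_of_mem zero_le_one ⟨by positivity, hp⟩]
  -- This `θ` makes `p n θ ^ 2` equal to `λ`, while `θ` times the degree error is still `n ^ (2 *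
  -- errorExponent α)`.
  have h := measureReal_not_isPseudoRandom_le hGm hG (θ := (n : ℝ) ^ (-((1 - α) / 2)))
    (by positivity) (Real.rpow_le_one_of_one_le_of_nonpos hx (by linarith)) (degreeError α n)
    (codegreeBound lam α n)
  rw [hpc] at h
  refine h.trans ?_
  have e1 : lam * (n : ℝ) ^ (-α) * n * ((n : ℝ) ^ (-((1 - α) / 2))) ^ 2 = lam := by
    have : (n : ℝ) ^ (-α) * n * ((n : ℝ) ^ (-((1 - α) / 2))) ^ 2 = 1 := by
      have e : (n : ℝ) ^ (-α + 1 + (-((1 - α) / 2) + -((1 - α) / 2)))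
          = (n : ℝ) ^ (-α) * n * ((n : ℝ) ^ (-((1 - α) / 2))) ^ 2 := by
        rw [Real.rpow_add hx0, Real.rpow_add hx0, Real.rpow_add hx0, Real.rpow_one, pow_two]
      rw [← e, show -α + 1 + (-((1 - α) / 2) + -((1 - α) / 2)) = 0 by ring, Real.rpow_zero]
    linear_combination lam * this
  have e2 : (n : ℝ) ^ (-((1 - α) / 2)) * degreeError α n = (n : ℝ) ^ (2 * errorExponent α) := by
    rw [degreeError, ← Real.rpow_add hx0]
    congr 1
    ring
  have e3 : (n : ℝ) ^ errorExponent α ≤ (n : ℝ) ^ (2 * errorExponent α) :=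
    Real.rpow_le_rpow_of_exponent_le hx (by linarith)
  have e4 : 0 ≤ (n : ℝ) ^ errorExponent α := by positivity
  have e5 : (n : ℝ) ^ (-((1 - α) / 2)) ≤ 1 :=
    Real.rpow_le_one_of_one_le_of_nonpos hx (by linarith)
  have b1 : Real.exp (lam * (n : ℝ) ^ (-α) * n * ((n : ℝ) ^ (-((1 - α) / 2))) ^ 2
      - (n : ℝ) ^ (-((1 - α) / 2)) * (degreeError α n - 1))
      ≤ Real.exp (lam + 1) * Real.exp (-(1 / 3) * (n : ℝ) ^ errorExponent α) := by
    rw [← Real.exp_add, Real.exp_le_exp, e1, mul_sub, e2]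
    linarith
  have b2 : Real.exp (2 * n * (lam * (n : ℝ) ^ (-α)) ^ 2 - codegreeBound lam α n)
      ≤ Real.exp (-(1 / 3) * (n : ℝ) ^ errorExponent α) := by
    rw [Real.exp_le_exp, codegreeBound]
    linarith
  calc _ ≤ (n : ℝ) * (n + 1) * (2 * (Real.exp (lam + 1) *
        Real.exp (-(1 / 3) * (n : ℝ) ^ errorExponent α)))
        + n * n * Real.exp (-(1 / 3) * (n : ℝ) ^ errorExponent α) := by gcongr
    _ ≤ ((n : ℝ) + 1) ^ 2 * (2 * (Real.exp (lam + 1) *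
        Real.exp (-(1 / 3) * (n : ℝ) ^ errorExponent α)))
        + ((n : ℝ) + 1) ^ 2 * Real.exp (-(1 / 3) * (n : ℝ) ^ errorExponent α) := by
      gcongr <;> nlinarith
    _ = _ := by ring

/-- With `y = n ^ errorExponent α` and `ε = exp (-y / 3)`, both terms of the tail bound are of order
`exp (-y / 3)` up to powers of `n`, because `log 2 > 2 / 3`. Rounding `y` down costs a factor `2`.
-/
theorem IsUniformSequence.measure_rpow_lt_recordCount_le (hW : IsUniformSequence W μ) (n : ℕ) :
    μ {ω | (n : ℝ) ^ errorExponent α < recordCount (fun k => W k ω) n}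
      ≤ ENNReal.ofReal (3 * (((n : ℝ) + 1) ^ 2 *
        Real.exp (-(1 / 3) * (n : ℝ) ^ errorExponent α))) := by
  set y : ℝ := (n : ℝ) ^ errorExponent α
  have hy : 0 ≤ y := by positivity
  have h := hW.measure_lt_recordCount_le n ⌊y⌋₊ (Real.exp_pos (-(1 / 3) * y))
  have hsub : {ω | y < recordCount (fun k => W k ω) n}
      ⊆ {ω | ⌊y⌋₊ < recordCount (fun k => W k ω) n} := fun ω hω => (Nat.floor_lt hy).2 hω
  refine (measure_mono hsub).trans (h.trans ?_)
  have h2 : 1 / (2 ^ ⌊y⌋₊ * Real.exp (-(1 / 3) * y)) ≤ 2 * Real.exp (-(1 / 3) * y) := by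
    have e : (2 : ℝ) = Real.exp (Real.log 2) := (Real.exp_log two_pos).symm
    have hl := Real.log_two_gt_d9
    have hf := Nat.lt_floor_add_one y
    have hm : 2 / 3 * ((⌊y⌋₊ : ℝ) + 1) ≤ Real.log 2 * (⌊y⌋₊ + 1) := by
      gcongr
      linarith
    rw [one_div, e, ← Real.exp_nat_mul, ← Real.exp_add, ← Real.exp_add, ← Real.exp_neg,
      Real.exp_le_exp]
    linarith
  have h3 : ((n : ℝ≥0∞) + 1) = ENNReal.ofReal (n + 1) := by
    rw [ENNReal.ofReal_add (by positivity) zero_le_one]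
    simp
  rw [h3, ← ENNReal.ofReal_mul (by positivity), ← ENNReal.ofReal_add (by positivity)
    (by positivity)]
  refine ENNReal.ofReal_le_ofReal ?_
  have h4 : (1 : ℝ) ≤ n + 1 := by linarith [Nat.cast_nonneg (α := ℝ) n]
  have h5 : ((n : ℝ) + 1) ≤ (n + 1) ^ 2 := by nlinarith
  have h6 := mul_le_mul_of_nonneg_right h5 (Real.exp_pos (-(1 / 3) * y)).le
  have h7 := mul_le_mul_of_nonneg_right (h4.trans h5) (Real.exp_pos (-(1 / 3) * y)).le
  linarith

theorem IsUniformSequence.measure_atypical_le (hW : IsUniformSequence W μ) {n : ℕ}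
    {G : Ω → SimpleGraph (Fin n)} (hlam : 0 < lam) (hα0 : 0 < α) (hα1 : α < 1) (hn : 1 ≤ n)
    (hGm : Measurable G) (hG : HasLaw G (SimpleGraph.binomialRandom (Fin n)
      (Set.projIcc 0 1 zero_le_one (lam * (n : ℝ) ^ (-α)))) μ)
    (hp : lam * (n : ℝ) ^ (-α) ≤ 1) :
    μ {ω | ¬ IsPseudoRandom (G ω) (lam * (n : ℝ) ^ (-α)) (degreeError α n)
      (codegreeBound lam α n) ∨ (n : ℝ) ^ errorExponent α < recordCount (fun k => W k ω) n}
    ≤ ENNReal.ofReal (atypicalBound lam α n) := by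
  refine (measure_union_le _ _).trans ?_
  have h1 := measure_not_isPseudoRandom_le hlam hα0 hα1 hn hGm hG hp
  rw [measureReal_def] at h1
  have h2 := ENNReal.ofReal_le_ofReal h1
  rw [ENNReal.ofReal_toReal (measure_ne_top _ _)] at h2
  refine (add_le_add h2 (hW.measure_rpow_lt_recordCount_le (α := α) n)).trans ?_
  rw [← ENNReal.ofReal_add (by positivity) (by positivity)]
  refine ENNReal.ofReal_le_ofReal (le_of_eq ?_)
  rw [atypicalBound]
  ring

end Parameters

/-! ### Asymptotics of the parameters -/

section Limits

variable {lam α β : ℝ}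

theorem tendsto_pnat_cast : Tendsto (fun n : ℕ+ => ((n : ℕ) : ℝ)) atTop atTop :=
  tendsto_natCast_atTop_atTop.comp tendsto_PNat_val_atTop_atTop

theorem tendsto_pnat_rpow {a : ℝ} (ha : 0 < a) :
    Tendsto (fun n : ℕ+ => ((n : ℕ) : ℝ) ^ a) atTop atTop :=
  (tendsto_rpow_atTop ha).comp tendsto_pnat_cast

theorem one_le_pnat_cast (n : ℕ+) : (1 : ℝ) ≤ ((n : ℕ) : ℝ) := by exact_mod_cast n.pos

theorem degreeError_nonneg (α : ℝ) {x : ℝ} (hx : 0 ≤ x) : 0 ≤ degreeError α x := by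
  unfold degreeError; positivity

theorem codegreeBound_nonneg (lam α : ℝ) {x : ℝ} (hx : 0 ≤ x) : 0 ≤ codegreeBound lam α x := by
  unfold codegreeBound; positivity

theorem visitErrorBound_nonneg (hlam : 0 < lam) (α : ℝ) (n : ℕ) : 0 ≤ visitErrorBound lam α n := by
  have h1 := degreeError_nonneg α (Nat.cast_nonneg (α := ℝ) n)
  have h2 := codegreeBound_nonneg lam α (Nat.cast_nonneg (α := ℝ) n)
  unfold visitErrorBound visitError
  positivity

/-- The time estimate accumulates one visit error for each of up to `n ^ errorExponent α` visits;
the total must remain negligible against `n^{1-α}`. -/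
theorem tendsto_mul_visitErrorBound_div (hlam : 0 < lam) (hα0 : 0 < α) (hα1 : α < 1) :
    Tendsto (fun n : ℕ+ => ((n : ℕ) : ℝ) ^ errorExponent α * visitErrorBound lam α n
      / ((n : ℕ) : ℝ) ^ (1 - α)) atTop (𝓝 0) := by
  obtain ⟨h1, -, -⟩ := errorExponent_bounds hα0 hα1
  have hlim := ((tendsto_rpow_neg_atTop h1).comp tendsto_pnat_cast).const_mul
    (3 + 3 * lam ^ 2 + 2 * lam)
  rw [mul_zero] at hlim
  refine squeeze_zero (fun n => ?_) (fun n => ?_) hlim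
  · have := visitErrorBound_nonneg hlam α n
    positivity
  · have hn0 : (0 : ℝ) < ((n : ℕ) : ℝ) := by linarith [one_le_pnat_cast n]
    rw [div_le_iff₀ (by positivity)]
    have h2 := mul_le_mul_of_nonneg_left (visitErrorBound_le hlam hα0 hα1 (n := (n : ℕ)) n.pos)
      (by positivity : 0 ≤ ((n : ℕ) : ℝ) ^ errorExponent α)
    refine h2.trans (le_of_eq ?_)
    simp only [Function.comp_apply]
    have e : ((n : ℕ) : ℝ) ^ errorExponent α * ((n : ℕ) : ℝ) ^ (1 - α - 2 * errorExponent α)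
        = ((n : ℕ) : ℝ) ^ (-errorExponent α) * ((n : ℕ) : ℝ) ^ (1 - α) := by
      rw [← Real.rpow_add hn0, ← Real.rpow_add hn0]
      congr 1
      ring
    linear_combination (3 + 3 * lam ^ 2 + 2 * lam) * e

theorem tendsto_visitErrorBound_div (hlam : 0 < lam) (hα0 : 0 < α) (hα1 : α < 1) :
    Tendsto (fun n : ℕ+ => visitErrorBound lam α n / ((n : ℕ) : ℝ) ^ (1 - α)) atTop (𝓝 0) := by
  obtain ⟨h1, -, -⟩ := errorExponent_bounds hα0 hα1
  refine squeeze_zero (fun n => ?_) (fun n => ?_) (tendsto_mul_visitErrorBound_div hlam hα0 hα1)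
  · have := visitErrorBound_nonneg hlam α n
    positivity
  · gcongr
    exact le_mul_of_one_le_left (visitErrorBound_nonneg hlam α n)
      (Real.one_le_rpow (one_le_pnat_cast n) h1.le)

theorem tendsto_rpow_errorExponent_div (hα0 : 0 < α) (hα1 : α < 1) :
    Tendsto (fun n : ℕ+ => ((n : ℕ) : ℝ) ^ errorExponent α / ((n : ℕ) : ℝ) ^ (1 - α)) atTop
      (𝓝 0) := by
  obtain ⟨h1, h2, h3⟩ := errorExponent_bounds hα0 hα1
  refine ((tendsto_rpow_neg_atTop (y := 1 - α - errorExponent α) (by linarith)).comp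
    tendsto_pnat_cast).congr fun n => ?_
  have hn0 : (0 : ℝ) < ((n : ℕ) : ℝ) := by linarith [one_le_pnat_cast n]
  rw [Function.comp_apply, ← Real.rpow_sub hn0]
  congr 1
  ring

theorem tendsto_degreeError_div (hα0 : 0 < α) (hα1 : α < 1) :
    Tendsto (fun n : ℕ+ => degreeError α (n : ℕ) / ((n : ℕ) : ℝ) ^ (1 - α)) atTop (𝓝 0) := by
  obtain ⟨h1, h2, h3⟩ := errorExponent_bounds hα0 hα1
  refine ((tendsto_rpow_neg_atTop (y := (1 - α) / 2 - 2 * errorExponent α) (by linarith)).comp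
    tendsto_pnat_cast).congr fun n => ?_
  have hn0 : (0 : ℝ) < ((n : ℕ) : ℝ) := by linarith [one_le_pnat_cast n]
  rw [Function.comp_apply, degreeError, ← Real.rpow_sub hn0]
  congr 1
  ring

theorem atypicalBound_nonneg (lam α x : ℝ) : 0 ≤ atypicalBound lam α x := by
  unfold atypicalBound
  positivity

/-- The factor `(n + 1) ^ 2` absorbs the crude bound on the running time. In the variable `y = n ^
errorExponent α` every power of `n` is a power of `y`, which `exp (-y / 3)` beats. -/
theorem tendsto_mul_atypicalBound (hα0 : 0 < α) (hα1 : α < 1) :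
    Tendsto (fun n : ℕ+ => (((n : ℕ) : ℝ) + 1) ^ 2 * atypicalBound lam α (n : ℕ)) atTop
      (𝓝 0) := by
  obtain ⟨h1, -, -⟩ := errorExponent_bounds hα0 hα1
  have hlim := ((tendsto_rpow_mul_exp_neg_mul_atTop_nhds_zero (4 / errorExponent α) (1 / 3)
    (by norm_num)).comp (tendsto_pnat_rpow h1)).const_mul
    ((2 * Real.exp (lam + 1) + 4) * 16)
  rw [mul_zero] at hlim
  refine squeeze_zero (fun n => ?_) (fun n => ?_) hlim
  · have := atypicalBound_nonneg lam α (n : ℕ)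
    positivity
  · have hn := one_le_pnat_cast n
    simp only [Function.comp_apply]
    rw [← Real.rpow_mul (by linarith), mul_div_cancel₀ _ h1.ne', atypicalBound,
      show (4 : ℝ) = ((4 : ℕ) : ℝ) by norm_num, Real.rpow_natCast]
    have h2 : (((n : ℕ) : ℝ) + 1) ^ 4 ≤ 16 * ((n : ℕ) : ℝ) ^ 4 := by
      calc (((n : ℕ) : ℝ) + 1) ^ 4 ≤ (2 * ((n : ℕ) : ℝ)) ^ 4 := by gcongr; linarith
        _ = _ := by ring
    have h3 := mul_le_mul_of_nonneg_left h2 (by positivity :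
      0 ≤ (2 * Real.exp (lam + 1) + 4) * Real.exp (-(1 / 3) * ((n : ℕ) : ℝ) ^ errorExponent α))
    push_cast
    linarith

theorem tendsto_density_mul_blockSize (hlam : 0 < lam) (hβ : 0 < β) {B : ℕ+ → ℕ}
    (hB : Tendsto (fun n : ℕ+ => (B n : ℝ) / (β * ((n : ℕ) : ℝ) ^ α / lam)) atTop (𝓝 1)) :
    Tendsto (fun n : ℕ+ => lam * ((n : ℕ) : ℝ) ^ (-α) * B n) atTop (𝓝 β) := by
  have h := hB.const_mul β
  rw [mul_one] at h
  refine h.congr fun n => ?_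
  have hn0 : (0 : ℝ) < ((n : ℕ) : ℝ) := by linarith [one_le_pnat_cast n]
  have h2 : (0 : ℝ) < ((n : ℕ) : ℝ) ^ α := by positivity
  rw [Real.rpow_neg hn0.le]
  field_simp

theorem density_mul_card (lam α : ℝ) (n : ℕ+) :
    lam * ((n : ℕ) : ℝ) ^ (-α) * ((n : ℕ) : ℝ) = lam * ((n : ℕ) : ℝ) ^ (1 - α) := by
  have hn0 : (0 : ℝ) < ((n : ℕ) : ℝ) := by linarith [one_le_pnat_cast n]
  rw [show 1 - α = -α + 1 by ring, Real.rpow_add hn0, Real.rpow_one, mul_assoc]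

variable {ι : Type*} {l : Filter ι} {m V η b : ι → ℝ}

theorem tendsto_floor_sub_div (hlam : 0 < lam) (hm : Tendsto m l atTop) (hV0 : ∀ i, 0 ≤ V i)
    (hV : Tendsto (fun i => V i / m i) l (𝓝 0)) :
    Tendsto (fun i => (⌊lam * m i - 2 * V i⌋₊ : ℝ) / m i) l (𝓝 lam) := by
  have h1 : Tendsto (fun i => lam - 2 * (V i / m i) - (m i)⁻¹) l (𝓝 lam) := by
    simpa using (tendsto_const_nhds.sub (hV.const_mul 2)).sub hm.inv_tendsto_atTop
  refine tendsto_of_tendsto_of_tendsto_of_le_of_le' h1 tendsto_const_nhds ?_ ?_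
  · filter_upwards [hm.eventually_gt_atTop 0] with i hi
    rw [le_div_iff₀ hi]
    have e : (lam - 2 * (V i / m i) - (m i)⁻¹) * m i = lam * m i - 2 * V i - 1 := by
      field_simp
    rw [e]
    linarith [Nat.lt_floor_add_one (lam * m i - 2 * V i)]
  · filter_upwards [hm.eventually_gt_atTop 0] with i hi
    rw [div_le_iff₀ hi]
    have h2 : (⌊lam * m i - 2 * V i⌋₊ : ℝ) ≤ ⌊lam * m i⌋₊ :=
      Nat.cast_le.2 (Nat.floor_mono (by linarith [hV0 i]))
    exact h2.trans (Nat.floor_le (by positivity))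

theorem tendsto_ceil_add_div (hlam : 0 < lam) (hm : Tendsto m l atTop) (hV0 : ∀ i, 0 ≤ V i)
    (hη0 : ∀ i, 0 ≤ η i) (hb0 : ∀ i, 0 ≤ b i)
    (hV : Tendsto (fun i => V i / m i) l (𝓝 0)) (hη : Tendsto (fun i => η i / m i) l (𝓝 0))
    (hb : Tendsto b l (𝓝 β)) :
    Tendsto (fun i => (⌈b i + 2 * V i + (lam * m i + η i) + 1⌉₊ : ℝ) / m i) l (𝓝 lam) := by
  have hb' : Tendsto (fun i => b i * (m i)⁻¹) l (𝓝 0) := by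
    simpa using hb.mul hm.inv_tendsto_atTop
  have h1 : Tendsto (fun i => b i * (m i)⁻¹ + 2 * (V i / m i) + (lam + η i / m i) + 2 * (m i)⁻¹) l
      (𝓝 lam) := by
    simpa using ((hb'.add (hV.const_mul 2)).add (tendsto_const_nhds.add hη)).add
      (hm.inv_tendsto_atTop.const_mul 2)
  refine tendsto_of_tendsto_of_tendsto_of_le_of_le' tendsto_const_nhds h1 ?_ ?_
  · filter_upwards [hm.eventually_gt_atTop 0] with i hi
    rw [le_div_iff₀ hi]
    linarith [Nat.le_ceil (b i + 2 * V i + (lam * m i + η i) + 1), hV0 i, hη0 i, hb0 i]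
  · filter_upwards [hm.eventually_gt_atTop 0] with i hi
    rw [div_le_iff₀ hi]
    have e : (b i * (m i)⁻¹ + 2 * (V i / m i) + (lam + η i / m i) + 2 * (m i)⁻¹) * m i
        = b i + 2 * V i + (lam * m i + η i) + 1 + 1 := by
      field_simp
      ring
    rw [e]
    have h2 := hV0 i
    have h3 := hη0 i
    have h4 := hb0 i
    exact (Nat.ceil_lt_add_one (by positivity)).le

end Limits

/-! ### Vanishing of the mean errors -/

section MainLimits

variable {lam α β : ℝ} {Ω : Type*} [MeasurableSpace Ω] {μ : Measure Ω}
  {B : ℕ+ → ℕ} {G : (n : ℕ+) → Ω → SimpleGraph (Fin n)} {v : (n : ℕ+) → Ω → Fin n}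
  {c : (n : ℕ+) → Ω → Fin n → ℝ} {W : ℕ → Ω → ℝ}

theorem tendsto_ofReal_zero {ι : Type*} {l : Filter ι} {f : ι → ℝ} (hf : Tendsto f l (𝓝 0)) :
    Tendsto (fun i => ENNReal.ofReal (f i)) l (𝓝 0) := by
  simpa using ENNReal.tendsto_ofReal hf

theorem ofReal_inv_mul_ofReal {m x : ℝ} (hm : 0 ≤ m) :
    ENNReal.ofReal m⁻¹ * ENNReal.ofReal x = ENNReal.ofReal (x / m) := by
  rw [← ENNReal.ofReal_mul (inv_nonneg.2 hm), mul_comm, div_eq_mul_inv]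

theorem ofReal_inv_mul_natCast {m : ℝ} (hm : 0 ≤ m) (k : ℕ) :
    ENNReal.ofReal m⁻¹ * k = ENNReal.ofReal (k / m) := by
  rw [← ENNReal.ofReal_natCast, ofReal_inv_mul_ofReal hm]

theorem UpperIntegralLE.ofReal_div {f : Ω → ℝ} {b : ℝ≥0∞}
    (h : UpperIntegralLE μ (fun ω => ENNReal.ofReal (f ω)) b) {m : ℝ} (hm : 0 ≤ m) :
    UpperIntegralLE μ (fun ω => ENNReal.ofReal (f ω / m)) (ENNReal.ofReal m⁻¹ * b) :=
  (h.const_mul (ENNReal.ofReal m⁻¹)).mono fun _ => (ofReal_inv_mul_ofReal hm).ge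

theorem eventually_density_le_one (lam : ℝ) (hα0 : 0 < α) :
    ∀ᶠ n : ℕ+ in atTop, lam * ((n : ℕ) : ℝ) ^ (-α) ≤ 1 := by
  have h := ((tendsto_rpow_neg_atTop hα0).comp tendsto_pnat_cast).const_mul lam
  rw [mul_zero] at h
  exact h.eventually_le_const one_pos

theorem eventually_blockSize_pos (hlam : 0 < lam) (hβ : 0 < β)
    (hB : Tendsto (fun n : ℕ+ => (B n : ℝ) / (β * ((n : ℕ) : ℝ) ^ α / lam)) atTop (𝓝 1)) :
    ∀ᶠ n : ℕ+ in atTop, 0 < B n := by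
  filter_upwards [(tendsto_density_mul_blockSize hlam hβ hB).eventually_const_lt hβ] with n hn
  refine Nat.pos_of_ne_zero fun h => ?_
  rw [h] at hn
  simp at hn

theorem tendsto_floorMeanDegree_div (hlam : 0 < lam) (hα1 : α < 1) :
    Tendsto (fun n : ℕ+ => (floorMeanDegree lam α n : ℝ) / ((n : ℕ) : ℝ) ^ (1 - α)) atTop
      (𝓝 lam) :=
  (tendsto_nat_floor_mul_div_atTop hlam.le).comp (tendsto_pnat_rpow (sub_pos.2 hα1))

variable [IsProbabilityMeasure μ]

theorem exists_upperIntegralLE_agdTotalExplored_sub (hlam : 0 < lam) (hα0 : 0 < α) (hα1 : α < 1)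
    (hβ : 0 < β)
    (hB : Tendsto (fun n : ℕ+ => (B n : ℝ) / (β * ((n : ℕ) : ℝ) ^ α / lam)) atTop (𝓝 1))
    (hGm : ∀ n, Measurable (G n))
    (hG : ∀ n : ℕ+, HasLaw (G n) (SimpleGraph.binomialRandom (Fin n)
      (Set.projIcc 0 1 zero_le_one (lam * ((n : ℕ) : ℝ) ^ (-α)))) μ)
    (hW : IsUniformSequence W μ)
    (hcW : ∀ n, ∀ᵐ ω ∂μ, AGDCostsDrawnFrom (G n ω) (c n ω) (v n ω) (B n) (fun k => W k ω)) :
    ∃ b : ℕ+ → ℝ≥0∞, Tendsto b atTop (𝓝 0) ∧ ∀ᶠ n : ℕ+ in atTop,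
      UpperIntegralLE μ (fun ω => ENNReal.ofReal
        (|(agdTotalExplored (G n ω) (c n ω) (v n ω) (B n) : ℝ)
          - (poissonFunctional (floorMeanDegree lam α n)
              (recordProcess (fun k => W k ω) (floorMeanDegree lam α n)) : ℝ)|
            / ((n : ℕ) : ℝ) ^ (1 - α))) (b n) := by
  set m : ℕ+ → ℝ := fun n => ((n : ℕ) : ℝ) ^ (1 - α) with hmdef
  set V : ℕ+ → ℝ := fun n => visitErrorBound lam α n with hVdef
  set η : ℕ+ → ℝ := fun n => degreeError α (n : ℕ) with hηdef
  set r : ℕ+ → ℝ := fun n => lam * ((n : ℕ) : ℝ) ^ (-α) * B n with hrdef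
  set Q : ℕ+ → ℝ := fun n => atypicalBound lam α (n : ℕ) with hQdef
  -- `D` and `R = D + d` are the levels provided by `agd_estimates`, the `+ 1` in `R` giving the
  -- strict inequality. They enclose `K`, and both are `λ n^{1-α}` to first order.
  set D : ℕ+ → ℕ := fun n => ⌊lam * m n - 2 * V n⌋₊ with hDdef
  set R : ℕ+ → ℕ := fun n => ⌈r n + 2 * V n + (lam * m n + η n) + 1⌉₊ with hRdef
  have hm : Tendsto m atTop atTop := tendsto_pnat_rpow (sub_pos.2 hα1)
  have hm0 : ∀ n, 0 ≤ m n := fun n => by positivity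
  have hV0 : ∀ n, 0 ≤ V n := fun n => visitErrorBound_nonneg hlam α n
  have hη0 : ∀ n, 0 ≤ η n := fun n => degreeError_nonneg α (Nat.cast_nonneg _)
  have hr0 : ∀ n, 0 ≤ r n := fun n => by positivity
  have hV := tendsto_visitErrorBound_div hlam hα0 hα1
  have hη := tendsto_degreeError_div hα0 hα1
  have hr := tendsto_density_mul_blockSize hlam hβ hB
  have hD : Tendsto (fun n => (D n : ℝ) / m n) atTop (𝓝 lam) :=
    tendsto_floor_sub_div hlam hm hV0 hV
  have hR : Tendsto (fun n => (R n : ℝ) / m n) atTop (𝓝 lam) :=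
    tendsto_ceil_add_div hlam hm hV0 hη0 hr0 hV hη hr
  have hDK : ∀ n, D n ≤ floorMeanDegree lam α n := fun n =>
    Nat.floor_mono (by linarith [hV0 n])
  have hKR : ∀ n : ℕ+, floorMeanDegree lam α n ≤ R n := fun n =>
    (Nat.floor_le_ceil _).trans (Nat.ceil_mono (by linarith [hV0 n, hη0 n, hr0 n]))
  have hd : Tendsto (fun n => ((R n - D n : ℕ) : ℝ) / m n) atTop (𝓝 0) := by
    have := hR.sub hD
    rw [sub_self] at this
    refine this.congr fun n => ?_
    rw [Nat.cast_sub ((hDK n).trans (hKR n)), sub_div]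
  -- This quotient bounds the probability that some record has a duration between the two levels.
  have hdD : Tendsto (fun n => ((R n - D n : ℕ) : ℝ) / (D n + 1)) atTop (𝓝 0) := by
    have h1 : Tendsto (fun n => (D n : ℝ) / m n + (m n)⁻¹) atTop (𝓝 lam) := by
      simpa using hD.add hm.inv_tendsto_atTop
    have := hd.div h1 hlam.ne'
    rw [zero_div] at this
    refine this.congr' ?_
    filter_upwards [hm.eventually_gt_atTop 0] with n hn
    rw [Pi.div_apply]
    field_simp
  have hQ : Tendsto Q atTop (𝓝 0) := by
    refine squeeze_zero (fun n => atypicalBound_nonneg lam α _) (fun n => ?_)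
      (tendsto_mul_atypicalBound (lam := lam) hα0 hα1)
    refine le_mul_of_one_le_left (atypicalBound_nonneg lam α _) (one_le_pow₀ ?_)
    linarith [one_le_pnat_cast n]
  have hnQ : Tendsto (fun n : ℕ+ => ((n : ℕ) : ℝ) * Q n / m n) atTop (𝓝 0) := by
    have h1 := (tendsto_mul_atypicalBound (lam := lam) hα0 hα1).mul hm.inv_tendsto_atTop
    rw [mul_zero] at h1
    refine squeeze_zero (fun n => ?_) (fun n => ?_) h1
    · have := atypicalBound_nonneg lam α (n : ℕ)
      positivity
    · rw [div_eq_mul_inv]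
      refine mul_le_mul_of_nonneg_right (mul_le_mul_of_nonneg_right ?_
        (atypicalBound_nonneg lam α _)) (inv_nonneg.2 (hm0 n))
      nlinarith [one_le_pnat_cast n]
  have hτ1 := tendsto_tsum_min_pow.comp (tendsto_ofReal_zero hdD)
  have hτ2 := tendsto_tsum_min_pow.comp (tendsto_ofReal_zero hQ)
  refine ⟨fun n => ENNReal.ofReal (((R n - D n : ℕ) : ℝ) / m n)
      + 2 * ENNReal.ofReal (R n / m n) * ∑' k : ℕ,
        min (ENNReal.ofReal (((R n - D n : ℕ) : ℝ) / (D n + 1))) ((1 / 2) ^ k)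
      + (ENNReal.ofReal (m n)⁻¹ + (ENNReal.ofReal (((n : ℕ) : ℝ) * Q n / m n)
        + 2 * ENNReal.ofReal (floorMeanDegree lam α n / m n) * ∑' k : ℕ,
          min (ENNReal.ofReal (Q n)) ((1 / 2) ^ k))), ?_, ?_⟩
  · have hR' := ENNReal.Tendsto.mul (ENNReal.Tendsto.const_mul (a := 2)
      (ENNReal.tendsto_ofReal hR) (Or.inr (by simp))) (Or.inr (by simp)) hτ1
      (Or.inr (ENNReal.mul_ne_top (by simp) ENNReal.ofReal_ne_top))
    have hK' := ENNReal.Tendsto.mul (ENNReal.Tendsto.const_mul (a := 2)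
      (ENNReal.tendsto_ofReal (tendsto_floorMeanDegree_div hlam hα1)) (Or.inr (by simp)))
      (Or.inr (by simp)) hτ2
      (Or.inr (ENNReal.mul_ne_top (by simp) ENNReal.ofReal_ne_top))
    have := ((tendsto_ofReal_zero hd).add hR').add
      ((tendsto_ofReal_zero hm.inv_tendsto_atTop).add ((tendsto_ofReal_zero hnQ).add hK'))
    simpa using this
  · filter_upwards [hD.eventually_const_lt hlam, eventually_density_le_one lam hα0,
      eventually_blockSize_pos hlam hβ hB] with n hn1 hn2 hn3
    have hx : (0 : ℝ) ≤ ((n : ℕ) : ℝ) := Nat.cast_nonneg _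
    have hD0 : 0 < D n := Nat.pos_of_ne_zero fun h => by simp [h] at hn1
    have hdR : D n + (R n - D n) = R n := Nat.add_sub_cancel' ((hDK n).trans (hKR n))
    have hpos : 0 ≤ lam * m n - 2 * V n := by
      by_contra hcon
      exact hD0.ne' (Nat.floor_of_nonpos (not_le.1 hcon).le)
    have h := hW.upperIntegralLE_agdTotalExplored_sub (hGm n) (hcW n) hn3
      (p := lam * ((n : ℕ) : ℝ) ^ (-α)) (η := η n) (κ := codegreeBound lam α (n : ℕ))
      (M := ((n : ℕ) : ℝ) ^ errorExponent α) (K := floorMeanDegree lam α n) (d := R n - D n)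
      (by positivity) (hη0 n) (codegreeBound_nonneg lam α hx) hD0 (hDK n)
      (by rw [hdR]; exact hKR n)
      (by rw [density_mul_card]; exact Nat.floor_le hpos)
      (by
        rw [density_mul_card, hdR]
        exact (lt_add_one _).trans_le (Nat.le_ceil _))
      (hW.measure_atypical_le hlam hα0 hα1 n.pos (hGm n) (hG n) hn2)
    refine (h.ofReal_div (hm0 n)).congr_right ?_
    rw [hdR]
    have e1 := ofReal_inv_mul_natCast (hm0 n)
    have e2 : ((n : ℕ) : ℝ≥0∞) * ENNReal.ofReal (Q n) = ENNReal.ofReal (((n : ℕ) : ℝ) * Q n) := by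
      rw [ENNReal.ofReal_mul hx, ENNReal.ofReal_natCast]
    rw [← e1, ← e1, ← e1, ← ofReal_inv_mul_ofReal (hm0 n), ← e2]
    ring

theorem exists_upperIntegralLE_agdRunningTime_sub (hlam : 0 < lam) (hα0 : 0 < α) (hα1 : α < 1)
    (hβ : 0 < β)
    (hB : Tendsto (fun n : ℕ+ => (B n : ℝ) / (β * ((n : ℕ) : ℝ) ^ α / lam)) atTop (𝓝 1))
    (hGm : ∀ n, Measurable (G n))
    (hG : ∀ n : ℕ+, HasLaw (G n) (SimpleGraph.binomialRandom (Fin n)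
      (Set.projIcc 0 1 zero_le_one (lam * ((n : ℕ) : ℝ) ^ (-α)))) μ)
    (hW : IsUniformSequence W μ)
    (hcW : ∀ n, ∀ᵐ ω ∂μ, AGDCostsDrawnFrom (G n ω) (c n ω) (v n ω) (B n) (fun k => W k ω)) :
    ∃ b : ℕ+ → ℝ≥0∞, Tendsto b atTop (𝓝 0) ∧ ∀ᶠ n : ℕ+ in atTop,
      UpperIntegralLE μ (fun ω => ENNReal.ofReal
        (|lam * ((n : ℕ) : ℝ) ^ (-α) * B n * agdRunningTime (G n ω) (c n ω) (v n ω) (B n)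
          - agdTotalExplored (G n ω) (c n ω) (v n ω) (B n)|
            / ((n : ℕ) : ℝ) ^ (1 - α))) (b n) := by
  set m : ℕ+ → ℝ := fun n => ((n : ℕ) : ℝ) ^ (1 - α) with hmdef
  set V : ℕ+ → ℝ := fun n => visitErrorBound lam α n with hVdef
  set M : ℕ+ → ℝ := fun n => ((n : ℕ) : ℝ) ^ errorExponent α with hMdef
  set r : ℕ+ → ℝ := fun n => lam * ((n : ℕ) : ℝ) ^ (-α) * B n with hrdef
  set Q : ℕ+ → ℝ := fun n => atypicalBound lam α (n : ℕ) with hQdef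
  have hm : Tendsto m atTop atTop := tendsto_pnat_rpow (sub_pos.2 hα1)
  have hm0 : ∀ n, 0 ≤ m n := fun n => by positivity
  have hr0 : ∀ n, 0 ≤ r n := fun n => by positivity
  have hQ0 : ∀ n, 0 ≤ Q n := fun n => atypicalBound_nonneg lam α _
  have hr : Tendsto r atTop (𝓝 β) := tendsto_density_mul_blockSize hlam hβ hB
  have h1 : Tendsto (fun n => (M n + 1) * (V n + r n) / m n) atTop (𝓝 0) := by
    have := ((tendsto_mul_visitErrorBound_div hlam hα0 hα1).add
      (tendsto_visitErrorBound_div hlam hα0 hα1)).add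
      (hr.mul ((tendsto_rpow_errorExponent_div hα0 hα1).add hm.inv_tendsto_atTop))
    simp only [add_zero, mul_zero] at this
    refine this.congr fun n => ?_
    simp only [Pi.inv_apply, M, V, m]
    ring
  have h2 : Tendsto (fun n : ℕ+ => (r n * (((n : ℕ) : ℝ) * ((n : ℕ) : ℝ) + 1) + ((n : ℕ) : ℝ)) * Q n
      / m n) atTop (𝓝 0) := by
    have h3 := ((hr.add_const 1).mul (tendsto_mul_atypicalBound (lam := lam) hα0 hα1)).mul
      hm.inv_tendsto_atTop
    simp only [mul_zero] at h3
    refine squeeze_zero (fun n => ?_) (fun n => ?_) h3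
    · have := hr0 n
      have := hQ0 n
      positivity
    · rw [div_eq_mul_inv, ← mul_assoc (r n + 1)]
      refine mul_le_mul_of_nonneg_right (mul_le_mul_of_nonneg_right ?_ (hQ0 n))
        (inv_nonneg.2 (hm0 n))
      have hx := one_le_pnat_cast n
      have := mul_le_mul_of_nonneg_left (by nlinarith :
        ((n : ℕ) : ℝ) * ((n : ℕ) : ℝ) + 1 ≤ (((n : ℕ) : ℝ) + 1) ^ 2) (hr0 n)
      nlinarith
  refine ⟨_, by simpa using (tendsto_ofReal_zero h1).add (tendsto_ofReal_zero h2), ?_⟩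
  filter_upwards [eventually_density_le_one lam hα0, eventually_blockSize_pos hlam hβ hB]
    with n hn2 hn3
  have hx : (0 : ℝ) ≤ ((n : ℕ) : ℝ) := Nat.cast_nonneg _
  have h := hW.upperIntegralLE_agdRunningTime_sub (hGm n) (hcW n) hn3 (by positivity)
    (degreeError_nonneg α hx) (codegreeBound_nonneg lam α hx)
    (hW.measure_atypical_le hlam hα0 hα1 n.pos (hGm n) (hG n) hn2)
  refine (h.ofReal_div (hm0 n)).congr_right ?_
  have hrn := hr0 n
  rw [mul_add, ofReal_inv_mul_ofReal (hm0 n), ← ENNReal.ofReal_mul (by positivity),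
    ofReal_inv_mul_ofReal (hm0 n)]
  rfl

end MainLimits

/-! ### From the number of explored vertices to the running time -/

section RunningTime

/-- `r = p * B` tends to `β` without being equal to it. The running time is therefore first compared
with `E / r`, and the discrepancy `1 - r / β` is charged to `P`, whose mean is of order `m`. -/
theorem abs_div_sub_div_le {S E P β r m : ℝ} (hβ : 0 < β) (hr : 0 < r) (hm : 0 < m) (hP : 0 ≤ P) :
    |S / m - P / (β * m)| ≤ r⁻¹ * (|r * S - E| / m + |E - P| / m + |1 - r / β| * (P / m)) := by
  have e : S / m - P / (β * m)
      = r⁻¹ * ((r * S - E) / m + (E - P) / m + (1 - r / β) * (P / m)) := by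
    field_simp
    ring
  rw [e, abs_mul, abs_of_pos (inv_pos.2 hr)]
  refine mul_le_mul_of_nonneg_left ((abs_add_three _ _ _).trans (le_of_eq ?_)) (inv_pos.2 hr).le
  rw [abs_div, abs_div, abs_mul, abs_of_pos hm, abs_of_nonneg (div_nonneg hP hm.le)]

theorem UpperIntegralLE.runningTime_sub {Ω : Type*} [MeasurableSpace Ω] {μ : Measure Ω}
    {S E : Ω → ℝ} {P : Ω → ℕ} {β r m : ℝ} {K : ℕ} {b₁ b₂ : ℝ≥0∞} (hβ : 0 < β) (hr : 0 < r)
    (hm : 0 < m) (h2 : UpperIntegralLE μ (fun ω => ENNReal.ofReal (|r * S ω - E ω| / m)) b₂)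
    (h1 : UpperIntegralLE μ (fun ω => ENNReal.ofReal (|E ω - P ω| / m)) b₁)
    (h3 : UpperIntegralLE μ (fun ω => (P ω : ℝ≥0∞)) (4 * K)) :
    UpperIntegralLE μ (fun ω => ENNReal.ofReal |S ω / m - P ω / (β * m)|)
      (ENNReal.ofReal r⁻¹ * (b₂ + b₁
        + ENNReal.ofReal |1 - r / β| * (4 * ENNReal.ofReal (K / m)))) := by
  have h4 := (h3.const_mul (ENNReal.ofReal m⁻¹)).const_mul (ENNReal.ofReal |1 - r / β|)
  refine (((h2.add h1).add h4).const_mul (ENNReal.ofReal r⁻¹)).mono (fun ω => ?_) |>.congr_right ?_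
  · refine (ENNReal.ofReal_le_ofReal (abs_div_sub_div_le (E := E ω) hβ hr hm
      (Nat.cast_nonneg (P ω)))).trans (le_of_eq ?_)
    rw [ofReal_inv_mul_natCast hm.le, ← ENNReal.ofReal_mul (abs_nonneg _),
      ← ENNReal.ofReal_add (by positivity) (by positivity),
      ← ENNReal.ofReal_add (by positivity) (by positivity), ← ENNReal.ofReal_mul (by positivity)]
  · rw [← ofReal_inv_mul_natCast hm.le]
    ring

theorem tendsto_runningTimeBound {ι : Type*} {l : Filter ι} {lam β : ℝ} {r k : ι → ℝ}
    {b₁ b₂ : ι → ℝ≥0∞} (hβ : 0 < β) (hr : Tendsto r l (𝓝 β)) (hk : Tendsto k l (𝓝 lam))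
    (hb₁ : Tendsto b₁ l (𝓝 0)) (hb₂ : Tendsto b₂ l (𝓝 0)) :
    Tendsto (fun i => ENNReal.ofReal (r i)⁻¹ * (b₂ i + b₁ i
      + ENNReal.ofReal |1 - r i / β| * (4 * ENNReal.ofReal (k i)))) l (𝓝 0) := by
  have h1 : Tendsto (fun i => |1 - r i / β|) l (𝓝 0) := by
    have := (tendsto_const_nhds (x := (1 : ℝ)).sub (hr.div_const β)).abs
    rwa [div_self hβ.ne', sub_self, abs_zero] at this
  have h2 := ENNReal.Tendsto.mul (tendsto_ofReal_zero h1) (Or.inr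
    (ENNReal.mul_ne_top (by simp) ENNReal.ofReal_ne_top)) (ENNReal.Tendsto.const_mul (a := 4)
      (ENNReal.tendsto_ofReal hk) (Or.inr (by simp))) (Or.inr (by simp))
  have h3 := ENNReal.Tendsto.mul (ENNReal.tendsto_ofReal (hr.inv₀ hβ.ne'))
    (Or.inr (by simp)) ((hb₂.add hb₁).add h2) (Or.inr ENNReal.ofReal_ne_top)
  simpa using h3

end RunningTime

end

theorem mainTheorem1 {Ω : Type*} [MeasurableSpace Ω] (μ : Measure Ω) [IsProbabilityMeasure μ]
    (lam α β : ℝ) (hlam : 0 < lam) (hα0 : 0 < α) (hα1 : α < 1) (hβ : 0 < β)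
    -- the block sizes
    (B : ℕ+ → ℕ)
    (hB : Tendsto (fun n : ℕ+ => (B n : ℝ) / (β * ((n : ℕ) : ℝ) ^ α / lam)) atTop (𝓝 1))
    -- the random graphs
    (G : (n : ℕ+) → Ω → SimpleGraph (Fin n)) (hGm : ∀ n, Measurable (G n))
    (hG : ∀ n : ℕ+, HasLaw (G n) (SimpleGraph.binomialRandom (Fin n)
      (Set.projIcc 0 1 zero_le_one (lam * ((n : ℕ) : ℝ) ^ (-α)))) μ)
    -- the initial vertices
    (v : (n : ℕ+) → Ω → Fin n) (hvm : ∀ n, Measurable (v n))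
    (hv : ∀ n : ℕ+, HasLaw (v n) (uniformOn (Set.univ : Set (Fin n))) μ)
    -- the costs of the vertices
    (c : (n : ℕ+) → Ω → Fin n → ℝ) (hcm : ∀ n, Measurable (c n))
    (hc : ∀ n u, HasLaw (fun ω => c n ω u) (volume.restrict (Set.Icc (0 : ℝ) 1)) μ)
    (hci : ∀ n, iIndepFun (fun u ω => c n ω u) μ)
    (hGv : ∀ n, IndepFun (G n) (v n) μ)
    (hGvc : ∀ n, IndepFun (fun ω => (G n ω, v n ω)) (c n) μ)
    -- the coupling: one i.i.d. uniform sequence, from which the costs are drawn sequentially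
    (W : ℕ → Ω → ℝ) (hWm : ∀ k, Measurable (W k))
    (hW : ∀ k, HasLaw (W k) (volume.restrict (Set.Icc (0 : ℝ) 1)) μ)
    (hWi : iIndepFun W μ)
    (hGvW : ∀ n, IndepFun (fun ω => (G n ω, v n ω)) (fun ω k => W k ω) μ)
    (hcW : ∀ n, ∀ᵐ ω ∂μ, AGDCostsDrawnFrom (G n ω) (c n ω) (v n ω) (B n) (fun k => W k ω)) :
    -- the processes `N^{(1)}, …, N^{(K)}` are independent Poisson processes
    (∀ n : ℕ+,
      (∀ i ∈ Finset.Icc 1 (floorMeanDegree lam α n), IsInhomogeneousPoisson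
        (fun t ω => recordProcess (fun k => W k ω) (floorMeanDegree lam α n) i t)
        (poissonIntensity (floorMeanDegree lam α n) i) μ) ∧
      iIndepFun (fun (i : Finset.Icc 1 (floorMeanDegree lam α n)) ω (t : ℝ≥0) =>
        recordProcess (fun k => W k ω) (floorMeanDegree lam α n) i t) μ) ∧
    -- the running time
    Tendsto (fun n : ℕ+ => ∫⁻ ω, ENNReal.ofReal
      |(agdRunningTime (G n ω) (c n ω) (v n ω) (B n) : ℝ) / ((n : ℕ) : ℝ) ^ (1 - α)
        - (poissonFunctional (floorMeanDegree lam α n)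
            (recordProcess (fun k => W k ω) (floorMeanDegree lam α n)) : ℝ)
          / (β * ((n : ℕ) : ℝ) ^ (1 - α))| ∂μ) atTop (𝓝 0) ∧
    -- the number of explored cost values
    Tendsto (fun n : ℕ+ => ∫⁻ ω, ENNReal.ofReal
      (|(agdTotalExplored (G n ω) (c n ω) (v n ω) (B n) : ℝ)
        - (poissonFunctional (floorMeanDegree lam α n)
            (recordProcess (fun k => W k ω) (floorMeanDegree lam α n)) : ℝ)|
          / ((n : ℕ) : ℝ) ^ (1 - α)) ∂μ) atTop (𝓝 0) := by
  have hW' : IsUniformSequence W μ := ⟨hWm, hW, hWi⟩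
  obtain ⟨b₁, hb₁, hE⟩ :=
    exists_upperIntegralLE_agdTotalExplored_sub hlam hα0 hα1 hβ hB hGm hG hW' hcW
  obtain ⟨b₂, hb₂, hS⟩ :=
    exists_upperIntegralLE_agdRunningTime_sub hlam hα0 hα1 hβ hB hGm hG hW' hcW
  refine ⟨fun n => ⟨fun i hi => hW'.isInhomogeneousPoisson_recordProcess hi,
    hW'.iIndepFun_recordProcess _⟩, ?_, ?_⟩
  · have hr := tendsto_density_mul_blockSize hlam hβ hB
    have hK := tendsto_floorMeanDegree_div hlam hα1
    refine tendsto_of_tendsto_of_tendsto_of_le_of_le' tendsto_const_nhds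
      (tendsto_runningTimeBound hβ hr hK hb₁ hb₂) (Eventually.of_forall fun _ => zero_le) ?_
    filter_upwards [hE, hS, hr.eventually_const_lt hβ, hK.eventually_const_lt hlam]
      with n h1 h2 hrn hKn
    have hx : (0 : ℝ) < ((n : ℕ) : ℝ) ^ (1 - α) := by
      have := one_le_pnat_cast n
      positivity
    have hK0 : 0 < floorMeanDegree lam α n := Nat.pos_of_ne_zero fun h => by simp [h] at hKn
    exact (UpperIntegralLE.runningTime_sub hβ hrn hx h2 h1
      (hW'.upperIntegralLE_poissonFunctional hK0)).lintegral_le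
  · refine tendsto_of_tendsto_of_tendsto_of_le_of_le' tendsto_const_nhds hb₁
      (Eventually.of_forall fun _ => zero_le) ?_
    filter_upwards [hE] with n hn using hn.lintegral_le
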